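/- Fractional relaxation and oscillation. For $\mu>0$ let $J^\mu f(t)=\frac1{\Gamma(\mu)}\int_0^t (t-\tau)^{\mu-1}f(\tau)\,d\tau$, and $J^0=I$. For $\alpha>0$ let $m$ be the positive integer with $m-1<\alpha\le m$, put $f^{(k)}(0^+)=\lim_{t\to0^+}f^{(k)}(t)$, and define $$D^\alpha f=\frac{d^m}{dt^m}J^{m-\alpha}f,\qquad D_*^\alpha f=D^\alpha\Big(f-\sum_{k=0}^{m-1}\frac{t^k}{k!}f^{(k)}(0^+)\Big).$$ Let $q$ be a real continuous function on $[0,\infty)$ and $c_0,c_1,\dots,c_{m-1}\in\mathbb R$. A solution of the problem $$D_*^\alpha u(t)=-u(t)+q(t)\quad(t\ge0),\qquad u^{(k)}(0^+)=c_k\quad(0\le k\le m-1)\qquad(*)$$ is a continuous $u:[0,\infty)\to\mathbb R$, of class $C^{m-1}$ on $(0,\infty)$, with these initial limits, such that $J^{m-\alpha}\big(u-\sum_{k<m}c_kt^k/k!\big)$ is of class $C^m$ on $[0,\infty)$ (one-sided derivatives at $0$) and the equation holds for all $t\ge0$. Let $E_\alpha(z)=\sum_{n\ge0}z^n/\Gamma(\alpha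 n+1)$, $e_\alpha(t)=E_\alpha(-t^\alpha)$, $u_k=J^ke_\alpha$, $u_\delta=-u_0'=-e_\alpha'$, and for $r>0$ $$K_\alpha(r)=-\frac1\pi\,\mathrm{Im}\,\frac{s^{\alpha-1}}{s^\alpha+1}\Big|_{s=re^{i\pi}},\qquad K_\alpha^k(r)=(-1)^kr^{-k}K_\alpha(r)\ (k\in\mathbb Z),\qquad f_\alpha(t)=\int_0^\infty e^{-rt}K_\alpha(r)\,dr .$$ A function $f$ is completely monotone if it is $C^\infty$ on $(0,\infty)$ and $(-1)^nf^{(n)}(t)\ge0$ for all $n\ge0$, $t>0$. 1. For every $\alpha>0$ the series defining $e_\alpha(t)$ converges for $t\ge0$, $e_\alpha$ is differentiable on $(0,\infty)$, the integral below converges for $t\ge 0$, and problem $(*)$ has exactly one solution, namely $$u(t)=\sum_{k=0}^{m-1}c_k\,u_k(t)-\int_0^tq(t-\tau)\,u_0'(\tau)\,d\tau .$$ For $\alpha=1$, $u_0(t)=e^{-t}$; for $\alpha=2$, $u_0(t)=\cos t$ and $u_1(t)=\sin t$ ($t\ge 0$). 2. For $0<\alpha<2$, $\alpha\ne1$ and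 $r>0$, $$K_\alpha(r)=\frac1\pi\,\frac{r^{\alpha-1}\sin(\alpha\pi)}{r^{2\alpha}+2r^\alpha\cos(\alpha\pi)+1},\qquad r^{2\alpha}+2r^\alpha\cos(\alpha\pi)+1>(r^\alpha-1)^2 .$$ 3. Let $0<\alpha<1$. Then $K_\alpha>0$ on $(0,\infty)$; for $t\ge0$ the integral defining $f_\alpha(t)$ converges and $e_\alpha(t)=f_\alpha(t)$; $f_\alpha=e_\alpha$ is completely monotone, positive and strictly decreasing on $[0,\infty)$, and tends to $0$ as $t\to\infty$. The solution of $(*)$ is $u(t)=c_0u_0(t)+\int_0^tq(t-\tau)u_\delta(\tau)\,d\tau$ for $t\ge 0$, where (with convergent integrals) $$u_0(t)=\int_0^\infty e^{-rt}K_\alpha^0(r)\,dr\ (t\ge0),\qquad u_\delta(t)=-\int_0^\infty e^{-rt}K_\alpha^{-1}(r)\,dr\ (t>0),$$ and $u_0(0^+)=1$, $u_\delta(0^+)=+\infty$. 4. Let $1<\alpha<2$. Then $K_\alpha<0$ on $(0,\infty)$; for $t\ge0$ the integral defining $f_\alpha(t)$ converges and $e_\alpha(t)=f_\alpha(t)+g_\alpha(t)$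 with $$g_\alpha(t)=\frac2\alpha\,e^{t\cos(\pi/\alpha)}\cos\big[t\sin(\pi/\alpha)\big],\qquad \cos(\pi/\alpha)<0<\sin(\pi/\alpha);$$ $-f_\alpha$ is completely monotone, and $f_\alpha$ is negative and strictly increasing on $[0,\infty)$ and tends to $0$ as $t\to\infty$. The solution of $(*)$ is $u(t)=c_0u_0(t)+c_1u_1(t)+\int_0^tq(t-\tau)u_\delta(\tau)\,d\tau$ for $t\ge 0$, where (with convergent integrals) $$u_0(t)=\int_0^\infty e^{-rt}K_\alpha^0(r)\,dr+\frac2\alpha e^{t\cos(\pi/\alpha)}\cos\big[t\sin(\pi/\alpha)\big]\quad(t\ge0),$$ $$u_1(t)=\int_0^\infty e^{-rt}K_\alpha^1(r)\,dr+\frac2\alpha e^{t\cos(\pi/\alpha)}\cos\big[t\sin(\pi/\alpha)-\pi/\alpha\big]\quad(t\ge0),$$ $$u_\delta(t)=-\int_0^\infty e^{-rt}K_\alpha^{-1}(r)\,dr-\frac2\alpha e^{t\cos(\pi/\alpha)}\cos\big[t\sin(\pi/\alpha)+\pi/\alpha\big]\quad(t>0),$$ and $u_0(0^+)=1$, $u_0'(0^+)=0$,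 $u_1(0^+)=0$, $u_1'(0^+)=1$, $u_\delta(0^+)=0$, $u_\delta'(0^+)=+\infty$. -/

import Mathlib

open Set Filter Topology MeasureTheory
open scoped ContDiff

noncomputable section

namespace FracRelax

/-- The Riemann–Liouville fractional integral `J^μ f (t) = Γ(μ)⁻¹ ∫₀ᵗ (t-τ)^(μ-1) f(τ) dτ` for
`μ > 0`, with the convention that `J^0` is the identity. -/
def rlIntegral (μ : ℝ) (f : ℝ → ℝ) (t : ℝ) : ℝ :=
  if μ = 0 then f t
  else (1 / Real.Gamma μ) * ∫ τ in (0 : ℝ)..t, (t - τ) ^ (μ - 1) * f τ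

/-- The Riemann–Liouville fractional derivative of order `α > 0` on `t ≥ 0`:
`D^α f = D^m J^(m-α) f` with `m - 1 < α ≤ m` (at `t = 0` the ordinary derivatives are
one-sided). -/
def rlDeriv (α : ℝ) (f : ℝ → ℝ) (t : ℝ) : ℝ :=
  iteratedDerivWithin ⌈α⌉₊ (rlIntegral (⌈α⌉₊ - α) f) (Ici 0) t

/-- The limiting value `f^(k)(0+) = lim_{t → 0+} f^(k)(t)`. -/
def initVal (f : ℝ → ℝ) (k : ℕ) : ℝ :=
  limUnder (𝓝[>] (0 : ℝ)) (iteratedDeriv k f)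

/-- `f` minus its Taylor polynomial `∑_{k<m} f^(k)(0+) t^k / k!` at the origin. -/
def taylorRemainder (m : ℕ) (f : ℝ → ℝ) (t : ℝ) : ℝ :=
  f t - ∑ k ∈ Finset.range m, t ^ k / (k.factorial : ℝ) * initVal f k

/-- The Caputo fractional derivative of order `α`, `m - 1 < α ≤ m`:
`D_*^α f = D^α (f - ∑_{k<m} f^(k)(0+) t^k / k!)`. -/
def caputoDeriv (α : ℝ) (f : ℝ → ℝ) (t : ℝ) : ℝ :=
  rlDeriv α (taylorRemainder ⌈α⌉₊ f) t

/-- `u` is a solution on `t ≥ 0` of `D_*^α u = -u + q` with initial values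
`u^(k)(0+) = c k` for `0 ≤ k ≤ m - 1`, where `m = ⌈α⌉`.  The field `caputo_exists` says that the
derivative of order `m` in the definition of `D_*^α u` exists, so that the equation is between
genuine derivatives.  Values of `u`, `q` at negative arguments play no role. -/
structure IsSolution (α : ℝ) (c : ℕ → ℝ) (q u : ℝ → ℝ) : Prop where
  continuousOn : ContinuousOn u (Ici 0)
  contDiffOn : ContDiffOn ℝ ((⌈α⌉₊ - 1 : ℕ) : ℕ∞) u (Ioi 0)
  initial : ∀ k < ⌈α⌉₊, Tendsto (iteratedDeriv k u) (𝓝[>] (0 : ℝ)) (𝓝 (c k))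
  caputo_exists : ContDiffOn ℝ (⌈α⌉₊ : ℕ∞)
    (rlIntegral (⌈α⌉₊ - α) (taylorRemainder ⌈α⌉₊ u)) (Ici 0)
  equation : ∀ t, 0 ≤ t → caputoDeriv α u t = -u t + q t

/-- The Mittag-Leffler function `E_α(z) = ∑ zⁿ / Γ(α n + 1)` (at real arguments). -/
def mittagLeffler (α z : ℝ) : ℝ :=
  ∑' n : ℕ, z ^ n / Real.Gamma (α * n + 1)

/-- `e_α(t) = E_α(-t^α)`. -/
def eFun (α t : ℝ) : ℝ := mittagLeffler α (-(t ^ α))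

/-- The fundamental solutions `u_k = J^k e_α`. -/
def fundSol (α : ℝ) (k : ℕ) : ℝ → ℝ := rlIntegral k (eFun α)

/-- The impulse-response solution `u_δ = -u_0'`. -/
def impulseSol (α t : ℝ) : ℝ := -deriv (fundSol α 0) t

/-- The function `∑_{k<m} c_k u_k(t) - ∫₀ᵗ q(t-τ) u_0'(τ) dτ`, with `m = ⌈α⌉`. -/
def solFormula (α : ℝ) (c : ℕ → ℝ) (q : ℝ → ℝ) (t : ℝ) : ℝ :=
  ∑ k ∈ Finset.range ⌈α⌉₊, c k * fundSol α k t
    - ∫ τ in (0 : ℝ)..t, q (t - τ) * deriv (fundSol α 0) τ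

/-- The basic spectral function
`K_α(r) = -π⁻¹ Im ( s^(α-1) / (s^α + 1) )` at `s = r e^{iπ}`, `r > 0`.
Here `s` is the negative number `-r` with argument `+π`, which is the argument that Mathlib's
complex power assigns to it: `s^β = r^β e^{iπβ}`. -/
def spectralK (α r : ℝ) : ℝ :=
  -(1 / Real.pi) *
    ((-(r : ℂ)) ^ ((α : ℂ) - 1) / ((-(r : ℂ)) ^ (α : ℂ) + 1)).im

/-- `K_α^k(r) = (-1)^k r^(-k) K_α(r)` for an integer `k`. -/
def spectralKk (α : ℝ) (k : ℤ) (r : ℝ) : ℝ :=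
  (-1 : ℝ) ^ k * r ^ (-k) * spectralK α r

/-- `∫₀^∞ e^{-rt} K(r) dr`. -/
def laplaceInt (K : ℝ → ℝ) (t : ℝ) : ℝ :=
  ∫ r in Ioi (0 : ℝ), Real.exp (-(r * t)) * K r

/-- The integral defining `laplaceInt K t` converges (absolutely). -/
def LaplaceConverges (K : ℝ → ℝ) (t : ℝ) : Prop :=
  IntegrableOn (fun r : ℝ => Real.exp (-(r * t)) * K r) (Ioi 0)

/-- The monotonic part `f_α(t) = ∫₀^∞ e^{-rt} K_α(r) dr`. -/
def fFun (α : ℝ) : ℝ → ℝ := laplaceInt (spectralK α)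

/-- The oscillatory part `g_α(t) = (2/α) e^{t cos(π/α)} cos(t sin(π/α))`. -/
def gFun (α t : ℝ) : ℝ :=
  (2 / α) * Real.exp (t * Real.cos (Real.pi / α)) *
    Real.cos (t * Real.sin (Real.pi / α))

/-- Complete monotonicity on `t > 0`: `(-1)^n f^(n)(t) ≥ 0` for all `n`. -/
def CompletelyMonotone (f : ℝ → ℝ) : Prop :=
  ContDiffOn ℝ ∞ f (Ioi 0) ∧
    ∀ n : ℕ, ∀ t, 0 < t → 0 ≤ (-1 : ℝ) ^ n * iteratedDeriv n f t

end FracRelax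

end

open FracRelax

/-!
The equation is solved by turning it into a Volterra equation, and the spectral formulas are
obtained by comparing Laplace transforms.

*The initial value problem.*  On continuous functions on `[0, ∞)` the operators `J^μ` form a
semigroup (`rlIntegral_rlIntegral`), because they are convolutions with the kernels
`t^(μ-1)/Γ(μ)`, which are multiplied by Euler's beta integral (`halfConv_rlKernel`), and because
convolution on the half-line is associative (`halfConv_assoc`).  A function `u` is a solution
exactly when it is continuous and `u = ∑_{k<m} c_k t^k/k! + J^α (q - u)`
(`IsSolution.volterra`, `isSolution_of_volterra`).  In one direction, the remainder
`w = u - ∑ c_k t^k/k!` is `J^(m-1) z` with `z` continuous and `z(0) = 0`, so that `J^(m-α) w` has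
vanishing derivatives of order `< m` at the origin and equals `J^m (q - u)`; applying `J^α` and
differentiating `m` times gives the Volterra equation.  Uniqueness holds since `z = -J^α z` forces
`|z| = |J^(nα) z|` for all `n`, which tends to `0`.  For existence, the functions
`t^(β-1) E_{α,β}(-t^α)` (`mlKernel`) satisfy `J^μ : β ↦ β + μ` and a two-term recursion; `e_α` and
`-e_α'` are the cases `β = 1` and `β = α`, and the recursion says that they are resolvents.

*The spectral representation.*  The Laplace transform of `e_α` is `s^(α-1)/(s^α+1)`, and that of
`f_α` is the Stieltjes transform `∫ K_α(r)/(s+r) dr`.  With `s = e^w` the cut plane becomes the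
strip `|Im w| ≤ π`, the symbol becomes `φ(w) = e^{αw}/(e^{αw}+1)`, and `r K_α(r)` is, up to a
constant, the jump of `φ` between the two boundary lines.  Cauchy's theorem on large rectangles
for `(φ(w) - φ(a))/(e^w - e^a)`, whose singularity at `a = log s` is removable, evaluates the
Stieltjes transform (`tendsto_strip_integral`).  For `1 < α < 2` the symbol has simple poles at
`± iπ/α` with residue `1/α`; subtracting `(1/α) e^w/(e^w - e^{± iπ/α})`, which is `2πi`-periodic and
does not change the jump, removes them and produces the Laplace transform of `g_α`.  The Laplace
transform is injective on continuous functions of exponential growth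
(`eq_zero_of_laplace_eq_zero`), hence `e_α = f_α` or `e_α = f_α + g_α`.

*Consequences.*  Complete monotonicity, strict monotonicity and decay of `f_α` follow from the sign
of `K_α` and differentiation under the integral sign; the formula for `u_δ` by differentiating, and
that for `u_1` by integrating, where the constant of integration is the limit `s → 0` of the
Stieltjes transform.  The limits at `0+` are read off the Mittag-Leffler series.
-/

namespace FracRelax

/-! ### Convolution on the half-line and fractional integrals -/

/-- The Laplace convolution `(f * g)(t) = ∫₀ᵗ f(t-τ) g(τ) dτ` on the half-line. -/
noncomputable def halfConv (f g : ℝ → ℝ) (t : ℝ) : ℝ := ∫ τ in (0 : ℝ)..t, f (t - τ) * g τ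

/-- Integrability on `(0, T]` for every `T`. -/
def LocIntPos (f : ℝ → ℝ) : Prop := ∀ T : ℝ, IntegrableOn f (Ioc 0 T)

/-- The kernel `t^(μ-1) / Γ(μ)` of the fractional integral of order `μ`. -/
noncomputable def rlKernel (μ t : ℝ) : ℝ := (1 / Real.Gamma μ) * t ^ (μ - 1)

lemma halfConv_congr {f f' g g' : ℝ → ℝ} {t : ℝ} (ht : 0 ≤ t)
    (hf : ∀ x, 0 < x → x ≤ t → f x = f' x) (hg : ∀ x, 0 < x → x ≤ t → g x = g' x) :
    halfConv f g t = halfConv f' g' t := by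
  unfold halfConv
  rw [intervalIntegral.integral_of_le ht, intervalIntegral.integral_of_le ht,
    integral_Ioc_eq_integral_Ioo, integral_Ioc_eq_integral_Ioo]
  refine setIntegral_congr_fun measurableSet_Ioo fun x hx => ?_
  rw [hf (t - x) (by linarith [hx.2]) (by linarith [hx.1]), hg x hx.1 hx.2.le]

lemma halfConv_comm (f g : ℝ → ℝ) (t : ℝ) : halfConv f g t = halfConv g f t := by
  unfold halfConv
  have := intervalIntegral.integral_comp_sub_left (fun x => f x * g (t - x)) t (a := 0) (b := t)
  simp only [sub_sub_cancel, sub_self, sub_zero] at this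
  rw [this]
  exact intervalIntegral.integral_congr fun x _ => mul_comm _ _

lemma halfConv_eq_convolution {f g : ℝ → ℝ} (hf : ∀ x ≤ 0, f x = 0) (hg : ∀ x ≤ 0, g x = 0) :
    halfConv f g = convolution g f (ContinuousLinearMap.mul ℝ ℝ) volume := by
  ext t
  simp only [halfConv, convolution_def, ContinuousLinearMap.mul_apply']
  rcases le_or_gt t 0 with ht | ht
  · rw [integral_eq_zero_of_ae, intervalIntegral.integral_of_ge ht]
    · rw [setIntegral_eq_zero_of_forall_eq_zero, neg_zero]
      intro x hx; rw [hg x hx.2, mul_zero]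
    · refine Eventually.of_forall fun x => ?_
      rcases le_or_gt x 0 with hx | hx
      · simp [hg x hx]
      · simp [hf (t - x) (by linarith)]
  · rw [intervalIntegral.integral_of_le ht.le, setIntegral_eq_integral_of_forall_compl_eq_zero]
    · simp only [mul_comm]
    · intro x hx
      rcases le_or_gt x 0 with hx0 | hx0
      · simp [hg x hx0]
      · rw [hf (t - x), zero_mul]
        by_contra h
        exact hx ⟨hx0, by linarith⟩

lemma LocIntPos.integrable_indicator {f : ℝ → ℝ} (hf : LocIntPos f) (T : ℝ) :
    Integrable (indicator (Ioc 0 T) f) :=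
  (integrable_indicator_iff measurableSet_Ioc).2 (hf T)

lemma locIntPos_of_continuousOn {f : ℝ → ℝ} (hf : ContinuousOn f (Ici 0)) : LocIntPos f := fun T =>
  ((hf.mono (Icc_subset_Ici_self : Icc 0 T ⊆ Ici 0)).integrableOn_Icc).mono_set (Ioc_subset_Icc_self (a := 0) (b := T))

lemma exists_bound_indicator {h : ℝ → ℝ} (hh : ContinuousOn h (Ici 0)) (T : ℝ) :
    ∃ C, ∀ x, ‖indicator (Ioc 0 T) h x‖ ≤ C := by
  obtain ⟨C, hC⟩ := isCompact_Icc.exists_bound_of_continuousOn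
    (hh.mono (Icc_subset_Ici_self : Icc 0 T ⊆ Ici 0))
  refine ⟨max C 0, fun x => ?_⟩
  by_cases hx : x ∈ Ioc 0 T
  · rw [indicator_of_mem hx]; exact (hC x ⟨hx.1.le, hx.2⟩).trans (le_max_left _ _)
  · rw [indicator_of_notMem hx]; simp

/-- The half-line convolution is associative when one of the functions is continuous on
`[0, ∞)`. -/
lemma halfConv_assoc {f g h : ℝ → ℝ} (hf : LocIntPos f) (hg : LocIntPos g)
    (hh : ContinuousOn h (Ici 0)) {t : ℝ} (ht : 0 ≤ t) :
    halfConv f (halfConv g h) t = halfConv (halfConv f g) h t := by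
  set F := indicator (Ioc 0 t) f with hF
  set G := indicator (Ioc 0 t) g with hG
  set H := indicator (Ioc 0 t) h with hH
  -- only values on `(0, t]` matter, so all functions may be truncated to that interval
  have e {k : ℝ → ℝ} (x : ℝ) (hx : 0 < x) (hxt : x ≤ t) : k x = indicator (Ioc 0 t) k x :=
    (indicator_of_mem (show x ∈ Ioc 0 t from ⟨hx, hxt⟩) k).symm
  have z {k : ℝ → ℝ} (x : ℝ) (hx : x ≤ 0) : indicator (Ioc 0 t) k x = 0 :=
    indicator_of_notMem (fun h => not_lt.2 hx h.1) k
  have hz : ∀ (k l : ℝ → ℝ) (hk : ∀ x ≤ 0, k x = 0) (hl : ∀ x ≤ 0, l x = 0), ∀ x ≤ 0,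
      halfConv k l x = 0 := by
    intro k l hk hl x hx
    unfold halfConv
    rw [intervalIntegral.integral_of_ge hx, setIntegral_eq_zero_of_forall_eq_zero, neg_zero]
    intro y hy; rw [hl y hy.2, mul_zero]
  have h1 : halfConv f (halfConv g h) t = halfConv F (halfConv G H) t :=
    halfConv_congr ht e fun x hx hxt => halfConv_congr hx.le
      (fun y hy hyx => e y hy (hyx.trans hxt)) (fun y hy hyx => e y hy (hyx.trans hxt))
  have h2 : halfConv (halfConv f g) h t = halfConv (halfConv F G) H t :=
    halfConv_congr ht (fun x hx hxt => halfConv_congr hx.le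
      (fun y hy hyx => e y hy (hyx.trans hxt)) (fun y hy hyx => e y hy (hyx.trans hxt))) e
  rw [h1, h2, halfConv_eq_convolution z (hz _ _ z z), halfConv_eq_convolution z z,
    halfConv_eq_convolution (hz _ _ z z) z, halfConv_eq_convolution z z]
  have iF := hf.integrable_indicator t
  have iG := hg.integrable_indicator t
  have iH := (locIntPos_of_continuousOn hh).integrable_indicator t
  obtain ⟨C, hC⟩ := exists_bound_indicator hh t
  refine convolution_assoc _ _ _ _ (fun x y z => mul_assoc x y z) iH.aestronglyMeasurable
    iG.aestronglyMeasurable iF.aestronglyMeasurable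
    (iH.ae_convolution_exists _ iG) (iG.norm.ae_convolution_exists _ iF.norm) ?_
  have i2 := iG.norm.integrable_convolution (ContinuousLinearMap.mul ℝ ℝ) iF.norm
  have i3 := i2.comp_sub_left t
  refine i3.bdd_mul (c := C) iH.norm.aestronglyMeasurable (Eventually.of_forall fun x => ?_)
  simpa using hC x

lemma halfConv_integrable {f h : ℝ → ℝ} (hf : LocIntPos f) (hh : ContinuousOn h (Ici 0))
    {t : ℝ} (ht : 0 ≤ t) :
    IntervalIntegrable (fun τ => f (t - τ) * h τ) volume 0 t := by
  have h1 : IntervalIntegrable (fun τ => f (t - τ)) volume 0 t := by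
    have := ((intervalIntegrable_iff_integrableOn_Ioc_of_le ht).2 (hf t)).comp_sub_left t
    simpa using this.symm
  refine h1.mul_continuousOn (hh.mono ?_)
  rw [uIcc_of_le ht]; exact Icc_subset_Ici_self

lemma halfConv_continuousOn {f h : ℝ → ℝ} (hf : LocIntPos f) (hh : ContinuousOn h (Ici 0)) :
    ContinuousOn (halfConv f h) (Ici 0) := by
  intro t0 ht0
  have ht0 : (0 : ℝ) ≤ t0 := ht0
  set T := t0 + 1
  set F : ℝ → ℝ → ℝ := fun t τ => indicator (Ioc 0 T) f τ * indicator (Ioc 0 T) h (t - τ) with hFdef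
  obtain ⟨C, hC⟩ := exists_bound_indicator hh T
  have iF := hf.integrable_indicator T
  have iH := (locIntPos_of_continuousOn hh).integrable_indicator T
  have key : ∀ t ∈ Icc 0 T, halfConv f h t = ∫ τ, F t τ := by
    intro t ht
    have z {k : ℝ → ℝ} (x : ℝ) (hx : x ≤ 0) : indicator (Ioc 0 T) k x = 0 :=
      indicator_of_notMem (fun h => not_lt.2 hx h.1) k
    have e {k : ℝ → ℝ} (x : ℝ) (hx : 0 < x) (hxt : x ≤ t) : k x = indicator (Ioc 0 T) k x :=
      (indicator_of_mem (show x ∈ Ioc 0 T from ⟨hx, hxt.trans ht.2⟩) k).symm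
    rw [halfConv_comm, halfConv_congr ht.1 e e, halfConv_eq_convolution z z]
    rfl
  have hc : ContinuousAt (fun t => ∫ τ, F t τ) t0 := by
    refine continuousAt_of_dominated (bound := fun τ => ‖indicator (Ioc 0 T) f τ‖ * C) ?_ ?_ ?_ ?_
    · exact Eventually.of_forall fun t => iF.aestronglyMeasurable.mul
        (iH.comp_sub_left t).aestronglyMeasurable
    · refine Eventually.of_forall fun t => Eventually.of_forall fun τ => ?_
      rw [norm_mul]
      exact mul_le_mul_of_nonneg_left (hC _) (norm_nonneg _)
    · exact iF.norm.mul_const C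
    -- `h(t - τ)`, cut off to `(0, T]`, is continuous at `t = t0` unless `τ = t0`
    · have : ∀ᵐ τ : ℝ, τ ≠ t0 := Measure.ae_ne volume t0
      filter_upwards [this] with τ hτ
      by_cases hτ0 : 0 < τ
      swap
      · have : ∀ t, F t τ = 0 := fun t => by
          simp only [hFdef]; rw [indicator_of_notMem (fun h => hτ0 h.1), zero_mul]
        simp only [this]; exact continuousAt_const
      refine continuousAt_const.mul ?_
      rcases lt_or_gt_of_ne hτ with hlt | hlt
      · have hmem : Ioo 0 T ∈ 𝓝 (t0 - τ) :=
          Ioo_mem_nhds (by linarith) (by simp only [T]; linarith)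
        have : ContinuousAt (indicator (Ioc 0 T) h) (t0 - τ) := by
          refine ContinuousAt.congr (f := h) ?_ ?_
          · exact hh.continuousAt (mem_of_superset hmem fun x hx => hx.1.le)
          · filter_upwards [hmem] with x hx
            rw [indicator_of_mem (Ioo_subset_Ioc_self hx)]
        exact ContinuousAt.comp (g := indicator (Ioc 0 T) h) this (by fun_prop)
      · refine ContinuousAt.congr (f := fun _ => (0 : ℝ)) continuousAt_const ?_
        filter_upwards [Iio_mem_nhds hlt] with x hx
        rw [indicator_of_notMem]
        intro h'; have := h'.1; simp only [mem_Iio] at hx; linarith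
  refine (hc.continuousWithinAt (s := Ici 0)).congr_of_eventuallyEq ?_ (key _ ⟨ht0, by simp [T]⟩)
  have : Iio T ∈ 𝓝 t0 := Iio_mem_nhds (by simp [T])
  filter_upwards [self_mem_nhdsWithin, nhdsWithin_le_nhds this] with t h1 h2
  exact key t ⟨h1, le_of_lt h2⟩

lemma halfConv_sub {f g h : ℝ → ℝ} (hf : LocIntPos f) (hg : ContinuousOn g (Ici 0))
    (hh : ContinuousOn h (Ici 0)) {t : ℝ} (ht : 0 ≤ t) :
    halfConv f (fun x => g x - h x) t = halfConv f g t - halfConv f h t := by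
  unfold halfConv
  rw [← intervalIntegral.integral_sub (halfConv_integrable hf hg ht) (halfConv_integrable hf hh ht)]
  simp only [mul_sub]

lemma halfConv_sub_left {f g h : ℝ → ℝ} (hf : LocIntPos f) (hg : LocIntPos g)
    (hh : ContinuousOn h (Ici 0)) {t : ℝ} (ht : 0 ≤ t) :
    halfConv (fun x => f x - g x) h t = halfConv f h t - halfConv g h t := by
  unfold halfConv
  rw [← intervalIntegral.integral_sub (halfConv_integrable hf hh ht) (halfConv_integrable hg hh ht)]
  simp only [sub_mul]

lemma rlKernel_locIntPos {μ : ℝ} (hμ : 0 < μ) : LocIntPos (rlKernel μ) := by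
  intro T
  rcases le_or_gt T 0 with hT | hT
  · simp [Ioc_eq_empty_of_le hT]
  · have : IntervalIntegrable (fun x : ℝ => x ^ (μ - 1)) volume 0 T :=
      intervalIntegral.intervalIntegrable_rpow' (by linarith)
    exact ((intervalIntegrable_iff_integrableOn_Ioc_of_le hT.le).1 this).const_mul _

lemma rlIntegral_eq_halfConv {μ : ℝ} (hμ : μ ≠ 0) (f : ℝ → ℝ) :
    rlIntegral μ f = halfConv (rlKernel μ) f := by
  ext t
  simp only [rlIntegral, if_neg hμ, halfConv, rlKernel, ← intervalIntegral.integral_const_mul,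
    mul_assoc]

lemma rlIntegral_zero_order (f : ℝ → ℝ) : rlIntegral 0 f = f := by
  ext t; simp [rlIntegral]

lemma rlKernel_nonneg {μ t : ℝ} (hμ : 0 < μ) (ht : 0 ≤ t) : 0 ≤ rlKernel μ t :=
  mul_nonneg (one_div_nonneg.2 (Real.Gamma_pos_of_pos hμ).le) (Real.rpow_nonneg ht _)

/-- Euler's beta integral: the fractional integration kernels form a convolution semigroup. -/
lemma halfConv_rlKernel {a b : ℝ} (ha : 0 < a) (hb : 0 < b) {t : ℝ} (ht : 0 < t) :
    halfConv (rlKernel a) (rlKernel b) t = rlKernel (a + b) t := by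
  have hB := Complex.betaIntegral_scaled b a ht
  have h1 : (∫ x in (0 : ℝ)..t, (x : ℂ) ^ ((b : ℂ) - 1) * ((t : ℂ) - x) ^ ((a : ℂ) - 1))
      = ((∫ x in (0 : ℝ)..t, x ^ (b - 1) * (t - x) ^ (a - 1) : ℝ) : ℂ) := by
    rw [← intervalIntegral.integral_ofReal]
    refine intervalIntegral.integral_congr_ae ?_
    filter_upwards with x hx
    rw [uIoc_of_le ht.le] at hx
    push_cast
    rw [Complex.ofReal_cpow hx.1.le, Complex.ofReal_cpow (by linarith [hx.2])]
    push_cast; rfl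
  rw [h1, Complex.betaIntegral_eq_Gamma_mul_div b a (by simpa) (by simpa)] at hB
  have h2 : (t : ℂ) ^ ((b : ℂ) + a - 1) *
      (Complex.Gamma b * Complex.Gamma a / Complex.Gamma (b + a)) =
      ((t ^ (b + a - 1) * (Real.Gamma b * Real.Gamma a / Real.Gamma (b + a)) : ℝ) : ℂ) := by
    rw [← Complex.ofReal_add b a, Complex.Gamma_ofReal, Complex.Gamma_ofReal, Complex.Gamma_ofReal]
    push_cast
    rw [Complex.ofReal_cpow ht.le]; push_cast; rfl
  rw [h2] at hB
  have hB' := Complex.ofReal_injective hB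
  have : halfConv (rlKernel a) (rlKernel b) t = (1 / Real.Gamma a) * (1 / Real.Gamma b) *
      ∫ x in (0 : ℝ)..t, x ^ (b - 1) * (t - x) ^ (a - 1) := by
    unfold halfConv rlKernel
    rw [← intervalIntegral.integral_const_mul]
    congr 1; ext x; ring
  rw [this, hB', rlKernel, add_comm b a]
  have := (Real.Gamma_pos_of_pos ha).ne'
  have := (Real.Gamma_pos_of_pos hb).ne'
  field_simp

lemma rlIntegral_continuousOn {μ : ℝ} (hμ : 0 ≤ μ) {f : ℝ → ℝ} (hf : ContinuousOn f (Ici 0)) :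
    ContinuousOn (rlIntegral μ f) (Ici 0) := by
  rcases hμ.eq_or_lt with rfl | h
  · rwa [rlIntegral_zero_order]
  · rw [rlIntegral_eq_halfConv h.ne']
    exact halfConv_continuousOn (rlKernel_locIntPos h) hf

lemma rlIntegral_congr {μ : ℝ} {f g : ℝ → ℝ} (h : ∀ t, 0 ≤ t → f t = g t) {t : ℝ} (ht : 0 ≤ t) :
    rlIntegral μ f t = rlIntegral μ g t := by
  by_cases hμ : μ = 0
  · simp [rlIntegral, hμ, h t ht]
  · rw [rlIntegral_eq_halfConv hμ, rlIntegral_eq_halfConv hμ]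
    exact halfConv_congr ht (fun _ _ _ => rfl) fun x hx _ => h x hx.le

/-- The semigroup law `J^a J^b = J^(a+b)`. -/
lemma rlIntegral_rlIntegral {a b : ℝ} (ha : 0 ≤ a) (hb : 0 ≤ b) {f : ℝ → ℝ}
    (hf : ContinuousOn f (Ici 0)) {t : ℝ} (ht : 0 ≤ t) :
    rlIntegral a (rlIntegral b f) t = rlIntegral (a + b) f t := by
  rcases ha.eq_or_lt with rfl | ha
  · rw [zero_add, rlIntegral_zero_order]
  rcases hb.eq_or_lt with rfl | hb
  · rw [add_zero, rlIntegral_zero_order]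
  rw [rlIntegral_eq_halfConv ha.ne', rlIntegral_eq_halfConv hb.ne',
    rlIntegral_eq_halfConv (add_pos ha hb).ne',
    halfConv_assoc (rlKernel_locIntPos ha) (rlKernel_locIntPos hb) hf ht]
  exact halfConv_congr ht (fun x hx _ => halfConv_rlKernel ha hb hx) fun _ _ _ => rfl

lemma rlIntegral_sub {μ : ℝ} (hμ : 0 ≤ μ) {f g : ℝ → ℝ} (hf : ContinuousOn f (Ici 0))
    (hg : ContinuousOn g (Ici 0)) {t : ℝ} (ht : 0 ≤ t) :
    rlIntegral μ (fun x => f x - g x) t = rlIntegral μ f t - rlIntegral μ g t := by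
  rcases hμ.eq_or_lt with rfl | h
  · simp only [rlIntegral_zero_order]
  · rw [rlIntegral_eq_halfConv h.ne', rlIntegral_eq_halfConv h.ne', rlIntegral_eq_halfConv h.ne']
    exact halfConv_sub (rlKernel_locIntPos h) hf hg ht

lemma rlIntegral_one (f : ℝ → ℝ) (t : ℝ) : rlIntegral 1 f t = ∫ τ in (0 : ℝ)..t, f τ := by
  simp [rlIntegral]

lemma rlIntegral_at_zero {μ : ℝ} (hμ : μ ≠ 0) (f : ℝ → ℝ) : rlIntegral μ f 0 = 0 := by
  simp [rlIntegral, hμ]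

/-- The fundamental theorem of calculus for `J^1` on `[0, ∞)`. -/
lemma hasDerivWithinAt_integral {f : ℝ → ℝ} (hf : ContinuousOn f (Ici 0)) {t : ℝ} (ht : 0 ≤ t) :
    HasDerivWithinAt (fun t => ∫ τ in (0 : ℝ)..t, f τ) (f t) (Ici 0) t := by
  set F : ℝ → ℝ := fun x => f (max x 0)
  have hF : Continuous F := by
    have : Continuous fun x : ℝ => max x 0 := by fun_prop
    exact hf.comp_continuous this fun x => mem_Ici.2 (le_max_right _ _)
  have hd : HasDerivAt (fun t => ∫ τ in (0 : ℝ)..t, F τ) (F t) t :=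
    intervalIntegral.integral_hasDerivAt_right (hF.intervalIntegrable _ _)
      hF.aestronglyMeasurable.stronglyMeasurableAtFilter hF.continuousAt
  have e : ∀ s, 0 ≤ s → ∫ τ in (0 : ℝ)..s, f τ = ∫ τ in (0 : ℝ)..s, F τ := fun s hs => by
    refine intervalIntegral.integral_congr fun x hx => ?_
    rw [uIcc_of_le hs] at hx
    simp [F, max_eq_left hx.1]
  have : F t = f t := by simp [F, max_eq_left ht]
  rw [← this]
  exact hd.hasDerivWithinAt.congr (fun s hs => e s hs) (e t ht)

/-- Differentiating `J^(μ+1) f` gives `J^μ f`, also one-sidedly at the origin. -/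
lemma hasDerivWithinAt_rlIntegral {μ : ℝ} (hμ : 0 ≤ μ) {f : ℝ → ℝ} (hf : ContinuousOn f (Ici 0))
    {t : ℝ} (ht : 0 ≤ t) :
    HasDerivWithinAt (rlIntegral (μ + 1) f) (rlIntegral μ f t) (Ici 0) t := by
  have e : ∀ s, 0 ≤ s → rlIntegral (μ + 1) f s = ∫ τ in (0 : ℝ)..s, rlIntegral μ f τ := by
    intro s hs
    rw [add_comm, ← rlIntegral_rlIntegral zero_le_one hμ hf hs, rlIntegral_one]
  exact (hasDerivWithinAt_integral (rlIntegral_continuousOn hμ hf) ht).congr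
    (fun s hs => e s hs) (e t ht)

/-! ### Mittag-Leffler series -/

/-- A lower bound for `Γ` with a free parameter `R`, from the part `x > R` of Euler's integral; it
replaces Stirling's formula in the convergence of the Mittag-Leffler series. -/
lemma exp_mul_rpow_le_Gamma {R y : ℝ} (hR : 0 < R) (hy : 0 ≤ y) :
    Real.exp (-R) * R ^ y ≤ Real.Gamma (y + 1) := by
  have hint := Real.GammaIntegral_convergent (show 0 < y + 1 by linarith)
  rw [Real.Gamma_eq_integral (by linarith)]
  have h1 : ∫ x in Ioi R, Real.exp (-x) * R ^ y = Real.exp (-R) * R ^ y := by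
    rw [integral_mul_const, integral_exp_neg_Ioi]
  rw [← h1]
  calc ∫ x in Ioi R, Real.exp (-x) * R ^ y
      ≤ ∫ x in Ioi R, Real.exp (-x) * x ^ (y + 1 - 1) := by
        refine setIntegral_mono_on ?_ (hint.mono_set (Ioi_subset_Ioi hR.le)) measurableSet_Ioi ?_
        · exact (integrableOn_exp_neg_Ioi R).mul_const _
        · intro x hx
          rw [add_sub_cancel_right]
          have hx : R < x := hx
          gcongr
    _ ≤ ∫ x in Ioi 0, Real.exp (-x) * x ^ (y + 1 - 1) := by
        refine setIntegral_mono_set hint ?_ (Ioi_subset_Ioi hR.le).eventuallyLE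
        filter_upwards [ae_restrict_mem measurableSet_Ioi] with x hx
        exact mul_nonneg (Real.exp_pos _).le (Real.rpow_nonneg (le_of_lt hx) _)

section

variable {α β : ℝ}

lemma order_pos (hα : 0 < α) (hβ : 0 < β) (n : ℕ) : 0 < α * n + β := by positivity

/-- The coefficients `1 / Γ(αn+β)` decay faster than any geometric sequence. -/
lemma summable_pow_div_Gamma (hα : 0 < α) (hβ : 0 < β) (ρ : ℝ) :
    Summable fun n : ℕ => ρ ^ n / Real.Gamma (α * n + β) := by
  -- `R^α = 2 (|ρ| + 1)` makes the bound below geometric with ratio `1/2`, up to the factor `αn+β`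
  set R := (2 * (|ρ| + 1)) ^ (1 / α) with hRdef
  have hρ : 0 < 2 * (|ρ| + 1) := by positivity
  have hR : 0 < R := Real.rpow_pos_of_pos hρ _
  have hRα : R ^ α = 2 * (|ρ| + 1) := by
    rw [hRdef, ← Real.rpow_mul hρ.le, one_div_mul_cancel hα.ne', Real.rpow_one]
  have hs : Summable fun n : ℕ => (Real.exp R * R ^ (-β)) * ((α * n + β) * (1 / 2 : ℝ) ^ n) := by
    refine Summable.mul_left _ ?_
    have h1 : Summable fun n : ℕ => (n : ℝ) ^ 1 * (1 / 2 : ℝ) ^ n :=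
      summable_pow_mul_geometric_of_norm_lt_one 1 (by norm_num)
    have h2 : Summable fun n : ℕ => (1 / 2 : ℝ) ^ n := summable_geometric_two
    refine ((h1.mul_left α).add (h2.mul_left β)).congr fun n => ?_
    ring
  refine hs.of_norm_bounded fun n => ?_
  have hy := order_pos hα hβ n
  have hG := exp_mul_rpow_le_Gamma hR hy.le
  rw [Real.Gamma_add_one hy.ne'] at hG
  have hΓ := Real.Gamma_pos_of_pos hy
  rw [norm_div, norm_pow, Real.norm_eq_abs, Real.norm_of_nonneg hΓ.le, div_le_iff₀ hΓ]
  have e1 : R ^ (α * n + β) = (2 * (|ρ| + 1)) ^ n * R ^ β := by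
    rw [Real.rpow_add hR, Real.rpow_mul hR.le, hRα, Real.rpow_natCast]
  rw [e1] at hG
  have e2 : (|ρ| : ℝ) ^ n ≤ (|ρ| + 1) ^ n := by gcongr; linarith
  calc |ρ| ^ n ≤ (|ρ| + 1) ^ n := e2
    _ = (Real.exp R * R ^ (-β) * (1 / 2) ^ n) * (Real.exp (-R) * ((2 * (|ρ| + 1)) ^ n * R ^ β)) := by
      rw [Real.rpow_neg hR.le, Real.exp_neg, mul_pow]
      have := (Real.rpow_pos_of_pos hR β).ne'
      field_simp
      rw [← mul_pow]; norm_num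
    _ ≤ (Real.exp R * R ^ (-β) * (1 / 2) ^ n) * ((α * n + β) * Real.Gamma (α * n + β)) := by
      gcongr
    _ = _ := by ring

/-- The entire function `x ↦ ∑ (-x)ⁿ / Γ(αn+β)`, the two-parameter Mittag-Leffler function
`E_{α,β}(-x)`. -/
noncomputable def mlSeries (α β x : ℝ) : ℝ := ∑' n : ℕ, (-x) ^ n / Real.Gamma (α * n + β)

/-- The function `t^(β-1) E_{α,β}(-t^α)`. -/
noncomputable def mlKernel (α β t : ℝ) : ℝ := t ^ (β - 1) * mlSeries α β (t ^ α)

lemma mlSeries_continuous (hα : 0 < α) (hβ : 0 < β) : Continuous (mlSeries α β) := by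
  rw [continuous_iff_continuousAt]
  intro x
  have : ContinuousOn (mlSeries α β) (Icc (x - 1) (x + 1)) := by
    refine continuousOn_tsum (u := fun n : ℕ => (|x| + 1) ^ n / Real.Gamma (α * n + β))
      (fun n => by fun_prop) (summable_pow_div_Gamma hα hβ _) fun n y hy => ?_
    rw [norm_div, norm_pow, norm_neg, Real.norm_eq_abs,
      Real.norm_of_nonneg (Real.Gamma_pos_of_pos (order_pos hα hβ n)).le]
    have : |y| ≤ |x| + 1 := by
      have h1 : |y - x| ≤ 1 := abs_le.2 ⟨by linarith [hy.1], by linarith [hy.2]⟩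
      have := abs_add_le (y - x) x
      rw [sub_add_cancel] at this
      linarith
    have := (Real.Gamma_pos_of_pos (order_pos hα hβ n))
    gcongr
  exact this.continuousAt (Icc_mem_nhds (by linarith) (by linarith))

lemma mlSeries_zero (α β : ℝ) : mlSeries α β 0 = 1 / Real.Gamma β := by
  rw [mlSeries, tsum_eq_single 0]
  · simp
  · intro n hn; simp [hn]

lemma mlSeries_recursion (hα : 0 < α) (hβ : 0 < β) (x : ℝ) :
    mlSeries α β x = 1 / Real.Gamma β - x * mlSeries α (α + β) x := by
  rw [mlSeries, (summable_pow_div_Gamma hα hβ (-x)).tsum_eq_zero_add, mlSeries, ← tsum_mul_left]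
  rw [sub_eq_add_neg, ← tsum_neg]
  congr 1
  · simp
  · refine tsum_congr fun n => ?_
    rw [show α * ((n + 1 : ℕ) : ℝ) + β = α * n + (α + β) by push_cast; ring, pow_succ]
    ring

lemma mlKernel_recursion (hα : 0 < α) (hβ : 0 < β) {t : ℝ} (ht : 0 < t) :
    mlKernel α β t = rlKernel β t - mlKernel α (α + β) t := by
  rw [mlKernel, mlSeries_recursion hα hβ, rlKernel, mlKernel, add_sub_assoc α β 1,
    Real.rpow_add ht]
  ring

lemma mlKernel_eq_tsum (α β : ℝ) {t : ℝ} (ht : 0 < t) :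
    mlKernel α β t = ∑' n : ℕ, (-1) ^ n * rlKernel (α * n + β) t := by
  rw [mlKernel, mlSeries, ← tsum_mul_left]
  refine tsum_congr fun n => ?_
  rw [rlKernel, add_sub_assoc, Real.rpow_add ht, Real.rpow_mul ht.le, Real.rpow_natCast,
    neg_pow]
  ring

lemma summable_rlKernel (hα : 0 < α) (hβ : 0 < β) {t : ℝ} (ht : 0 < t) :
    Summable fun n : ℕ => rlKernel (α * n + β) t := by
  refine ((summable_pow_div_Gamma hα hβ (t ^ α)).mul_left (t ^ (β - 1))).congr fun n => ?_
  rw [rlKernel, add_sub_assoc, Real.rpow_add ht, Real.rpow_mul ht.le, Real.rpow_natCast]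
  ring

lemma rlKernel_pos {μ t : ℝ} (hμ : 0 < μ) (ht : 0 < t) : 0 < rlKernel μ t :=
  mul_pos (one_div_pos.2 (Real.Gamma_pos_of_pos hμ)) (Real.rpow_pos_of_pos ht _)

/-- Fractional integration raises the second parameter of the Mittag-Leffler function. -/
lemma halfConv_rlKernel_mlKernel {μ : ℝ} (hμ : 0 < μ) (hα : 0 < α) (hβ : 0 < β) {t : ℝ}
    (ht : 0 < t) : halfConv (rlKernel μ) (mlKernel α β) t = mlKernel α (μ + β) t := by
  set F : ℕ → ℝ → ℝ := fun n τ => (-1) ^ n * (rlKernel μ (t - τ) * rlKernel (α * n + β) τ)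
  have hval : ∀ n : ℕ, ∫ τ in Ioc 0 t, rlKernel μ (t - τ) * rlKernel (α * n + β) τ =
      rlKernel (α * n + (μ + β)) t := fun n => by
    rw [← intervalIntegral.integral_of_le ht.le]
    rw [show α * n + (μ + β) = μ + (α * n + β) by ring,
      ← halfConv_rlKernel hμ (order_pos hα hβ n) ht, halfConv]
  -- a nonzero Bochner integral certifies integrability
  have hint : ∀ n : ℕ, IntegrableOn (fun τ => rlKernel μ (t - τ) * rlKernel (α * n + β) τ)
      (Ioc 0 t) := fun n => by
    refine Integrable.of_integral_ne_zero ?_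
    rw [hval n]
    exact (rlKernel_pos (order_pos hα (add_pos hμ hβ) n) ht).ne'
  have hnorm : ∀ n : ℕ, ∫ τ in Ioc 0 t, ‖F n τ‖ = rlKernel (α * n + (μ + β)) t := fun n => by
    rw [← hval n]
    refine setIntegral_congr_fun measurableSet_Ioc fun τ hτ => ?_
    simp only [F, norm_mul, norm_pow, norm_neg, norm_one, one_pow, one_mul]
    rw [Real.norm_of_nonneg (rlKernel_nonneg hμ (by linarith [hτ.2])),
      Real.norm_of_nonneg (rlKernel_nonneg (order_pos hα hβ n) hτ.1.le)]
  have hs := hasSum_integral_of_summable_integral_norm (μ := volume.restrict (Ioc 0 t)) (F := F)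
    (fun n => (hint n).const_mul _)
    (by simp only [hnorm]; exact summable_rlKernel hα (add_pos hμ hβ) ht)
  have h1 : halfConv (rlKernel μ) (mlKernel α β) t = ∫ τ in Ioc 0 t, ∑' n, F n τ := by
    rw [halfConv, intervalIntegral.integral_of_le ht.le]
    refine setIntegral_congr_fun measurableSet_Ioc fun τ hτ => ?_
    simp only [F]
    rw [mlKernel_eq_tsum α β hτ.1, ← tsum_mul_left]
    refine tsum_congr fun n => ?_
    ring
  rw [h1, ← hs.tsum_eq, mlKernel_eq_tsum _ _ ht]
  refine tsum_congr fun n => ?_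
  simp only [F]
  rw [integral_const_mul, hval n]

lemma mlSeries_rpow_continuous (hα : 0 < α) (hβ : 0 < β) :
    Continuous fun t : ℝ => mlSeries α β (t ^ α) :=
  (mlSeries_continuous hα hβ).comp (Real.continuous_rpow_const hα.le)

lemma mlKernel_locIntPos (hα : 0 < α) (hβ : 0 < β) : LocIntPos (mlKernel α β) := by
  intro T
  rcases le_or_gt T 0 with hT | hT
  · simp [Ioc_eq_empty_of_le hT]
  · have : IntervalIntegrable (fun x : ℝ => x ^ (β - 1)) volume 0 T :=
      intervalIntegral.intervalIntegrable_rpow' (by linarith)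
    have h2 := this.mul_continuousOn (mlSeries_rpow_continuous hα hβ).continuousOn
    exact (intervalIntegrable_iff_integrableOn_Ioc_of_le hT.le).1 h2

lemma mlKernel_continuousOn_Ioi (hα : 0 < α) (hβ : 0 < β) :
    ContinuousOn (mlKernel α β) (Ioi 0) :=
  (continuousOn_id.rpow_const fun _ hx => Or.inl (ne_of_gt hx)).mul
    (mlSeries_rpow_continuous hα hβ).continuousOn

lemma hasDerivAt_mlKernel (hα : 0 < α) (hβ : 0 < β) {t : ℝ} (ht : 0 < t) :
    HasDerivAt (mlKernel α (β + 1)) (mlKernel α β t) t := by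
  have hint : IntervalIntegrable (mlKernel α β) volume 0 t :=
    (intervalIntegrable_iff_integrableOn_Ioc_of_le ht.le).2 (mlKernel_locIntPos hα hβ t)
  have hc := mlKernel_continuousOn_Ioi hα hβ
  have hd := intervalIntegral.integral_hasDerivAt_right hint
    (hc.stronglyMeasurableAtFilter isOpen_Ioi t ht) (hc.continuousAt (Ioi_mem_nhds ht))
  refine hd.congr_of_eventuallyEq ?_
  filter_upwards [Ioi_mem_nhds ht] with s hs
  rw [add_comm, ← halfConv_rlKernel_mlKernel one_pos hα hβ hs]
  simp [halfConv, rlKernel]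

lemma tendsto_mlSeries_rpow (hα : 0 < α) (hβ : 0 < β) :
    Tendsto (fun t : ℝ => mlSeries α β (t ^ α)) (𝓝[>] 0) (𝓝 (1 / Real.Gamma β)) := by
  have := (mlSeries_rpow_continuous hα hβ).tendsto 0
  rw [Real.zero_rpow hα.ne', mlSeries_zero] at this
  exact this.mono_left nhdsWithin_le_nhds

lemma tendsto_mlKernel_zero (hα : 0 < α) (hβ : 1 < β) :
    Tendsto (mlKernel α β) (𝓝[>] 0) (𝓝 0) := by
  have h1 : Tendsto (fun t : ℝ => t ^ (β - 1)) (𝓝[>] 0) (𝓝 0) := by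
    have := (Real.continuous_rpow_const (show 0 ≤ β - 1 by linarith)).tendsto 0
    rw [Real.zero_rpow (by linarith)] at this
    exact this.mono_left nhdsWithin_le_nhds
  have h2 := h1.mul (tendsto_mlSeries_rpow hα (zero_lt_one.trans hβ))
  rw [zero_mul] at h2
  exact h2

lemma tendsto_mlKernel_atTop (hα : 0 < α) (hβ : 0 < β) (hβ1 : β < 1) :
    Tendsto (mlKernel α β) (𝓝[>] 0) atTop :=
  (tendsto_rpow_neg_nhdsGT_zero (by linarith)).atTop_mul_pos
    (one_div_pos.2 (Real.Gamma_pos_of_pos hβ)) (tendsto_mlSeries_rpow hα hβ)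

lemma eFun_eq_mlKernel (α t : ℝ) : eFun α t = mlKernel α 1 t := by
  simp [eFun, mittagLeffler, mlKernel, mlSeries]

lemma eFun_eq_mlSeries (α t : ℝ) : eFun α t = mlSeries α 1 (t ^ α) := by
  simp [eFun, mittagLeffler, mlSeries]

lemma eFun_continuous (hα : 0 < α) : Continuous (eFun α) := by
  have : eFun α = fun t => mlSeries α 1 (t ^ α) := funext (eFun_eq_mlSeries α)
  rw [this]; exact mlSeries_rpow_continuous hα one_pos

lemma eFun_zero (hα : 0 < α) : eFun α 0 = 1 := by
  rw [eFun_eq_mlSeries, Real.zero_rpow hα.ne', mlSeries_zero]; simp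

lemma hasDerivAt_eFun (hα : 0 < α) {t : ℝ} (ht : 0 < t) :
    HasDerivAt (eFun α) (-mlKernel α α t) t := by
  have h := (hasDerivAt_mlKernel hα hα ht).const_sub 1
  refine h.congr_of_eventuallyEq ?_
  filter_upwards [Ioi_mem_nhds ht] with s hs
  rw [eFun_eq_mlKernel, mlKernel_recursion hα one_pos hs]
  simp [rlKernel]

/-- `e_α` is the resolvent of the constant function `1`: it solves `e + J^α e = 1`. -/
lemma rlIntegral_eFun (hα : 0 < α) {t : ℝ} (ht : 0 ≤ t) :
    rlIntegral α (eFun α) t = 1 - eFun α t := by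
  rcases ht.eq_or_lt with rfl | ht
  · rw [rlIntegral_at_zero hα.ne', eFun_zero hα, sub_self]
  · rw [show eFun α = mlKernel α 1 from funext (eFun_eq_mlKernel α),
      rlIntegral_eq_halfConv hα.ne', halfConv_rlKernel_mlKernel hα hα one_pos ht,
      mlKernel_recursion hα one_pos ht]
    simp [rlKernel]

lemma fundSol_zero (α : ℝ) : fundSol α 0 = eFun α := by
  rw [fundSol, Nat.cast_zero, rlIntegral_zero_order]

lemma deriv_fundSol_zero (hα : 0 < α) {t : ℝ} (ht : 0 < t) :
    deriv (fundSol α 0) t = -mlKernel α α t := by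
  rw [fundSol_zero]; exact (hasDerivAt_eFun hα ht).deriv

lemma impulseSol_eq_mlKernel (hα : 0 < α) {t : ℝ} (ht : 0 < t) :
    impulseSol α t = mlKernel α α t := by
  rw [impulseSol, deriv_fundSol_zero hα ht, neg_neg]

lemma hasDerivWithinAt_fundSol_one (hα : 0 < α) {t : ℝ} (ht : 0 ≤ t) :
    HasDerivWithinAt (fundSol α 1) (eFun α t) (Ici 0) t := by
  have := hasDerivWithinAt_rlIntegral le_rfl (eFun_continuous hα).continuousOn ht
  rw [rlIntegral_zero_order, zero_add] at this
  simpa [fundSol] using this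

/-- The Mittag-Leffler function grows at most exponentially. -/
lemma abs_eFun_le (hα : 0 < α) {t : ℝ} (ht : 0 ≤ t) :
    |eFun α t| ≤ 2 * Real.exp (2 ^ (1 / α) * t) := by
  rcases ht.eq_or_lt with rfl | ht
  · rw [eFun_zero hα]; norm_num
  -- with this `R` the `n`-th term of the series is at most `e^R 2^(-n)`
  set R := 2 ^ (1 / α) * t
  have hR : 0 < R := by positivity
  have hRα : R ^ α = 2 * t ^ α := by
    rw [Real.mul_rpow (by positivity) ht.le, ← Real.rpow_mul (by norm_num),
      one_div_mul_cancel hα.ne', Real.rpow_one]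
  have hg : HasSum (fun n : ℕ => Real.exp R * (1 / 2 : ℝ) ^ n) (Real.exp R * 2) :=
    hasSum_geometric_two.mul_left _
  rw [mul_comm, eFun_eq_mlSeries, mlSeries]
  rw [← Real.norm_eq_abs]
  refine tsum_of_norm_bounded hg fun n => ?_
  have hΓ := Real.Gamma_pos_of_pos (order_pos hα one_pos n)
  have hG := exp_mul_rpow_le_Gamma hR (show 0 ≤ α * n by positivity)
  rw [norm_div, norm_pow, norm_neg, Real.norm_of_nonneg (Real.rpow_nonneg ht.le α),
    Real.norm_of_nonneg hΓ.le, div_le_iff₀ hΓ]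
  rw [Real.rpow_mul hR.le, hRα, Real.rpow_natCast] at hG
  calc (t ^ α) ^ n = Real.exp R * (1 / 2) ^ n * (Real.exp (-R) * (2 * t ^ α) ^ n) := by
        rw [Real.exp_neg, mul_pow]; field_simp; rw [← mul_pow]; norm_num
    _ ≤ _ := by gcongr

lemma laplace_rlKernel {μ s : ℝ} (hμ : 0 < μ) (hs : 0 < s) :
    ∫ t in Ioi (0 : ℝ), Real.exp (-(s * t)) * rlKernel μ t = (1 / s) ^ μ := by
  have hI := Real.integral_rpow_mul_exp_neg_mul_Ioi hμ hs
  calc _ = ∫ t in Ioi (0 : ℝ), (1 / Real.Gamma μ) * (t ^ (μ - 1) * Real.exp (-(s * t))) := by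
        congr 1; ext t; simp only [rlKernel]; ring
    _ = _ := by
        have := (Real.Gamma_pos_of_pos hμ).ne'
        rw [integral_const_mul, hI]
        field_simp

lemma integrableOn_exp_mul_rlKernel {μ s : ℝ} (hμ : 0 < μ) (hs : 0 < s) :
    IntegrableOn (fun t => Real.exp (-(s * t)) * rlKernel μ t) (Ioi 0) := by
  refine Integrable.of_integral_ne_zero ?_
  rw [laplace_rlKernel hμ hs]; positivity

/-- The Laplace transform of `e_α` is `s^(α-1) / (s^α + 1)`. -/
lemma laplace_eFun (hα : 0 < α) {s : ℝ} (hs : 1 < s) :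
    ∫ t in Ioi (0 : ℝ), Real.exp (-(s * t)) * eFun α t = s ^ (α - 1) / (s ^ α + 1) := by
  have hs0 : 0 < s := one_pos.trans hs
  have hsα : 1 < s ^ α := Real.one_lt_rpow hs hα
  have hval : ∀ n : ℕ, ∫ t in Ioi (0 : ℝ), Real.exp (-(s * t)) * rlKernel (α * n + 1) t =
      (1 / s) * (1 / s ^ α) ^ n := fun n => by
    rw [laplace_rlKernel (order_pos hα one_pos n) hs0, Real.rpow_add (by positivity),
      Real.rpow_mul (by positivity), Real.rpow_natCast, Real.rpow_one,
      Real.div_rpow zero_le_one hs0.le, Real.one_rpow, mul_comm]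
  have hnorm : ∀ n : ℕ, ∫ t in Ioi (0 : ℝ),
      ‖(-1) ^ n * (Real.exp (-(s * t)) * rlKernel (α * n + 1) t)‖ =
      (1 / s) * (1 / s ^ α) ^ n := fun n => by
    rw [← hval n]
    refine setIntegral_congr_fun measurableSet_Ioi fun t ht => ?_
    simp only [norm_mul, norm_pow, norm_neg, norm_one, one_pow, one_mul]
    rw [Real.norm_of_nonneg (Real.exp_pos _).le,
      Real.norm_of_nonneg (rlKernel_nonneg (order_pos hα one_pos n) (le_of_lt ht))]
  have hq : 1 / s ^ α < 1 := (div_lt_one (by linarith)).2 hsα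
  have hq0 : 0 ≤ 1 / s ^ α := by positivity
  have hsummable : Summable fun n : ℕ => (1 / s) * (1 / s ^ α) ^ n :=
    (summable_geometric_of_lt_one hq0 hq).mul_left _
  have hsum := hasSum_integral_of_summable_integral_norm (μ := volume.restrict (Ioi (0 : ℝ)))
    (F := fun (n : ℕ) t => (-1) ^ n * (Real.exp (-(s * t)) * rlKernel (α * n + 1) t))
    (fun n => (integrableOn_exp_mul_rlKernel (order_pos hα one_pos n) hs0).const_mul ((-1) ^ n))
    (hsummable.congr fun n => (hnorm n).symm)
  have h1 : ∫ t in Ioi (0 : ℝ), Real.exp (-(s * t)) * eFun α t = ∫ t in Ioi (0 : ℝ),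
      ∑' n : ℕ, (-1) ^ n * (Real.exp (-(s * t)) * rlKernel (α * n + 1) t) := by
    refine setIntegral_congr_fun measurableSet_Ioi fun t ht => ?_
    rw [eFun_eq_mlKernel, mlKernel_eq_tsum α 1 ht, ← tsum_mul_left]
    refine tsum_congr fun n => ?_
    ring
  have h2 : ∀ n : ℕ, ∫ t in Ioi (0 : ℝ),
      (-1) ^ n * (Real.exp (-(s * t)) * rlKernel (α * n + 1) t) =
      (1 / s) * (-(1 / s ^ α)) ^ n := fun n => by
    rw [integral_const_mul, hval, neg_pow (1 / s ^ α) n]; exact mul_left_comm _ _ _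
  have hq' : ‖-(1 / s ^ α)‖ < 1 := by rwa [norm_neg, Real.norm_of_nonneg hq0]
  have hgeo : HasSum (fun n : ℕ => (1 / s) * (-(1 / s ^ α)) ^ n)
      ((1 / s) * (1 - -(1 / s ^ α))⁻¹) := (hasSum_geometric_of_norm_lt_one hq').mul_left (1 / s)
  rw [h1, ← hsum.tsum_eq, tsum_congr h2, hgeo.tsum_eq, Real.rpow_sub hs0, Real.rpow_one,
    sub_neg_eq_add]
  have : s ^ α + 1 ≠ 0 := by positivity
  field_simp

lemma eFun_one (t : ℝ) : eFun 1 t = Real.exp (-t) := by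
  rw [eFun_eq_mlSeries, mlSeries, Real.rpow_one, Real.exp_eq_exp_ℝ, NormedSpace.exp_eq_tsum_div]
  refine tsum_congr fun n => ?_
  rw [one_mul, Real.Gamma_nat_eq_factorial]

lemma eFun_two (t : ℝ) : eFun 2 t = Real.cos t := by
  rw [eFun_eq_mlSeries, mlSeries, (Real.hasSum_cos t).tsum_eq.symm]
  refine tsum_congr fun n => ?_
  rw [show (2 : ℝ) * n + 1 = ((2 * n : ℕ) : ℝ) + 1 by push_cast; ring, Real.Gamma_nat_eq_factorial,
    Real.rpow_two, neg_pow, pow_mul]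

end

/-! ### The initial value problem as a Volterra equation -/

lemma iteratedDerivWithin_rlIntegral {f : ℝ → ℝ} (hf : ContinuousOn f (Ici 0)) {ν : ℝ} {k : ℕ}
    (hk : (k : ℝ) ≤ ν) {t : ℝ} (ht : 0 ≤ t) :
    iteratedDerivWithin k (rlIntegral ν f) (Ici 0) t = rlIntegral (ν - k) f t := by
  induction k generalizing t with
  | zero => simp
  | succ k ih =>
    push_cast at hk
    rw [iteratedDerivWithin_succ]
    have h1 := hasDerivWithinAt_rlIntegral (μ := ν - (k + 1 : ℕ)) (by push_cast; linarith) hf ht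
    rw [show ν - ((k + 1 : ℕ) : ℝ) + 1 = ν - k by push_cast; ring] at h1
    have h2 : HasDerivWithinAt (iteratedDerivWithin k (rlIntegral ν f) (Ici 0)) _ (Ici 0) t :=
      h1.congr (fun s hs => ih (by linarith) hs) (ih (by linarith) ht)
    exact h2.derivWithin (uniqueDiffOn_Ici 0 t ht)

lemma contDiffOn_rlIntegral {f : ℝ → ℝ} (hf : ContinuousOn f (Ici 0)) {ν : ℝ} {n : ℕ}
    (hn : (n : ℝ) ≤ ν) : ContDiffOn ℝ n (rlIntegral ν f) (Ici 0) := by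
  have hle : ∀ k : ℕ, k ≤ n → (k : ℝ) ≤ ν := fun k hk => (Nat.cast_le.2 hk).trans hn
  refine contDiffOn_of_continuousOn_differentiableOn_deriv (n := (n : ℕ∞)) (fun k hk => ?_)
    fun k hk => ?_
  · have hk := hle k (by exact_mod_cast hk)
    exact (rlIntegral_continuousOn (by linarith) hf).congr
      fun t ht => iteratedDerivWithin_rlIntegral hf hk ht
  · have hk' : k + 1 ≤ n := by exact_mod_cast hk
    have hk2 := hle (k + 1) hk'
    push_cast at hk2
    have h := fun t (ht : t ∈ Ici (0 : ℝ)) =>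
      hasDerivWithinAt_rlIntegral (μ := ν - k - 1) (by linarith) hf ht
    rw [sub_add_cancel] at h
    exact fun t ht => ((h t ht).congr (fun s hs => iteratedDerivWithin_rlIntegral hf
      (by linarith) hs) (iteratedDerivWithin_rlIntegral hf (by linarith) ht)).differentiableWithinAt

lemma iteratedDeriv_rlIntegral {f : ℝ → ℝ} (hf : ContinuousOn f (Ici 0)) {ν : ℝ} {k : ℕ}
    (hk : (k : ℝ) ≤ ν) {t : ℝ} (ht : 0 < t) :
    iteratedDeriv k (rlIntegral ν f) t = rlIntegral (ν - k) f t := by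
  rw [← iteratedDerivWithin_rlIntegral hf hk ht.le]
  exact (iteratedDerivWithin_eq_iteratedDeriv (uniqueDiffOn_Ici 0)
    ((contDiffOn_rlIntegral hf hk).contDiffAt (Ici_mem_nhds ht)) ht.le).symm

/-- The polynomial `∑_{k<m} c_k t^k / k!`. -/
noncomputable def initPoly (c : ℕ → ℝ) (m : ℕ) (t : ℝ) : ℝ :=
  ∑ k ∈ Finset.range m, t ^ k / (k.factorial : ℝ) * c k

lemma contDiff_initPoly (c : ℕ → ℝ) (m : ℕ) {n : WithTop ℕ∞} : ContDiff ℝ n (initPoly c m) := by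
  unfold initPoly
  fun_prop

lemma deriv_initPoly (c : ℕ → ℝ) (m : ℕ) :
    deriv (initPoly c m) = initPoly (fun k => c (k + 1)) (m - 1) := by
  cases m with
  | zero =>
    have h0 : ∀ c : ℕ → ℝ, initPoly c 0 = fun _ => 0 := fun c => by ext t; simp [initPoly]
    rw [Nat.zero_sub, h0, h0, deriv_const']
  | succ m =>
    ext t
    have : HasDerivAt (initPoly c (m + 1)) (initPoly (fun k => c (k + 1)) m t) t := by
      have h1 : initPoly c (m + 1) = fun t => (∑ k ∈ Finset.range m,
          t ^ (k + 1) / ((k + 1).factorial : ℝ) * c (k + 1)) + c 0 := by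
        ext t; simp [initPoly, Finset.sum_range_succ']
      rw [h1]
      refine HasDerivAt.add_const _ ?_
      unfold initPoly
      refine HasDerivAt.fun_sum fun k _ => ?_
      have h2 := ((hasDerivAt_pow (k + 1) t).div_const ((k + 1).factorial : ℝ)).mul_const (c (k + 1))
      refine h2.congr_deriv ?_
      rw [Nat.factorial_succ, Nat.add_sub_cancel]
      have : (k.factorial : ℝ) ≠ 0 := by positivity
      push_cast
      field_simp
    simpa using this.deriv

lemma iteratedDeriv_initPoly (c : ℕ → ℝ) (m k : ℕ) :
    iteratedDeriv k (initPoly c m) = initPoly (fun j => c (j + k)) (m - k) := by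
  induction k generalizing c m with
  | zero => simp
  | succ k ih =>
    rw [iteratedDeriv_succ', deriv_initPoly, ih]
    congr 1
    omega

lemma tendsto_iteratedDeriv_initPoly (c : ℕ → ℝ) {m k : ℕ} (hk : k < m) :
    Tendsto (iteratedDeriv k (initPoly c m)) (𝓝[>] 0) (𝓝 (c k)) := by
  rw [iteratedDeriv_initPoly]
  have h := (contDiff_initPoly (fun j => c (j + k)) (m - k) (n := 0)).continuous.tendsto 0
  have h0 : initPoly (fun j => c (j + k)) (m - k) 0 = c k := by
    obtain ⟨n, hn⟩ : ∃ n, m - k = n + 1 := ⟨m - k - 1, by omega⟩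
    simp [initPoly, hn, Finset.sum_range_succ']
  rw [h0] at h
  exact h.mono_left nhdsWithin_le_nhds

/-- Taylor's formula with vanishing initial values: a function of class `C^n` on `(0, ∞)` all of
whose derivatives up to order `n` tend to `0` at the origin is an `n`-fold integral. -/
lemma exists_eq_rlIntegral_of_tendsto_zero (n : ℕ) {w : ℝ → ℝ} (hw : ContinuousOn w (Ici 0))
    (hd : ContDiffOn ℝ n w (Ioi 0))
    (hlim : ∀ k ≤ n, Tendsto (iteratedDeriv k w) (𝓝[>] 0) (𝓝 0)) :
    ∃ z : ℝ → ℝ, ContinuousOn z (Ici 0) ∧ z 0 = 0 ∧ ∀ t, 0 ≤ t → w t = rlIntegral n z t := by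
  have hw0 : w 0 = 0 := by
    have h1 : Tendsto w (𝓝[>] 0) (𝓝 (w 0)) :=
      ((hw 0 self_mem_Ici).mono Ioi_subset_Ici_self).tendsto
    have h2 := hlim 0 (Nat.zero_le n)
    rw [iteratedDeriv_zero] at h2
    exact tendsto_nhds_unique h1 h2
  induction n generalizing w with
  | zero => exact ⟨w, hw, hw0, fun t _ => by simp [rlIntegral]⟩
  | succ n ih =>
    set w' : ℝ → ℝ := fun t => if 0 < t then deriv w t else 0 with hw'
    have e1 : ∀ t, 0 < t → w' =ᶠ[𝓝 t] deriv w := fun t ht => by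
      filter_upwards [Ioi_mem_nhds ht] with s hs
      exact if_pos hs
    have hdw : ContDiffOn ℝ n (deriv w) (Ioi 0) :=
      ((contDiffOn_succ_iff_deriv_of_isOpen isOpen_Ioi).1 (by exact_mod_cast hd)).2.2
    have hd' : ContDiffOn ℝ n w' (Ioi 0) := hdw.congr fun t ht => if_pos ht
    have hlim' : ∀ k ≤ n, Tendsto (iteratedDeriv k w') (𝓝[>] 0) (𝓝 0) := fun k hk => by
      refine (hlim (k + 1) (by omega)).congr' ?_
      filter_upwards [self_mem_nhdsWithin] with t ht
      rw [iteratedDeriv_succ', (e1 t ht).iteratedDeriv_eq]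
    have h00 : w' 0 = 0 := by simp [hw']
    have hc' : ContinuousOn w' (Ici 0) := by
      intro t ht
      rcases (show (0 : ℝ) ≤ t from ht).eq_or_lt with rfl | ht
      · have := hlim' 0 (Nat.zero_le _)
        rw [iteratedDeriv_zero] at this
        rw [← Ioi_insert, continuousWithinAt_insert_self, ContinuousWithinAt, h00]
        exact this
      · exact (hd'.continuousOn.continuousAt (Ioi_mem_nhds ht)).continuousWithinAt
    obtain ⟨z, hz, hz0, hwz⟩ := ih hc' hd' hlim' h00
    refine ⟨z, hz, hz0, fun t ht => ?_⟩
    have hdiff : ∀ x ∈ Ioo 0 t, HasDerivAt w (w' x) x := fun x hx => by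
      have h1 : DifferentiableAt ℝ w x :=
        ((hd.differentiableOn (by simp)) x hx.1).differentiableAt (Ioi_mem_nhds hx.1)
      simpa [hw', hx.1] using h1.hasDerivAt
    have hftc := intervalIntegral.integral_eq_sub_of_hasDerivAt_of_le ht
      (hw.mono Icc_subset_Ici_self) hdiff
      (ContinuousOn.intervalIntegrable_of_Icc ht (hc'.mono Icc_subset_Ici_self))
    rw [hw0, sub_zero] at hftc
    rw [← hftc, ← rlIntegral_one, rlIntegral_congr hwz ht,
      rlIntegral_rlIntegral zero_le_one n.cast_nonneg hz ht]
    push_cast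
    rw [add_comm]

section

variable {α : ℝ} {c : ℕ → ℝ} {q u : ℝ → ℝ}

lemma ceil_facts (hα : 0 < α) :
    1 ≤ ⌈α⌉₊ ∧ α ≤ ⌈α⌉₊ ∧ ((⌈α⌉₊ - 1 : ℕ) : ℝ) < α ∧
      ((⌈α⌉₊ - 1 : ℕ) : ℝ) = (⌈α⌉₊ : ℝ) - 1 := by
  have h1 : 1 ≤ ⌈α⌉₊ := Nat.one_le_ceil_iff.2 hα
  have h3 : ((⌈α⌉₊ - 1 : ℕ) : ℝ) = (⌈α⌉₊ : ℝ) - 1 := by rw [Nat.cast_sub h1, Nat.cast_one]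
  refine ⟨h1, Nat.le_ceil α, ?_, h3⟩
  rw [h3]
  linarith [Nat.ceil_lt_add_one hα.le]

lemma taylorRemainder_eq {m : ℕ}
    (h : ∀ k < m, Tendsto (iteratedDeriv k u) (𝓝[>] (0 : ℝ)) (𝓝 (c k))) :
    taylorRemainder m u = fun t => u t - initPoly c m t := by
  ext t
  unfold taylorRemainder initPoly
  congr 1
  refine Finset.sum_congr rfl fun k hk => ?_
  rw [initVal, (h k (Finset.mem_range.1 hk)).limUnder_eq]

/-- A solution of the initial value problem satisfies `u = ∑ c_k t^k/k! + J^α (q - u)`. -/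
lemma IsSolution.volterra (hα : 0 < α) (hq : ContinuousOn q (Ici 0)) (hu : IsSolution α c q u)
    {t : ℝ} (ht : 0 ≤ t) :
    u t = initPoly c ⌈α⌉₊ t + rlIntegral α (fun x => q x - u x) t := by
  obtain ⟨hm1, hαm, hmα, hcast⟩ := ceil_facts hα
  set m := ⌈α⌉₊ with hm
  set w : ℝ → ℝ := fun t => u t - initPoly c m t with hw
  have hT : taylorRemainder m u = w := taylorRemainder_eq hu.initial
  have hwc : ContinuousOn w (Ici 0) :=
    hu.continuousOn.sub (contDiff_initPoly c m (n := 0)).continuous.continuousOn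
  have hwd : ContDiffOn ℝ ((m - 1 : ℕ) : ℕ∞) w (Ioi 0) :=
    hu.contDiffOn.sub (contDiff_initPoly c m).contDiffOn
  have hwl : ∀ k ≤ m - 1, Tendsto (iteratedDeriv k w) (𝓝[>] 0) (𝓝 0) := fun k hk => by
    have h := (hu.initial k (by omega)).sub
      (tendsto_iteratedDeriv_initPoly c (show k < m by omega))
    rw [sub_self] at h
    refine h.congr' ?_
    filter_upwards [self_mem_nhdsWithin] with s hs
    refine (iteratedDeriv_fun_sub ?_ (contDiff_initPoly c m).contDiffAt).symm
    exact ((hu.contDiffOn.contDiffAt (Ioi_mem_nhds hs))).of_le (by exact_mod_cast hk)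
  obtain ⟨z, hz, hz0, hwz⟩ := exists_eq_rlIntegral_of_tendsto_zero (m - 1) hwc
    (by exact_mod_cast hwd) hwl
  have hg : ContinuousOn (fun x => q x - u x) (Ici 0) := hq.sub hu.continuousOn
  have hmα0 : 0 ≤ (m : ℝ) - α := by linarith
  -- `y = J^(m-α) w^(m-1)` is the derivative of order `m - 1` of `J^(m-α) w`
  set y := rlIntegral (m - α) z with hy
  have hyc : ContinuousOn y (Ici 0) := rlIntegral_continuousOn hmα0 hz
  have hy0 : y 0 = 0 := by
    by_cases h : (m : ℝ) - α = 0
    · rw [hy, h, rlIntegral_zero_order, hz0]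
    · exact rlIntegral_at_zero h z
  have hJ : ∀ s, 0 ≤ s → rlIntegral (m - α) w s = rlIntegral ((m - 1 : ℕ) : ℝ) y s :=
    fun s hs => by
      rw [rlIntegral_congr hwz hs, rlIntegral_rlIntegral hmα0 (Nat.cast_nonneg _) hz hs, hy,
        rlIntegral_rlIntegral (Nat.cast_nonneg _) hmα0 hz hs, add_comm]
  have hit : EqOn (iteratedDerivWithin (m - 1) (rlIntegral (m - α) w) (Ici 0)) y (Ici 0) :=
    fun s hs => by
      rw [iteratedDerivWithin_congr (s := Ici (0 : ℝ)) (fun r hr => hJ r hr) hs,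
        iteratedDerivWithin_rlIntegral hyc le_rfl hs, sub_self, rlIntegral_zero_order]
  have hdy : ∀ s ∈ Ici (0 : ℝ), HasDerivWithinAt y (q s - u s) (Ici 0) s := fun s hs => by
    have hC : ContDiffOn ℝ (m : WithTop ℕ∞) (rlIntegral (m - α) w) (Ici 0) := by
      rw [← hT]; exact_mod_cast hu.caputo_exists
    have h1 : DifferentiableWithinAt ℝ
        (iteratedDerivWithin (m - 1) (rlIntegral (m - α) w) (Ici 0)) (Ici 0) s :=
      hC.differentiableOn_iteratedDerivWithin (Nat.cast_lt.2 (by omega))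
        (uniqueDiffOn_Ici 0) s hs
    have h2 := h1.hasDerivWithinAt
    rw [← iteratedDerivWithin_succ, Nat.sub_add_cancel hm1] at h2
    have h3 := hu.equation s hs
    rw [caputoDeriv, rlDeriv, ← hm, hT] at h3
    rw [h3] at h2
    have h4 := h2.congr (fun r hr => (hit hr).symm) (hit hs).symm
    exact h4.congr_deriv (by ring)
  have hyi : ∀ s, 0 ≤ s → y s = rlIntegral 1 (fun x => q x - u x) s := fun s hs => by
    rw [rlIntegral_one, intervalIntegral.integral_eq_sub_of_hasDeriv_right_of_le hs
      (hyc.mono Icc_subset_Ici_self) (fun x hx => ?_)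
      (ContinuousOn.intervalIntegrable_of_Icc hs (hg.mono Icc_subset_Ici_self)), hy0, sub_zero]
    exact (hdy x hx.1.le).mono (Ioi_subset_Ici hx.1.le)
  have hmain : ∀ s, 0 ≤ s → rlIntegral m w s =
      rlIntegral m (rlIntegral α fun x => q x - u x) s := fun s hs => by
    have h1 : (m : ℝ) = α + (m - α) := by ring
    conv_lhs => rw [h1]
    rw [← rlIntegral_rlIntegral hα.le hmα0 hwc hs, rlIntegral_congr hJ hs]
    have h2 : ∀ r, 0 ≤ r → rlIntegral ((m - 1 : ℕ) : ℝ) y r =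
        rlIntegral m (fun x => q x - u x) r := fun r hr => by
      rw [rlIntegral_congr hyi hr, rlIntegral_rlIntegral (Nat.cast_nonneg _) zero_le_one hg hr,
        hcast, sub_add_cancel]
    rw [rlIntegral_congr h2 hs, rlIntegral_rlIntegral hα.le (Nat.cast_nonneg _) hg hs,
      rlIntegral_rlIntegral (Nat.cast_nonneg _) hα.le hg hs, add_comm]
  have h5 := iteratedDerivWithin_congr (n := m) (s := Ici (0 : ℝ)) (fun r hr => hmain r hr) ht
  rw [iteratedDerivWithin_rlIntegral hwc le_rfl ht,
    iteratedDerivWithin_rlIntegral (rlIntegral_continuousOn hα.le hg) le_rfl ht, sub_self,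
    rlIntegral_zero_order, rlIntegral_zero_order] at h5
  rw [← h5]
  simp [hw]

/-- A continuous function with `u = ∑ c_k t^k/k! + J^α (q - u)` solves the initial value
problem. -/
lemma isSolution_of_volterra (hα : 0 < α) (hq : ContinuousOn q (Ici 0))
    (hu : ContinuousOn u (Ici 0))
    (h : ∀ t, 0 ≤ t → u t = initPoly c ⌈α⌉₊ t + rlIntegral α (fun x => q x - u x) t) :
    IsSolution α c q u := by
  obtain ⟨hm1, hαm, hmα, hcast⟩ := ceil_facts hα
  set m := ⌈α⌉₊ with hm
  have hg : ContinuousOn (fun x => q x - u x) (Ici 0) := hq.sub hu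
  have hmα0 : 0 ≤ (m : ℝ) - α := by linarith
  have hinit : ∀ k < m, Tendsto (iteratedDeriv k u) (𝓝[>] (0 : ℝ)) (𝓝 (c k)) := by
    intro k hk
    have hkα : (k : ℝ) < α :=
      lt_of_le_of_lt (by exact_mod_cast (by omega : k ≤ m - 1)) hmα
    have h1 : Tendsto (rlIntegral (α - k) fun x => q x - u x) (𝓝[>] 0) (𝓝 0) := by
      have h2 := rlIntegral_continuousOn (μ := α - k) (by linarith) hg 0 self_mem_Ici
      rw [ContinuousWithinAt, rlIntegral_at_zero (by linarith)] at h2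
      exact h2.mono_left (nhdsWithin_mono _ Ioi_subset_Ici_self)
    have h3 := (tendsto_iteratedDeriv_initPoly c hk).add h1
    rw [add_zero] at h3
    refine h3.congr' ?_
    filter_upwards [self_mem_nhdsWithin] with s hs
    have h4 : u =ᶠ[𝓝 s] fun x => initPoly c m x + rlIntegral α (fun x => q x - u x) x := by
      filter_upwards [Ioi_mem_nhds hs] with r hr
      exact h r (le_of_lt hr)
    rw [h4.iteratedDeriv_eq, iteratedDeriv_fun_add (contDiff_initPoly c m).contDiffAt
      ((contDiffOn_rlIntegral hg hkα.le).contDiffAt (Ici_mem_nhds hs)),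
      iteratedDeriv_rlIntegral hg hkα.le hs]
  have hT : taylorRemainder m u = fun t => u t - initPoly c m t := taylorRemainder_eq hinit
  have hJ : ∀ s ∈ Ici (0 : ℝ), rlIntegral (m - α) (taylorRemainder m u) s =
      rlIntegral m (fun x => q x - u x) s := fun s hs => by
    have h1 : ∀ r, 0 ≤ r → taylorRemainder m u r = rlIntegral α (fun x => q x - u x) r :=
      fun r hr => by rw [hT]; simp only []; rw [h r hr]; ring
    rw [rlIntegral_congr h1 hs, rlIntegral_rlIntegral hmα0 hα.le hg hs, sub_add_cancel]
  refine ⟨hu, ?_, hinit, ?_, ?_⟩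
  · have h1 : ContDiffOn ℝ ((m - 1 : ℕ) : ℕ∞)
        (fun x => initPoly c m x + rlIntegral α (fun x => q x - u x) x) (Ioi 0) :=
      (contDiff_initPoly c m).contDiffOn.add
        ((contDiffOn_rlIntegral hg hmα.le).mono Ioi_subset_Ici_self)
    exact h1.congr fun s hs => h s (le_of_lt hs)
  · exact (contDiffOn_rlIntegral hg le_rfl).congr hJ
  · intro t ht
    rw [caputoDeriv, rlDeriv, ← hm, iteratedDerivWithin_congr hJ ht,
      iteratedDerivWithin_rlIntegral hg le_rfl ht, sub_self, rlIntegral_zero_order]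
    ring

/-- The homogeneous Volterra equation `z = -J^α z` has only the zero solution: iterating gives
`z = ± J^(nα) z`, which is bounded by a term of a convergent Mittag-Leffler series. -/
lemma eq_zero_of_eq_neg_rlIntegral (hα : 0 < α) {z : ℝ → ℝ} (hz : ContinuousOn z (Ici 0))
    (h : ∀ t, 0 ≤ t → z t = -rlIntegral α z t) {t : ℝ} (ht : 0 ≤ t) : z t = 0 := by
  rcases ht.eq_or_lt with rfl | ht
  · rw [h 0 le_rfl, rlIntegral_at_zero hα.ne', neg_zero]
  have hiter : ∀ n : ℕ, ∀ s, 0 ≤ s → |z s| = |rlIntegral (α * n) z s| := by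
    intro n
    have : ∀ s, 0 ≤ s → z s = (-1) ^ n * rlIntegral (α * n) z s := by
      induction n with
      | zero => intro s _; simp [rlIntegral]
      | succ n ih =>
        intro s hs
        have hn : 0 ≤ α * n := by positivity
        have h1 : ∀ r, 0 ≤ r → rlIntegral α z r = 0 - z r := fun r hr => by rw [h r hr]; ring
        have hc0 : ContinuousOn (fun _ : ℝ => (0 : ℝ)) (Ici 0) := continuousOn_const
        have h2 : rlIntegral (α * n) (fun _ => 0) s = 0 := by simp [rlIntegral]
        have h3 := rlIntegral_sub hn hc0 hz hs
        rw [← rlIntegral_congr h1 hs, rlIntegral_rlIntegral hn hα.le hz hs, h2, zero_sub] at h3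
        rw [show α * ((n + 1 : ℕ) : ℝ) = α * n + α by push_cast; ring, h3, ih s hs]
        ring
    intro s hs
    conv_lhs => rw [this s hs]
    rw [abs_mul, abs_pow, abs_neg, abs_one, one_pow, one_mul]
  obtain ⟨M, hM⟩ := isCompact_Icc.exists_bound_of_continuousOn
    (hz.mono (Icc_subset_Ici_self : Icc 0 t ⊆ Ici 0))
  have hbound : ∀ n : ℕ, 0 < n → |z t| ≤ M * rlKernel (α * n + 1) t := fun n hn => by
    have hn' : 0 < α * n := by positivity
    rw [hiter n t ht.le, rlIntegral_eq_halfConv hn'.ne', ← halfConv_rlKernel hn' one_pos ht,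
      halfConv, halfConv, ← intervalIntegral.integral_const_mul, ← Real.norm_eq_abs]
    have hint := (halfConv_integrable (rlKernel_locIntPos hn')
      (continuousOn_const (c := M) (s := Ici 0)) ht.le)
    refine intervalIntegral.norm_integral_le_of_norm_le ht.le ?_ ?_
    · refine Eventually.of_forall fun x hx => ?_
      rw [norm_mul, Real.norm_of_nonneg (rlKernel_nonneg hn' (by linarith [hx.2]))]
      have h1 := hM x ⟨hx.1.le, hx.2⟩
      have h2 := rlKernel_nonneg (t := t - x) hn' (by linarith [hx.2])
      calc rlKernel (α * n) (t - x) * ‖z x‖ ≤ rlKernel (α * n) (t - x) * M := by gcongr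
        _ = _ := by simp [rlKernel]; ring
    · refine hint.congr fun x _ => ?_
      simp [rlKernel]; ring
  have hlim : Tendsto (fun n : ℕ => M * rlKernel (α * n + 1) t) atTop (𝓝 0) := by
    simpa using (summable_rlKernel hα one_pos ht).tendsto_atTop_zero.const_mul M
  have h0 : |z t| ≤ 0 := ge_of_tendsto hlim
    (by filter_upwards [eventually_gt_atTop 0] with n hn using hbound n hn)
  exact abs_eq_zero.1 (le_antisymm h0 (abs_nonneg _))

lemma eq_of_isSolution (hα : 0 < α) (hq : ContinuousOn q (Ici 0)) {u v : ℝ → ℝ}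
    (hu : IsSolution α c q u) (hv : IsSolution α c q v) {t : ℝ} (ht : 0 ≤ t) : u t = v t := by
  have huc := hu.continuousOn
  have hvc := hv.continuousOn
  refine sub_eq_zero.1 (eq_zero_of_eq_neg_rlIntegral hα (z := fun s => u s - v s)
    (huc.sub hvc) (fun s hs => ?_) ht)
  have h1 := rlIntegral_sub hα.le (hq.fun_sub hvc) (hq.fun_sub huc) hs
  simp only [sub_sub_sub_cancel_left] at h1
  rw [h1, hu.volterra hα hq hs, hv.volterra hα hq hs]
  ring

/-! ### The solution formula -/

lemma rlIntegral_sum_mul {μ : ℝ} (hμ : 0 ≤ μ) {ι : Type*} (s : Finset ι) (a : ι → ℝ)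
    {f : ι → ℝ → ℝ} (hf : ∀ i, ContinuousOn (f i) (Ici 0)) {t : ℝ} (ht : 0 ≤ t) :
    rlIntegral μ (fun x => ∑ i ∈ s, a i * f i x) t = ∑ i ∈ s, a i * rlIntegral μ (f i) t := by
  rcases hμ.eq_or_lt with rfl | h
  · simp only [rlIntegral_zero_order]
  · simp only [rlIntegral_eq_halfConv h.ne', halfConv, Finset.mul_sum]
    rw [intervalIntegral.integral_finsetSum]
    · refine Finset.sum_congr rfl fun i _ => ?_
      rw [← intervalIntegral.integral_const_mul]
      refine intervalIntegral.integral_congr fun x _ => ?_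
      ring
    · intro i _
      exact halfConv_integrable (rlKernel_locIntPos h) ((hf i).const_mul (a i)) ht

lemma rlIntegral_const_one (k : ℕ) {t : ℝ} (ht : 0 ≤ t) :
    rlIntegral k (fun _ => 1) t = t ^ k / (k.factorial : ℝ) := by
  cases k with
  | zero => simp [rlIntegral]
  | succ k =>
    have hk : ((k + 1 : ℕ) : ℝ) ≠ 0 := by positivity
    rcases ht.eq_or_lt with rfl | ht
    · rw [rlIntegral_at_zero hk]; simp
    · have h1 : (fun _ : ℝ => (1 : ℝ)) = rlKernel 1 := by ext x; simp [rlKernel]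
      rw [rlIntegral_eq_halfConv hk, h1, halfConv_rlKernel (by positivity) one_pos ht, rlKernel,
        add_sub_cancel_right, Real.rpow_natCast, Real.Gamma_nat_eq_factorial]
      ring

lemma fundSol_continuousOn (hα : 0 < α) (k : ℕ) : ContinuousOn (fundSol α k) (Ici 0) :=
  rlIntegral_continuousOn k.cast_nonneg (eFun_continuous hα).continuousOn

lemma rlIntegral_fundSol (hα : 0 < α) (k : ℕ) {t : ℝ} (ht : 0 ≤ t) :
    rlIntegral α (fundSol α k) t = t ^ k / (k.factorial : ℝ) - fundSol α k t := by
  have hk : (0 : ℝ) ≤ k := k.cast_nonneg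
  have he := (eFun_continuous hα).continuousOn (s := Ici 0)
  rw [fundSol, rlIntegral_rlIntegral hα.le hk he ht, add_comm,
    ← rlIntegral_rlIntegral hk hα.le he ht,
    rlIntegral_congr (fun s hs => rlIntegral_eFun hα hs) ht,
    rlIntegral_sub hk continuousOn_const he ht, rlIntegral_const_one k ht]

lemma deriv_fundSol_locIntPos (hα : 0 < α) : LocIntPos (deriv (fundSol α 0)) := fun T =>
  (mlKernel_locIntPos hα hα T).neg.congr_fun
    (fun _ hx => (deriv_fundSol_zero hα hx.1).symm) measurableSet_Ioc

lemma solFormula_eq (hα : 0 < α) (c : ℕ → ℝ) (q : ℝ → ℝ) {t : ℝ} (ht : 0 ≤ t) :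
    solFormula α c q t =
      ∑ k ∈ Finset.range ⌈α⌉₊, c k * fundSol α k t + halfConv (mlKernel α α) q t := by
  rw [solFormula, sub_eq_add_neg]
  congr 1
  have h1 : ∫ τ in (0 : ℝ)..t, q (t - τ) * deriv (fundSol α 0) τ =
      halfConv q (fun τ => -mlKernel α α τ) t :=
    halfConv_congr ht (fun _ _ _ => rfl) fun _ hx _ => deriv_fundSol_zero hα hx
  rw [h1, halfConv_comm (mlKernel α α) q]
  simp only [halfConv, mul_neg, intervalIntegral.integral_neg, neg_neg]

lemma rlIntegral_halfConv_mlKernel (hα : 0 < α) (hq : ContinuousOn q (Ici 0)) {t : ℝ}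
    (ht : 0 ≤ t) : rlIntegral α (halfConv (mlKernel α α) q) t =
      halfConv (rlKernel α) q t - halfConv (mlKernel α α) q t := by
  rw [rlIntegral_eq_halfConv hα.ne', halfConv_assoc (rlKernel_locIntPos hα)
    (mlKernel_locIntPos hα hα) hq ht, ← halfConv_sub_left (rlKernel_locIntPos hα)
    (mlKernel_locIntPos hα hα) hq ht]
  refine halfConv_congr ht (fun _ hx _ => ?_) fun _ _ _ => rfl
  rw [halfConv_rlKernel_mlKernel hα hα hα hx, mlKernel_recursion hα hα hx, sub_sub_cancel]

lemma isSolution_solFormula (hα : 0 < α) (hq : ContinuousOn q (Ici 0)) (c : ℕ → ℝ) :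
    IsSolution α c q (solFormula α c q) := by
  have hvc : ContinuousOn (halfConv (mlKernel α α) q) (Ici 0) :=
    halfConv_continuousOn (mlKernel_locIntPos hα hα) hq
  have hSc : ContinuousOn (fun t => ∑ k ∈ Finset.range ⌈α⌉₊, c k * fundSol α k t) (Ici 0) :=
    continuousOn_finsetSum _ fun k _ => (fundSol_continuousOn hα k).const_mul _
  have hc : ContinuousOn (solFormula α c q) (Ici 0) :=
    (hSc.add hvc).congr fun t ht => solFormula_eq hα c q ht
  refine isSolution_of_volterra hα hq hc fun t ht => ?_
  have h1 : rlIntegral α (fun x => q x - solFormula α c q x) t =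
      rlIntegral α (fun x => (q x - halfConv (mlKernel α α) q x) -
        ∑ k ∈ Finset.range ⌈α⌉₊, c k * fundSol α k x) t :=
    rlIntegral_congr (fun x hx => by rw [solFormula_eq hα c q hx]; ring) ht
  rw [h1, rlIntegral_sub hα.le (hq.fun_sub hvc) hSc ht, rlIntegral_sub hα.le hq hvc ht,
    rlIntegral_halfConv_mlKernel hα hq ht, ← rlIntegral_eq_halfConv hα.ne' q,
    rlIntegral_sum_mul hα.le _ _ (fun k => fundSol_continuousOn hα k) ht,
    solFormula_eq hα c q ht]
  simp only [rlIntegral_fundSol hα _ ht, mul_sub, Finset.sum_sub_distrib, initPoly]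
  have h2 : ∑ k ∈ Finset.range ⌈α⌉₊, c k * (t ^ k / (k.factorial : ℝ)) =
      ∑ k ∈ Finset.range ⌈α⌉₊, t ^ k / (k.factorial : ℝ) * c k :=
    Finset.sum_congr rfl fun k _ => mul_comm _ _
  rw [h2]; ring

lemma intervalIntegrable_solFormula (hα : 0 < α) (hq : ContinuousOn q (Ici 0)) {t : ℝ}
    (ht : 0 ≤ t) :
    IntervalIntegrable (fun τ => q (t - τ) * deriv (fundSol α 0) τ) volume 0 t := by
  have h := (halfConv_integrable (deriv_fundSol_locIntPos hα) hq ht).comp_sub_left t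
  simp only [sub_sub_cancel, sub_self, sub_zero] at h
  exact h.symm.congr fun x _ => mul_comm _ _

end

/-! ### Laplace integrals -/

lemma exp_mul_le_aux {r t : ℝ} (ht : 0 < t) :
    r * Real.exp (-(r * t)) ≤ (2 / t) * Real.exp (-(r * (t / 2))) := by
  have h1 : r * (t / 2) ≤ Real.exp (r * (t / 2)) := by linarith [Real.add_one_le_exp (r * (t / 2))]
  have h2 : Real.exp (-(r * (t / 2))) = Real.exp (r * (t / 2)) * Real.exp (-(r * t)) := by
    rw [← Real.exp_add]; congr 1; ring
  rw [h2, ← mul_assoc]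
  refine mul_le_mul_of_nonneg_right ?_ (Real.exp_pos _).le
  calc r = (2 / t) * (r * (t / 2)) := by field_simp
    _ ≤ _ := by gcongr

lemma LaplaceConverges.aestronglyMeasurable_density {K : ℝ → ℝ} {t : ℝ} (hK : LaplaceConverges K t) :
    AEStronglyMeasurable K (volume.restrict (Ioi 0)) := by
  have h1 := Integrable.aestronglyMeasurable hK
  have h2 : Continuous fun r : ℝ => Real.exp (r * t) := by fun_prop
  refine (h2.aestronglyMeasurable.mul h1).congr (Eventually.of_forall fun r => ?_)
  simp only [Pi.mul_apply]
  rw [← mul_assoc, ← Real.exp_add, add_neg_cancel, Real.exp_zero, one_mul]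

lemma LaplaceConverges.mul_self {K : ℝ → ℝ} (hK : ∀ t, 0 < t → LaplaceConverges K t) {t : ℝ}
    (ht : 0 < t) : LaplaceConverges (fun r => r * K r) t := by
  have h1 := hK (t / 2) (by positivity)
  refine Integrable.mono' (h1.norm.const_mul (2 / t)) ?_ ?_
  · have h2 : Continuous fun r : ℝ => Real.exp (-(r * t)) := by fun_prop
    exact h2.aestronglyMeasurable.mul
      (continuous_id.aestronglyMeasurable.mul h1.aestronglyMeasurable_density)
  · filter_upwards [ae_restrict_mem measurableSet_Ioi] with r hr
    have hr : 0 < r := hr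
    rw [norm_mul, norm_mul, norm_mul, Real.norm_of_nonneg (Real.exp_pos _).le,
      Real.norm_of_nonneg (Real.exp_pos _).le, Real.norm_of_nonneg hr.le]
    have h3 := exp_mul_le_aux (r := r) ht
    calc Real.exp (-(r * t)) * (r * ‖K r‖) = r * Real.exp (-(r * t)) * ‖K r‖ := by ring
      _ ≤ (2 / t) * Real.exp (-(r * (t / 2))) * ‖K r‖ := by gcongr
      _ = _ := by ring

/-- Differentiation of a Laplace integral under the integral sign. -/
lemma hasDerivAt_laplaceInt {K : ℝ → ℝ} (hK : ∀ t, 0 < t → LaplaceConverges K t) {t : ℝ}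
    (ht : 0 < t) :
    HasDerivAt (laplaceInt K) (-laplaceInt (fun r => r * K r) t) t := by
  have hb := LaplaceConverges.mul_self hK (half_pos ht)
  have hm := (hK 1 one_pos).aestronglyMeasurable_density
  have key := hasDerivAt_integral_of_dominated_loc_of_deriv_le (μ := volume.restrict (Ioi 0))
    (F := fun x r => Real.exp (-(r * x)) * K r)
    (F' := fun x r => -(Real.exp (-(r * x)) * (r * K r)))
    (bound := fun r => ‖Real.exp (-(r * (t / 2))) * (r * K r)‖) (x₀ := t) (s := Ioi (t / 2))
    (Ioi_mem_nhds (by linarith)) ?_ (hK t ht) ?_ ?_ hb.norm ?_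
  · have h2 := key.2
    rw [integral_neg] at h2
    exact h2
  · refine Eventually.of_forall fun x => ?_
    have h2 : Continuous fun r : ℝ => Real.exp (-(r * x)) := by fun_prop
    exact h2.aestronglyMeasurable.mul hm
  · exact (Integrable.aestronglyMeasurable (LaplaceConverges.mul_self hK ht)).neg
  · filter_upwards [ae_restrict_mem measurableSet_Ioi] with r hr x hx
    have hr : 0 < r := hr
    have hx : t / 2 < x := hx
    rw [norm_neg, norm_mul, norm_mul _ (r * K r), Real.norm_of_nonneg (Real.exp_pos _).le,
      Real.norm_of_nonneg (Real.exp_pos _).le]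
    gcongr
  · refine Eventually.of_forall fun r x _ => ?_
    have h1 : HasDerivAt (fun x : ℝ => Real.exp (-(r * x))) (Real.exp (-(r * x)) * -(r * 1)) x :=
      ((hasDerivAt_id x).const_mul r).neg.exp
    exact (h1.mul_const (K r)).congr_deriv (by ring)

lemma contDiffOn_laplaceInt (n : ℕ) {K : ℝ → ℝ} (hK : ∀ t, 0 < t → LaplaceConverges K t) :
    ContDiffOn ℝ n (laplaceInt K) (Ioi 0) := by
  induction n generalizing K with
  | zero =>
    rw [Nat.cast_zero, contDiffOn_zero]
    exact fun t ht => (hasDerivAt_laplaceInt hK ht).continuousAt.continuousWithinAt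
  | succ n ih =>
    push_cast
    refine (contDiffOn_succ_iff_deriv_of_isOpen isOpen_Ioi).2
      ⟨fun t ht => (hasDerivAt_laplaceInt hK ht).differentiableAt.differentiableWithinAt,
        fun h => by simp at h, ?_⟩
    exact ((ih fun t ht => LaplaceConverges.mul_self hK ht).neg).congr
      fun t ht => (hasDerivAt_laplaceInt hK ht).deriv

lemma iteratedDeriv_laplaceInt (n : ℕ) {K : ℝ → ℝ} (hK : ∀ t, 0 < t → LaplaceConverges K t)
    {t : ℝ} (ht : 0 < t) :
    iteratedDeriv n (laplaceInt K) t = (-1) ^ n * laplaceInt (fun r => r ^ n * K r) t := by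
  induction n generalizing K t with
  | zero => simp
  | succ n ih =>
    have h1 : deriv (laplaceInt K) =ᶠ[𝓝 t] fun x => -laplaceInt (fun r => r * K r) x := by
      filter_upwards [Ioi_mem_nhds ht] with x hx
      exact (hasDerivAt_laplaceInt hK hx).deriv
    rw [iteratedDeriv_succ', h1.iteratedDeriv_eq, iteratedDeriv_fun_neg,
      ih (fun t ht => LaplaceConverges.mul_self hK ht) ht, pow_succ]
    simp only [pow_succ, mul_assoc]
    ring

/-- The easy half of Bernstein's theorem: the Laplace integral of a nonnegative density is
completely monotone. -/
lemma completelyMonotone_laplaceInt {K : ℝ → ℝ} (hK : ∀ t, 0 < t → LaplaceConverges K t)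
    (hpos : ∀ r, 0 < r → 0 ≤ K r) : CompletelyMonotone (laplaceInt K) := by
  refine ⟨contDiffOn_infty.2 fun n => contDiffOn_laplaceInt n hK, fun n t ht => ?_⟩
  rw [iteratedDeriv_laplaceInt n hK ht, ← mul_assoc, ← mul_pow, neg_one_mul, neg_neg, one_pow,
    one_mul]
  refine setIntegral_nonneg measurableSet_Ioi fun r hr => ?_
  have hr : 0 < r := hr
  have := hpos r hr
  positivity

lemma CompletelyMonotone.congr {f g : ℝ → ℝ} (hf : CompletelyMonotone f)
    (h : ∀ t, 0 < t → g t = f t) : CompletelyMonotone g := by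
  refine ⟨hf.1.congr h, fun n t ht => ?_⟩
  have : g =ᶠ[𝓝 t] f := by
    filter_upwards [Ioi_mem_nhds ht] with x hx using h x hx
  rw [this.iteratedDeriv_eq]
  exact hf.2 n t ht

lemma laplaceConverges_of_integrable {K : ℝ → ℝ} (hK : IntegrableOn K (Ioi 0)) {t : ℝ}
    (ht : 0 ≤ t) : LaplaceConverges K t := by
  have h2 : Continuous fun r : ℝ => Real.exp (-(r * t)) := by fun_prop
  refine Integrable.bdd_mul (c := 1) hK h2.aestronglyMeasurable ?_
  filter_upwards [ae_restrict_mem measurableSet_Ioi] with r hr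
  have hr : 0 < r := hr
  rw [Real.norm_of_nonneg (Real.exp_pos _).le, Real.exp_le_one_iff]
  have : 0 ≤ r * t := by positivity
  linarith

lemma exp_mul_norm_le {K : ℝ → ℝ} {r t : ℝ} (hr : 0 < r) (ht : 0 ≤ t) :
    ‖Real.exp (-(r * t)) * K r‖ ≤ ‖K r‖ := by
  rw [norm_mul, Real.norm_of_nonneg (Real.exp_pos _).le]
  refine mul_le_of_le_one_left (norm_nonneg _) ?_
  rw [Real.exp_le_one_iff]
  have : 0 ≤ r * t := by positivity
  linarith

lemma continuousOn_laplaceInt {K : ℝ → ℝ} (hK : IntegrableOn K (Ioi 0)) :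
    ContinuousOn (laplaceInt K) (Ici 0) := by
  refine continuousOn_of_dominated (bound := fun r => ‖K r‖) (fun t ht => ?_) (fun t ht => ?_)
    hK.norm ?_
  · exact (laplaceConverges_of_integrable hK ht).1
  · filter_upwards [ae_restrict_mem measurableSet_Ioi] with r hr
    exact exp_mul_norm_le hr ht
  · exact Eventually.of_forall fun r => by fun_prop

lemma tendsto_laplaceInt_atTop {K : ℝ → ℝ} (hK : IntegrableOn K (Ioi 0)) :
    Tendsto (laplaceInt K) atTop (𝓝 0) := by
  have h := tendsto_integral_filter_of_dominated_convergence (μ := volume.restrict (Ioi 0))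
    (F := fun t r => Real.exp (-(r * t)) * K r) (f := fun _ => 0) (l := atTop)
    (fun r => ‖K r‖) ?_ ?_ hK.norm ?_
  · rw [integral_zero] at h
    exact h
  · filter_upwards [eventually_ge_atTop 0] with t ht
    exact (laplaceConverges_of_integrable hK ht).1
  · filter_upwards [eventually_ge_atTop 0] with t ht
    filter_upwards [ae_restrict_mem measurableSet_Ioi] with r hr
    exact exp_mul_norm_le hr ht
  · filter_upwards [ae_restrict_mem measurableSet_Ioi] with r hr
    have h1 : Tendsto (fun t : ℝ => Real.exp (-(r * t))) atTop (𝓝 0) :=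
      Real.tendsto_exp_neg_atTop_nhds_zero.comp (tendsto_id.const_mul_atTop hr)
    simpa using h1.mul_const (K r)

lemma setIntegral_Ioi_pos {g : ℝ → ℝ} (hg : IntegrableOn g (Ioi 0)) (hpos : ∀ r, 0 < r → 0 < g r) :
    0 < ∫ r in Ioi (0 : ℝ), g r := by
  rw [setIntegral_pos_iff_support_of_nonneg_ae]
  · have : Function.support g ∩ Ioi 0 = Ioi 0 :=
      inter_eq_right.2 fun r hr => (hpos r hr).ne'
    rw [this]; simp
  · filter_upwards [ae_restrict_mem measurableSet_Ioi] with r hr using (hpos r hr).le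
  · exact hg

lemma laplaceInt_pos {K : ℝ → ℝ} (hK : IntegrableOn K (Ioi 0)) (hpos : ∀ r, 0 < r → 0 < K r)
    {t : ℝ} (ht : 0 ≤ t) : 0 < laplaceInt K t :=
  setIntegral_Ioi_pos (laplaceConverges_of_integrable hK ht)
    fun r hr => mul_pos (Real.exp_pos _) (hpos r hr)

lemma strictAntiOn_laplaceInt {K : ℝ → ℝ} (hK : IntegrableOn K (Ioi 0))
    (hpos : ∀ r, 0 < r → 0 < K r) : StrictAntiOn (laplaceInt K) (Ici 0) := by
  intro a ha b hb hab
  have hA := laplaceConverges_of_integrable hK ha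
  have hB := laplaceConverges_of_integrable hK hb
  rw [← sub_pos, laplaceInt, laplaceInt, ← integral_sub hA hB]
  refine setIntegral_Ioi_pos (hA.sub hB) fun r hr => ?_
  rw [← sub_mul]
  refine mul_pos (sub_pos.2 (Real.exp_lt_exp.2 ?_)) (hpos r hr)
  have := mul_lt_mul_of_pos_left hab hr
  linarith

/-- The Laplace transform of a Laplace integral is a Stieltjes transform. -/
lemma laplace_laplaceInt {K : ℝ → ℝ} (hK : IntegrableOn K (Ioi 0)) {s : ℝ} (hs : 0 < s) :
    ∫ t in Ioi (0 : ℝ), Real.exp (-(s * t)) * laplaceInt K t =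
      ∫ r in Ioi (0 : ℝ), K r / (s + r) := by
  have hexp : IntegrableOn (fun t : ℝ => Real.exp (-(s * t))) (Ioi 0) := by
    simpa [neg_mul] using integrableOn_exp_mul_Ioi (neg_lt_zero.2 hs) 0
  have hprod : Integrable (Function.uncurry fun t r => Real.exp (-(s * t)) *
      (Real.exp (-(r * t)) * K r))
      ((volume.restrict (Ioi (0 : ℝ))).prod (volume.restrict (Ioi (0 : ℝ)))) := by
    have h1 := Integrable.mul_prod hexp hK
    have h2 : Continuous fun p : ℝ × ℝ => Real.exp (-(p.2 * p.1)) := by fun_prop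
    have h3 := Integrable.bdd_mul (c := 1) h1 h2.aestronglyMeasurable ?_
    · refine h3.congr (Eventually.of_forall fun p => ?_)
      simp only [Function.uncurry]; ring
    · rw [Measure.prod_restrict]
      filter_upwards [ae_restrict_mem (measurableSet_Ioi.prod measurableSet_Ioi)] with p hp
      rw [Real.norm_of_nonneg (Real.exp_pos _).le, Real.exp_le_one_iff]
      have h4 : 0 < p.1 := hp.1
      have h5 : 0 < p.2 := hp.2
      have : 0 ≤ p.2 * p.1 := by positivity
      linarith
  calc _ = ∫ t in Ioi (0 : ℝ), ∫ r in Ioi (0 : ℝ), Real.exp (-(s * t)) *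
        (Real.exp (-(r * t)) * K r) := by
        simp only [laplaceInt, integral_const_mul]
    _ = ∫ r in Ioi (0 : ℝ), ∫ t in Ioi (0 : ℝ), Real.exp (-(s * t)) *
        (Real.exp (-(r * t)) * K r) := integral_integral_swap hprod
    _ = _ := by
        refine setIntegral_congr_fun measurableSet_Ioi fun r hr => ?_
        have hr : 0 < r := hr
        have h1 : ∀ t, Real.exp (-(s * t)) * (Real.exp (-(r * t)) * K r) =
            K r * Real.exp (-(s + r) * t) := fun t => by
          rw [← mul_assoc, ← Real.exp_add, mul_comm]; congr 2; ring
        simp only [h1]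
        rw [integral_const_mul, integral_exp_mul_Ioi (by linarith)]
        rw [mul_zero, Real.exp_zero, neg_div_neg_eq, mul_one_div]

/-! ### The spectral function -/

/-- `e^{αw} / (e^{αw} + 1)`, which is `s^α / (s^α + 1)` in the logarithmic coordinate
`s = e^w`. -/
noncomputable def logSymbol (α : ℝ) (w : ℂ) : ℂ :=
  Complex.exp (α * w) / (Complex.exp (α * w) + 1)

lemma spectralK_eq_logSymbol (α : ℝ) {r : ℝ} (hr : 0 < r) :
    spectralK α r = (1 / (Real.pi * r)) * (logSymbol α (Real.log r + Real.pi * Complex.I)).im := by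
  have hz : -(r : ℂ) ≠ 0 := by simpa using hr.ne'
  have hlog : Complex.log (-(r : ℂ)) = Real.log r + Real.pi * Complex.I := by
    have h1 : (-(r : ℂ)) = ((-r : ℝ) : ℂ) := by push_cast; rfl
    rw [Complex.log, h1, Complex.arg_ofReal_of_neg (by linarith), Complex.norm_real, norm_neg,
      Real.norm_of_nonneg hr.le]
  rw [spectralK, Complex.cpow_sub _ _ hz, Complex.cpow_one, Complex.cpow_def_of_ne_zero hz, hlog,
    logSymbol, mul_comm (α : ℂ)]
  set E := Complex.exp ((Real.log r + Real.pi * Complex.I) * α)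
  have h2 : E / -(r : ℂ) / (E + 1) = ((-(1 / r) : ℝ) : ℂ) * (E / (E + 1)) := by
    have : (r : ℂ) ≠ 0 := by exact_mod_cast hr.ne'
    push_cast
    rw [div_neg, neg_div, neg_mul, div_div, one_div, ← div_eq_inv_mul, div_div, mul_comm (r : ℂ)]
  rw [h2, Complex.im_ofReal_mul]
  have := Real.pi_pos
  field_simp

lemma spectralK_eq (α : ℝ) {r : ℝ} (hr : 0 < r) :
    spectralK α r = (1 / Real.pi) * (r ^ (α - 1) * Real.sin (α * Real.pi) /
        (r ^ (2 * α) + 2 * r ^ α * Real.cos (α * Real.pi) + 1)) := by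
  have hE : Complex.exp (α * (Real.log r + Real.pi * Complex.I)) =
      ((r ^ α * Real.cos (α * Real.pi) : ℝ) : ℂ) +
        ((r ^ α * Real.sin (α * Real.pi) : ℝ) : ℂ) * Complex.I := by
    rw [mul_add, Complex.exp_add, ← mul_assoc, Real.rpow_def_of_pos hr]
    rw [Complex.exp_mul_I]
    push_cast
    ring_nf
  rw [spectralK_eq_logSymbol α hr, logSymbol, hE, Real.rpow_sub hr, Real.rpow_one, two_mul,
    Real.rpow_add hr]
  set A := r ^ α
  set C := Real.cos (α * Real.pi)
  set S := Real.sin (α * Real.pi)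
  have hCS : S ^ 2 + C ^ 2 = 1 := Real.sin_sq_add_cos_sq _
  rw [Complex.div_im]
  have hN : Complex.normSq (((A * C : ℝ) : ℂ) + ((A * S : ℝ) : ℂ) * Complex.I + 1) =
      A * A + 2 * A * C + 1 := by
    rw [Complex.normSq_apply]
    simp
    linear_combination A ^ 2 * hCS
  rw [hN]
  simp
  have := Real.pi_pos
  field_simp
  ring

lemma sin_mul_pi_pos {α : ℝ} (h0 : 0 < α) (h1 : α < 1) : 0 < Real.sin (α * Real.pi) :=
  Real.sin_pos_of_pos_of_lt_pi (mul_pos h0 Real.pi_pos)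
    (by nlinarith [Real.pi_pos])

lemma sin_mul_pi_neg {α : ℝ} (h0 : 1 < α) (h1 : α < 2) : Real.sin (α * Real.pi) < 0 := by
  have h := sin_mul_pi_pos (α := α - 1) (by linarith) (by linarith)
  rw [sub_mul, one_mul, Real.sin_sub_pi] at h
  linarith

lemma sin_mul_pi_ne_zero {α : ℝ} (h0 : 0 < α) (h2 : α < 2) (h1 : α ≠ 1) :
    Real.sin (α * Real.pi) ≠ 0 := by
  rcases lt_or_gt_of_ne h1 with h | h
  · exact (sin_mul_pi_pos h0 h).ne'
  · exact (sin_mul_pi_neg h h2).ne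

section

variable {α : ℝ}

lemma sq_lt_spectral_denom (h0 : 0 < α) (h2 : α < 2) (h1 : α ≠ 1) {r : ℝ} (hr : 0 < r) :
    (r ^ α - 1) ^ 2 < r ^ (2 * α) + 2 * r ^ α * Real.cos (α * Real.pi) + 1 := by
  have hS := sin_mul_pi_ne_zero h0 h2 h1
  have hCS := Real.sin_sq_add_cos_sq (α * Real.pi)
  have hS2 : 0 < Real.sin (α * Real.pi) ^ 2 := by positivity
  have hC : -1 < Real.cos (α * Real.pi) := by
    refine lt_of_le_of_ne (Real.neg_one_le_cos _) fun h => ?_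
    rw [← h] at hCS; linarith
  have hA : 0 < r ^ α := Real.rpow_pos_of_pos hr α
  rw [two_mul, Real.rpow_add hr]
  nlinarith

lemma spectral_denom_pos (h0 : 0 < α) (h2 : α < 2) (h1 : α ≠ 1) {r : ℝ} (hr : 0 < r) :
    0 < r ^ (2 * α) + 2 * r ^ α * Real.cos (α * Real.pi) + 1 :=
  (sq_nonneg _).trans_lt (sq_lt_spectral_denom h0 h2 h1 hr)

lemma spectralK_pos (h0 : 0 < α) (h1 : α < 1) {r : ℝ} (hr : 0 < r) : 0 < spectralK α r := by
  rw [spectralK_eq α hr]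
  have hD := spectral_denom_pos h0 (by linarith) h1.ne hr
  have hS := sin_mul_pi_pos h0 h1
  have := Real.pi_pos
  exact mul_pos (by positivity) (div_pos (mul_pos (Real.rpow_pos_of_pos hr _) hS) hD)

lemma spectralK_neg (h1 : 1 < α) (h2 : α < 2) {r : ℝ} (hr : 0 < r) : spectralK α r < 0 := by
  rw [spectralK_eq α hr]
  have hD := spectral_denom_pos (by linarith) h2 h1.ne' hr
  have hS := sin_mul_pi_neg h1 h2
  have := Real.pi_pos
  exact mul_neg_of_pos_of_neg (by positivity)
    (div_neg_of_neg_of_pos (mul_neg_of_pos_of_neg (Real.rpow_pos_of_pos hr _) hS) hD)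

lemma continuousOn_spectralK (h0 : 0 < α) (h2 : α < 2) (h1 : α ≠ 1) :
    ContinuousOn (spectralK α) (Ioi 0) := by
  refine ContinuousOn.congr (f := fun r => (1 / Real.pi) * (r ^ (α - 1) * Real.sin (α * Real.pi) /
    (r ^ (2 * α) + 2 * r ^ α * Real.cos (α * Real.pi) + 1))) ?_ fun r hr => spectralK_eq α hr
  have hp : ∀ p : ℝ, ContinuousOn (fun r : ℝ => r ^ p) (Ioi 0) := fun p =>
    continuousOn_id.rpow_const fun r hr => Or.inl (ne_of_gt hr)
  refine continuousOn_const.mul (ContinuousOn.div ((hp _).mul continuousOn_const)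
    ((((hp _).add ((continuousOn_const.mul (hp _)).mul continuousOn_const))).add
      continuousOn_const) fun r hr => (spectral_denom_pos h0 h2 h1 hr).ne')

/-- Near `0` and near `∞` the spectral function is of order `r^(α-1)` and `r^(-α-1)`; both bounds
hold for all `r` because the denominator is `(r^α + cos απ)² + sin² απ` and also
`(r^α cos απ + 1)² + (r^α sin απ)²`. -/
lemma abs_spectralK_le (h0 : 0 < α) (h2 : α < 2) (h1 : α ≠ 1) {r : ℝ} (hr : 0 < r) :
    |spectralK α r| ≤ (1 / (Real.pi * |Real.sin (α * Real.pi)|)) * r ^ (α - 1) ∧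
    |spectralK α r| ≤ (1 / (Real.pi * |Real.sin (α * Real.pi)|)) * r ^ (-α - 1) := by
  have hD := spectral_denom_pos h0 h2 h1 hr
  have hA : 0 < r ^ α := Real.rpow_pos_of_pos hr α
  have hS := abs_pos.2 (sin_mul_pi_ne_zero h0 h2 h1)
  have hCS := Real.sin_sq_add_cos_sq (α * Real.pi)
  have hSS := sq_abs (Real.sin (α * Real.pi))
  have hπ := Real.pi_pos
  have hK : |spectralK α r| = (1 / Real.pi) * (r ^ (α - 1) * |Real.sin (α * Real.pi)| /
      (r ^ (2 * α) + 2 * r ^ α * Real.cos (α * Real.pi) + 1)) := by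
    rw [spectralK_eq α hr, abs_mul, abs_of_pos (by positivity : 0 < 1 / Real.pi), abs_div,
      abs_mul, abs_of_pos hD, abs_of_pos (Real.rpow_pos_of_pos hr _)]
  have e1 : r ^ (2 * α) = r ^ α * r ^ α := by rw [two_mul, Real.rpow_add hr]
  have e2 : r ^ (-α - 1) = r ^ (α - 1) / (r ^ α * r ^ α) := by
    rw [← Real.rpow_add hr, ← Real.rpow_sub hr]; congr 1; ring
  have hP : 0 < r ^ (α - 1) := Real.rpow_pos_of_pos hr _
  rw [e1] at hK hD
  rw [hK, e2]
  set A := r ^ α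
  set C := Real.cos (α * Real.pi)
  set T := |Real.sin (α * Real.pi)|
  rw [← hSS] at hCS
  have b1 : T ^ 2 ≤ A * A + 2 * A * C + 1 := by nlinarith [sq_nonneg (A + C)]
  have b2 : A * A * T ^ 2 ≤ A * A + 2 * A * C + 1 := by
    have e : A * A + 2 * A * C + 1 - A * A * T ^ 2 = (A * C + 1) ^ 2 := by
      linear_combination (-A ^ 2) * hCS
    nlinarith [sq_nonneg (A * C + 1)]
  constructor
  · calc 1 / Real.pi * (r ^ (α - 1) * T / (A * A + 2 * A * C + 1))
        ≤ 1 / Real.pi * (r ^ (α - 1) * T / T ^ 2) := by gcongr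
      _ = _ := by field_simp
  · calc 1 / Real.pi * (r ^ (α - 1) * T / (A * A + 2 * A * C + 1))
        ≤ 1 / Real.pi * (r ^ (α - 1) * T / (A * A * T ^ 2)) := by gcongr
      _ = _ := by field_simp

lemma integrableOn_rpow_mul_spectralK (h0 : 0 < α) (h2 : α < 2) (h1 : α ≠ 1) {p : ℝ}
    (hp : -α < p) (hp' : p < α) :
    IntegrableOn (fun r => r ^ p * spectralK α r) (Ioi 0) := by
  set C := 1 / (Real.pi * |Real.sin (α * Real.pi)|)
  have hc : ContinuousOn (fun r => r ^ p * spectralK α r) (Ioi 0) :=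
    (continuousOn_id.rpow_const fun r hr => Or.inl (ne_of_gt hr)).mul
      (continuousOn_spectralK h0 h2 h1)
  have hbound : ∀ b r : ℝ, 0 < r → |spectralK α r| ≤ C * r ^ (b - 1) →
      ‖r ^ p * spectralK α r‖ ≤ C * r ^ (p + b - 1) := fun b r hr h => by
    have hP : 0 < r ^ p := Real.rpow_pos_of_pos hr p
    rw [norm_mul, Real.norm_of_nonneg hP.le, Real.norm_eq_abs, add_sub_assoc, Real.rpow_add hr]
    calc r ^ p * |spectralK α r| ≤ r ^ p * (C * r ^ (b - 1)) := by gcongr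
      _ = _ := by ring
  rw [← Ioc_union_Ioi_eq_Ioi zero_le_one]
  refine IntegrableOn.union ?_ ?_
  · have hi : IntegrableOn (fun r : ℝ => C * r ^ (p + α - 1)) (Ioc 0 1) :=
      ((intervalIntegrable_iff_integrableOn_Ioc_of_le zero_le_one).1
        (intervalIntegral.intervalIntegrable_rpow' (by linarith))).const_mul C
    refine Integrable.mono' hi
      ((hc.mono fun r hr => hr.1).aestronglyMeasurable measurableSet_Ioc) ?_
    filter_upwards [ae_restrict_mem measurableSet_Ioc] with r hr
    exact hbound α r hr.1 (abs_spectralK_le h0 h2 h1 hr.1).1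
  · have hi : IntegrableOn (fun r : ℝ => C * r ^ (p + -α - 1)) (Ioi 1) :=
      (integrableOn_Ioi_rpow_of_lt (by linarith) one_pos).const_mul C
    have hsub : Ioi (1 : ℝ) ⊆ Ioi 0 := Ioi_subset_Ioi zero_le_one
    refine Integrable.mono' hi ((hc.mono hsub).aestronglyMeasurable measurableSet_Ioi) ?_
    filter_upwards [ae_restrict_mem measurableSet_Ioi] with r hr
    exact hbound (-α) r (hsub hr) (abs_spectralK_le h0 h2 h1 (hsub hr)).2

lemma integrableOn_spectralK (h0 : 0 < α) (h2 : α < 2) (h1 : α ≠ 1) :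
    IntegrableOn (spectralK α) (Ioi 0) := by
  simpa using integrableOn_rpow_mul_spectralK h0 h2 h1 (p := 0) (by linarith) h0

lemma spectralKk_zero (α : ℝ) : spectralKk α 0 = spectralK α := by
  ext r; simp [spectralKk]

lemma spectralKk_one (α r : ℝ) : spectralKk α 1 r = -(r ^ (-1 : ℝ) * spectralK α r) := by
  simp [spectralKk, Real.rpow_neg_one]

lemma spectralKk_neg_one (α r : ℝ) : spectralKk α (-1) r = -(r * spectralK α r) := by
  simp [spectralKk]

lemma integrableOn_spectralKk_one (h1 : 1 < α) (h2 : α < 2) :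
    IntegrableOn (spectralKk α 1) (Ioi 0) := by
  have h := (integrableOn_rpow_mul_spectralK (by linarith) h2 h1.ne' (p := -1) (by linarith)
    (by linarith)).neg
  exact h.congr (Eventually.of_forall fun r => (spectralKk_one α r).symm)

/-! ### Injectivity of the Laplace transform -/

/-- A continuous function of exponential growth on `[0, ∞)` whose Laplace transform vanishes on a
half-line is zero.  With `x = e^{-t}` the hypothesis says that all moments vanish, and the
Weierstrass approximation theorem applies. -/
lemma eq_zero_of_laplace_eq_zero {h : ℝ → ℝ} (hc : ContinuousOn h (Ici 0)) {C a : ℝ}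
    (hb : ∀ t, 0 ≤ t → |h t| ≤ C * Real.exp (a * t))
    (hL : ∀ s, a < s → ∫ t in Ioi (0 : ℝ), Real.exp (-(s * t)) * h t = 0) {t : ℝ} (ht : 0 ≤ t) :
    h t = 0 := by
  set φ : ℝ → ℝ := fun t => Real.exp (-((a + 1) * t)) * h t with hφ
  have hφc : ContinuousOn φ (Ici 0) := by
    have : Continuous fun t : ℝ => Real.exp (-((a + 1) * t)) := by fun_prop
    exact this.continuousOn.mul hc
  have hφb : ∀ t, 0 ≤ t → |φ t| ≤ C * Real.exp (-t) := fun t ht => by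
    rw [hφ, abs_mul, abs_of_pos (Real.exp_pos _)]
    calc Real.exp (-((a + 1) * t)) * |h t|
        ≤ Real.exp (-((a + 1) * t)) * (C * Real.exp (a * t)) := by gcongr; exact hb t ht
      _ = C * (Real.exp (-((a + 1) * t)) * Real.exp (a * t)) := by ring
      _ = _ := by rw [← Real.exp_add]; congr 2; ring
  have hC : 0 ≤ C := by
    have := (abs_nonneg _).trans (hφb 0 le_rfl); simpa using this
  have hφC : ∀ t, 0 ≤ t → |φ t| ≤ C := fun t ht =>
    (hφb t ht).trans (mul_le_of_le_one_right hC (by rw [Real.exp_le_one_iff]; linarith))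
  have hexp : IntegrableOn (fun t : ℝ => Real.exp (-t)) (Ioi 0) := integrableOn_exp_neg_Ioi 0
  have hmeas : AEStronglyMeasurable φ (volume.restrict (Ioi 0)) :=
    (hφc.mono Ioi_subset_Ici_self).aestronglyMeasurable measurableSet_Ioi
  -- products of `e^{-t} φ` with bounded continuous functions are integrable
  have hint : ∀ g : ℝ → ℝ, ContinuousOn g (Ioi 0) → (∃ B, ∀ t, 0 < t → |g t| ≤ B) →
      IntegrableOn (fun t => g t * (Real.exp (-t) * φ t)) (Ioi 0) := by
    rintro g hg ⟨B, hB⟩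
    have h1 : IntegrableOn (fun t => Real.exp (-t) * φ t) (Ioi 0) := by
      refine Integrable.mono' (hexp.const_mul C)
        ((by fun_prop : Continuous fun t : ℝ => Real.exp (-t)).aestronglyMeasurable.mul hmeas) ?_
      filter_upwards [ae_restrict_mem measurableSet_Ioi] with t ht
      rw [norm_mul, Real.norm_of_nonneg (Real.exp_pos _).le, mul_comm]
      gcongr
      exact hφC t (le_of_lt ht)
    refine Integrable.bdd_mul (c := B) h1 (hg.aestronglyMeasurable measurableSet_Ioi) ?_
    filter_upwards [ae_restrict_mem measurableSet_Ioi] with t ht using hB t ht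
  -- vanishing of the moments
  have hmom : ∀ n : ℕ, ∫ t in Ioi (0 : ℝ), Real.exp (-t) ^ n * (Real.exp (-t) * φ t) = 0 :=
    fun n => by
      have hn : (0 : ℝ) ≤ n := n.cast_nonneg
      refine (setIntegral_congr_fun measurableSet_Ioi fun t _ => ?_).trans
        (hL (a + 2 + n) (by linarith))
      simp only [hφ]
      rw [← Real.exp_nat_mul, ← mul_assoc, ← mul_assoc, ← Real.exp_add, ← Real.exp_add]
      congr 2; ring
  have hpoly : ∀ p : Polynomial ℝ,
      ∫ t in Ioi (0 : ℝ), p.eval (Real.exp (-t)) * (Real.exp (-t) * φ t) = 0 := fun p => by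
    simp only [Polynomial.eval_eq_sum_range, Finset.sum_mul, mul_assoc]
    rw [integral_finsetSum]
    · refine Finset.sum_eq_zero fun i _ => ?_
      rw [integral_const_mul, hmom, mul_zero]
    · intro i _
      refine (hint (fun t => Real.exp (-t) ^ i) (by fun_prop) ⟨1, fun t ht => ?_⟩).const_mul _
      rw [abs_of_pos (by positivity)]
      exact pow_le_one₀ (Real.exp_pos _).le (by rw [Real.exp_le_one_iff]; linarith)
  -- the function `ψ(x) = φ(-log x)` extends continuously to `x = 0`
  set ψ : ℝ → ℝ := fun x => if x ≤ 0 then 0 else φ (-Real.log x) with hψ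
  have hψe : ∀ t, ψ (Real.exp (-t)) = φ t := fun t => by
    simp [hψ, not_le.2 (Real.exp_pos _)]
  have hψc : ContinuousOn ψ (Icc 0 1) := by
    intro x hx
    rcases hx.1.eq_or_lt with rfl | hx0
    · have h0 : ψ 0 = 0 := by simp [hψ]
      rw [ContinuousWithinAt, h0]
      refine squeeze_zero_norm' (a := fun x => C * x) ?_ ?_
      · filter_upwards [self_mem_nhdsWithin] with y hy
        rcases hy.1.eq_or_lt with rfl | hy0
        · simp [h0]
        · have h1 := hφb (-Real.log y) (by linarith [Real.log_nonpos hy.1 hy.2])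
          rw [neg_neg, Real.exp_log hy0] at h1
          simpa [hψ, not_le.2 hy0] using h1
      · have : Tendsto (fun x : ℝ => C * x) (𝓝 0) (𝓝 (C * 0)) :=
          (continuous_const.mul continuous_id).tendsto 0
        rw [mul_zero] at this
        exact this.mono_left nhdsWithin_le_nhds
    · have h1 : ContinuousOn (fun y => φ (-Real.log y)) (Ioc 0 1) :=
        hφc.comp (Real.continuousOn_log.mono fun y hy => (ne_of_gt hy.1)).neg
          fun y hy => by
            simp only [mem_Ici]; linarith [Real.log_nonpos hy.1.le hy.2]
      have h2 : ContinuousOn ψ (Ioc 0 1) := h1.congr fun y hy => by simp [hψ, not_le.2 hy.1]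
      refine (h2 x ⟨hx0, hx.2⟩).mono_of_mem_nhdsWithin ?_
      filter_upwards [self_mem_nhdsWithin, nhdsWithin_le_nhds (Ioi_mem_nhds hx0)] with y h3 h4
      exact ⟨h4, h3.2⟩
  have hφc' := hφc.mono (Ioi_subset_Ici_self (a := (0 : ℝ)))
  have hsq : ∫ t in Ioi (0 : ℝ), φ t * (Real.exp (-t) * φ t) = 0 := by
    have hle : ∀ ε > 0, |∫ t in Ioi (0 : ℝ), φ t * (Real.exp (-t) * φ t)| ≤ ε * C := by
      intro ε hε
      obtain ⟨p, hp⟩ := exists_polynomial_near_of_continuousOn 0 1 ψ hψc ε hε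
      have hpb : ∀ t, 0 < t → |φ t - p.eval (Real.exp (-t))| ≤ ε := fun t ht => by
        rw [← hψe t, abs_sub_comm]
        exact (hp _ ⟨(Real.exp_pos _).le, by rw [Real.exp_le_one_iff]; linarith⟩).le
      have hi1 := hint φ hφc' ⟨C, fun t ht => hφC t ht.le⟩
      have hi2 := hint (fun t => φ t - p.eval (Real.exp (-t)))
        (hφc'.sub (by fun_prop)) ⟨ε, hpb⟩
      have h1 : ∫ t in Ioi (0 : ℝ), φ t * (Real.exp (-t) * φ t) =
          ∫ t in Ioi (0 : ℝ), (φ t - p.eval (Real.exp (-t))) * (Real.exp (-t) * φ t) := by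
        have h2 := integral_sub hi1 hi2
        have h3 := hpoly p
        refine sub_eq_zero.1 (h2.symm.trans
          ((setIntegral_congr_fun measurableSet_Ioi fun t _ => ?_).trans h3))
        ring
      rw [h1, ← Real.norm_eq_abs]
      refine (norm_integral_le_of_norm_le (hexp.const_mul (ε * C)) ?_).trans ?_
      · filter_upwards [ae_restrict_mem measurableSet_Ioi] with t ht
        rw [norm_mul, norm_mul, Real.norm_of_nonneg (Real.exp_pos (-t)).le]
        calc _ ≤ ε * (Real.exp (-t) * C) := by
              gcongr
              · exact hpb t ht
              · exact hφC t (le_of_lt ht)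
          _ = _ := by ring
      · rw [integral_const_mul, integral_exp_neg_Ioi_zero, mul_one]
    refine abs_eq_zero.1 (le_antisymm (le_of_forall_pos_le_add fun ε hε => ?_) (abs_nonneg _))
    rw [zero_add]
    refine (hle (ε / (C + 1)) (by positivity)).trans ?_
    rw [div_mul_eq_mul_div, div_le_iff₀ (by positivity)]
    nlinarith
  have hi := hint φ hφc' ⟨C, fun t ht => hφC t ht.le⟩
  have hzero : ∀ t, 0 < t → φ t = 0 := by
    rw [setIntegral_eq_zero_iff_of_nonneg_ae ?_ hi] at hsq
    · have hcont : ContinuousOn (fun t => φ t * (Real.exp (-t) * φ t)) (Ioi 0) := by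
        have : Continuous fun t : ℝ => Real.exp (-t) := by fun_prop
        exact hφc'.mul (this.continuousOn.mul hφc')
      have := Measure.eqOn_of_ae_eq hsq hcont continuousOn_const
        (by rw [interior_Ioi]; exact subset_closure)
      intro t ht
      have h1 := this ht
      simp only [Pi.zero_apply, mul_eq_zero, (Real.exp_pos _).ne', false_or, or_self] at h1
      exact h1
    · refine Eventually.of_forall fun t => ?_
      have : φ t * (Real.exp (-t) * φ t) = Real.exp (-t) * φ t ^ 2 := by ring
      simp only [Pi.zero_apply]
      rw [this]; positivity
  have hh : EqOn h (fun _ => 0) (Ioi 0) := fun t ht => by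
    have := hzero t ht
    simpa [hφ, (Real.exp_pos _).ne'] using this
  have := hh.of_subset_closure hc continuousOn_const Ioi_subset_Ici_self
    (by rw [closure_Ioi])
  exact this ht

end

/-! ### Contour integration over a strip -/

lemma eq_of_exp_eq_exp_ofReal {w : ℂ} {a : ℝ} (hw : |w.im| ≤ Real.pi)
    (h : Complex.exp w = Complex.exp a) : w = a := by
  obtain ⟨n, hn⟩ := Complex.exp_eq_exp_iff_exists_int.1 h
  have him : w.im = n * (2 * Real.pi) := by rw [hn]; simp
  have hπ := Real.pi_pos
  have hn0 : n = 0 := by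
    rw [him, abs_mul, abs_of_pos (by positivity : 0 < 2 * Real.pi)] at hw
    have h1 : |(n : ℝ)| < 1 := by
      by_contra h2
      have := mul_le_mul_of_nonneg_right (not_lt.1 h2) (by positivity : 0 ≤ 2 * Real.pi)
      linarith
    exact Int.abs_lt_one_iff.1 (by exact_mod_cast h1)
  rw [hn, hn0]; simp

/-- Cauchy's theorem on the rectangles `[-R, R] × [-π, π]`, applied to
`(ψ(w) - ψ(a)) / (e^w - e^a)`: the singularity at `a` is removable, the constant `ψ(a)` cancels
between the two horizontal sides by the `2πi`-periodicity of `e^w`, and the left side contributes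
the value `ψ(a)`. -/
lemma tendsto_strip_integral {ψ : ℂ → ℂ} {L : ℝ} (hL : Real.pi < L)
    (hd : DifferentiableOn ℂ ψ {w | |w.im| < L}) {B M : ℝ}
    (hb : ∀ w : ℂ, |w.im| ≤ Real.pi → M ≤ |w.re| → ‖ψ w‖ ≤ B)
    (h0 : ∀ y : ℝ, |y| ≤ Real.pi →
      Tendsto (fun R : ℝ => ψ ((-R : ℝ) + y * Complex.I)) atTop (𝓝 0)) (a : ℝ) :
    Tendsto (fun R : ℝ => ∫ x in (-R)..R, (ψ (x + Real.pi * Complex.I) -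
      ψ (x - Real.pi * Complex.I)) / ((Real.exp x + Real.exp a : ℝ) : ℂ)) atTop
      (𝓝 (2 * Real.pi * Complex.I * (ψ a / (Real.exp a : ℂ)))) := by
  have hπ := Real.pi_pos
  set H : ℂ → ℂ := fun w => dslope ψ a w / dslope Complex.exp a w with hHdef
  set S : Set ℂ := {w | |w.im| < L}
  set T : Set ℂ := {w | |w.im| ≤ Real.pi}
  have hS : IsOpen S := isOpen_lt (continuous_abs.comp Complex.continuous_im) continuous_const
  have hTS : T ⊆ S := fun w (hw : |w.im| ≤ Real.pi) => lt_of_le_of_lt hw hL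
  have haS : S ∈ 𝓝 (a : ℂ) := hS.mem_nhds (by simp [S]; linarith)
  have hne : ∀ w ∈ T, dslope Complex.exp a w ≠ 0 := fun w hw => by
    by_cases hwa : w = a
    · rw [hwa, dslope_same, Complex.deriv_exp]; exact Complex.exp_ne_zero _
    · rw [dslope_of_ne _ hwa, slope_def_field]
      refine div_ne_zero (fun h => hwa ?_) (sub_ne_zero.2 hwa)
      exact eq_of_exp_eq_exp_ofReal hw (sub_eq_zero.1 h)
  have hHd : DifferentiableOn ℂ H T :=
    (((Complex.differentiableOn_dslope haS).2 hd).mono hTS).div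
      (((Complex.differentiableOn_dslope haS).2
        Complex.differentiable_exp.differentiableOn).mono hTS) hne
  have hHe : ∀ w : ℂ, w ≠ a → H w = (ψ w - ψ a) / (Complex.exp w - Complex.exp a) :=
    fun w hw => by
      simp only [hHdef]
      rw [dslope_of_ne _ hw, dslope_of_ne _ hw, slope_def_field, slope_def_field,
        div_div_div_cancel_right₀ (sub_ne_zero.2 hw)]
  have hexpa : Complex.exp a = (Real.exp a : ℂ) := (Complex.ofReal_exp a).symm
  -- the horizontal sides
  have hpm : ∀ x : ℝ, H (x - Real.pi * Complex.I) - H (x + Real.pi * Complex.I) =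
      (ψ (x + Real.pi * Complex.I) - ψ (x - Real.pi * Complex.I)) /
        ((Real.exp x + Real.exp a : ℝ) : ℂ) := fun x => by
    have n1 : (x - Real.pi * Complex.I : ℂ) ≠ a := fun h => by
      have := congrArg Complex.im h; simp at this
    have n2 : (x + Real.pi * Complex.I : ℂ) ≠ a := fun h => by
      have := congrArg Complex.im h; simp at this
    have e1 : Complex.exp (x - Real.pi * Complex.I) = -(Real.exp x : ℂ) := by
      rw [Complex.exp_sub, Complex.exp_pi_mul_I, Complex.ofReal_exp]; ring
    have e2 : Complex.exp (x + Real.pi * Complex.I) = -(Real.exp x : ℂ) := by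
      rw [Complex.exp_add, Complex.exp_pi_mul_I, Complex.ofReal_exp]; ring
    rw [hHe _ n1, hHe _ n2, e1, e2, hexpa]
    have hpos : ((Real.exp x + Real.exp a : ℝ) : ℂ) ≠ 0 := by
      exact_mod_cast (add_pos (Real.exp_pos x) (Real.exp_pos a)).ne'
    push_cast at hpos ⊢
    rw [show -Complex.exp (x : ℂ) - Complex.exp a = -(Complex.exp x + Complex.exp a) by ring,
      div_neg, div_neg, neg_sub_neg, ← sub_div]
    congr 1; ring
  have hHx : ∀ y : ℝ, |y| ≤ Real.pi → Continuous fun x : ℝ => H (x + y * Complex.I) := fun y hy =>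
    hHd.continuousOn.comp_continuous (by fun_prop) fun x => by simpa [T] using hy
  have hHy : ∀ x : ℝ, ContinuousOn (fun y : ℝ => H (x + y * Complex.I)) (Icc (-Real.pi) Real.pi) :=
    fun x => hHd.continuousOn.comp (by fun_prop) fun y hy => by
      simpa [T] using abs_le.2 hy
  have hrect : ∀ R : ℝ, (∫ x in (-R)..R, (ψ (x + Real.pi * Complex.I) -
      ψ (x - Real.pi * Complex.I)) / ((Real.exp x + Real.exp a : ℝ) : ℂ)) =
      Complex.I * (∫ y in (-Real.pi)..Real.pi, H ((-R : ℝ) + y * Complex.I)) -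
      Complex.I * (∫ y in (-Real.pi)..Real.pi, H ((R : ℝ) + y * Complex.I)) := fun R => by
    have h := Complex.integral_boundary_rect_eq_zero_of_differentiableOn H
      (⟨-R, -Real.pi⟩ : ℂ) (⟨R, Real.pi⟩ : ℂ) (hHd.mono fun w hw => by
        have := hw.2
        simp only [mem_preimage] at this
        rw [uIcc_of_le (by linarith)] at this
        exact abs_le.2 this)
    simp only [smul_eq_mul] at h
    have hm : ∀ x : ℝ, (x : ℂ) + ((-Real.pi : ℝ) : ℂ) * Complex.I = x - Real.pi * Complex.I :=
      fun x => by push_cast; ring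
    have c1 : IntervalIntegrable (fun x : ℝ => H (x - Real.pi * Complex.I)) volume (-R) R := by
      have := (hHx (-Real.pi) (by simp [abs_of_pos hπ])).intervalIntegrable (μ := volume) (-R) R
      simpa only [hm] using this
    have c2 : IntervalIntegrable (fun x : ℝ => H (x + Real.pi * Complex.I)) volume (-R) R :=
      (hHx Real.pi (abs_of_pos hπ).le).intervalIntegrable (-R) R
    simp only [hm] at h
    rw [← intervalIntegral.integral_sub c1 c2] at h
    simp only [hpm] at h
    linear_combination h
  simp only [hrect]
  -- the right side: the numerator is bounded and the denominator tends to infinity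
  have hright : Tendsto (fun R : ℝ => ∫ y in (-Real.pi)..Real.pi, H ((R : ℝ) + y * Complex.I))
      atTop (𝓝 0) := by
    have hlim : Tendsto (fun R : ℝ => (B + ‖ψ a‖) / (Real.exp R - Real.exp a) *
        |Real.pi - -Real.pi|) atTop (𝓝 0) := by
      have h1 : Tendsto (fun R : ℝ => Real.exp R - Real.exp a) atTop atTop :=
        tendsto_atTop_add_const_right _ _ Real.tendsto_exp_atTop
      simpa using (h1.const_div_atTop (B + ‖ψ a‖)).mul_const |Real.pi - -Real.pi|
    refine squeeze_zero_norm' ?_ hlim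
    filter_upwards [eventually_gt_atTop a, eventually_ge_atTop M] with R hRa hRM
    refine intervalIntegral.norm_integral_le_of_norm_le_const fun y hy => ?_
    rw [uIoc_of_le (by linarith)] at hy
    have hn : ((R : ℝ) + y * Complex.I : ℂ) ≠ a := fun h => by
      have := congrArg Complex.re h; simp at this; exact hRa.ne' this
    have hsub : 0 < Real.exp R - Real.exp a := sub_pos.2 (Real.exp_lt_exp.2 hRa)
    have hden : Real.exp R - Real.exp a ≤
        ‖Complex.exp (R + y * Complex.I) - Complex.exp a‖ := by
      have := norm_sub_norm_le (Complex.exp (R + y * Complex.I)) (Complex.exp a)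
      simpa [Complex.norm_exp] using this
    have hψ : ‖ψ (R + y * Complex.I)‖ ≤ B :=
      hb _ (by simpa using abs_le.2 ⟨hy.1.le, hy.2⟩) (by simpa using hRM.trans (le_abs_self R))
    rw [hHe _ hn, norm_div]
    gcongr
    · exact add_nonneg ((norm_nonneg _).trans hψ) (norm_nonneg _)
    · exact (norm_sub_le _ _).trans (by gcongr)
  -- the left side: `ψ` and `e^w` tend to `0`
  have hleft : Tendsto (fun R : ℝ => ∫ y in (-Real.pi)..Real.pi, H ((-R : ℝ) + y * Complex.I))
      atTop (𝓝 (∫ _ in (-Real.pi)..Real.pi, ψ a / (Real.exp a : ℂ))) := by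
    have hbig : ∀ᶠ R : ℝ in atTop, Real.exp (-R) ≤ Real.exp a / 2 :=
      (Real.tendsto_exp_neg_atTop_nhds_zero).eventually_le_const (by positivity)
    refine intervalIntegral.tendsto_integral_filter_of_dominated_convergence
      (fun _ => (B + ‖ψ a‖) / (Real.exp a / 2)) ?_ ?_ intervalIntegrable_const ?_
    · refine Eventually.of_forall fun R => ?_
      rw [uIoc_of_le (by linarith)]
      exact ((hHy (-R)).mono Ioc_subset_Icc_self).aestronglyMeasurable measurableSet_Ioc
    · filter_upwards [hbig, eventually_ge_atTop M, eventually_ge_atTop 0] with R hR hRM hR0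
      refine Eventually.of_forall fun y hy => ?_
      rw [uIoc_of_le (by linarith)] at hy
      have hn : (((-R : ℝ) : ℂ) + y * Complex.I) ≠ a := fun h => by
        have h1 := congrArg Complex.re h
        simp at h1
        have := Real.exp_pos a
        rw [h1] at hR; linarith
      have hden : Real.exp a / 2 ≤
          ‖Complex.exp (((-R : ℝ) : ℂ) + y * Complex.I) - Complex.exp a‖ := by
        have := norm_sub_norm_le (Complex.exp a) (Complex.exp (((-R : ℝ) : ℂ) + y * Complex.I))
        rw [norm_sub_rev] at this
        simp only [Complex.norm_exp, Complex.add_re, Complex.ofReal_re, Complex.re_ofReal_mul,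
          Complex.I_re, mul_zero, add_zero] at this
        linarith
      have hψ : ‖ψ (((-R : ℝ) : ℂ) + y * Complex.I)‖ ≤ B :=
        hb _ (by simpa using abs_le.2 ⟨hy.1.le, hy.2⟩) (by simpa using hRM.trans (le_abs_self R))
      rw [hHe _ hn, norm_div]
      have := Real.exp_pos a
      gcongr
      · exact add_nonneg ((norm_nonneg _).trans hψ) (norm_nonneg _)
      · exact (norm_sub_le _ _).trans (by gcongr)
    · refine Eventually.of_forall fun y hy => ?_
      rw [uIoc_of_le (by linarith)] at hy
      have hψ := h0 y (abs_le.2 ⟨hy.1.le, hy.2⟩)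
      have he : Tendsto (fun R : ℝ => Complex.exp (((-R : ℝ) : ℂ) + y * Complex.I)) atTop (𝓝 0) := by
        rw [tendsto_zero_iff_norm_tendsto_zero]
        simp only [Complex.norm_exp, Complex.add_re, Complex.ofReal_re, Complex.re_ofReal_mul,
          Complex.I_re, mul_zero, add_zero]
        exact Real.tendsto_exp_neg_atTop_nhds_zero
      have h1 := (hψ.sub_const (ψ a)).div (he.sub_const (Complex.exp a))
        (by simp [Complex.exp_ne_zero])
      rw [zero_sub, zero_sub, neg_div_neg_eq, hexpa] at h1
      refine h1.congr' ?_
      filter_upwards [hbig] with R hR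
      simp only [Pi.div_apply]
      rw [← hexpa]
      refine (hHe _ fun h => ?_).symm
      have h1 := congrArg Complex.re h
      simp at h1
      have := Real.exp_pos a
      rw [h1] at hR; linarith
  have h := (hleft.const_mul Complex.I).sub (hright.const_mul Complex.I)
  rw [mul_zero, sub_zero, intervalIntegral.integral_const, Complex.real_smul] at h
  convert h using 2
  push_cast; ring

/-! ### The Stieltjes transform of the spectral function -/

/-- The function `e^{βw} / (e^{βw} - u)`; for `u = -1` it is the symbol of the equation, and for
`β = 1` it is a `2πi`-periodic function with simple poles at the logarithms of `u`. -/
noncomputable def expQuot (β : ℝ) (u w : ℂ) : ℂ :=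
  Complex.exp (β * w) / (Complex.exp (β * w) - u)

lemma logSymbol_eq_expQuot (α : ℝ) (w : ℂ) : logSymbol α w = expQuot α (-1) w := by
  rw [logSymbol, expQuot, sub_neg_eq_add]

lemma norm_expQuot_le {β : ℝ} (hβ : 0 < β) {u w : ℂ} (hu : ‖u‖ = 1)
    (hw : Real.log 2 / β ≤ |w.re|) : ‖expQuot β u w‖ ≤ 2 := by
  have hn : ‖Complex.exp (β * w)‖ = Real.exp (β * w.re) := by
    rw [Complex.norm_exp, Complex.re_ofReal_mul]
  rw [div_le_iff₀ hβ] at hw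
  rw [expQuot, norm_div]
  have h1 := norm_sub_norm_le (Complex.exp (β * w)) u
  have h2 := norm_sub_norm_le u (Complex.exp (β * w))
  rw [norm_sub_rev] at h2
  rw [hn, hu] at h1 h2
  rw [hn]
  rcases le_or_gt 0 w.re with h | h
  · rw [abs_of_nonneg h] at hw
    have h3 : 2 ≤ Real.exp (β * w.re) := by
      rw [← Real.exp_log (two_pos : (0 : ℝ) < 2)]; gcongr; linarith
    rw [div_le_iff₀ (by linarith)]
    linarith
  · rw [abs_of_neg h] at hw
    have h3 : Real.exp (β * w.re) ≤ 1 / 2 := by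
      rw [one_div, ← Real.exp_log (two_pos : (0 : ℝ) < 2), ← Real.exp_neg]; gcongr; linarith
    rw [div_le_iff₀ (by linarith)]
    linarith

lemma tendsto_expQuot {β : ℝ} (hβ : 0 < β) {u : ℂ} (hu : ‖u‖ = 1) (y : ℝ) :
    Tendsto (fun R : ℝ => expQuot β u ((-R : ℝ) + y * Complex.I)) atTop (𝓝 0) := by
  have he : Tendsto (fun R : ℝ => Complex.exp (β * (((-R : ℝ) : ℂ) + y * Complex.I))) atTop
      (𝓝 0) := by
    rw [tendsto_zero_iff_norm_tendsto_zero]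
    simp only [Complex.norm_exp, Complex.add_re, Complex.ofReal_re, Complex.re_ofReal_mul,
      Complex.I_re, mul_zero, add_zero, mul_neg]
    exact Real.tendsto_exp_neg_atTop_nhds_zero.comp (tendsto_id.const_mul_atTop hβ)
  have hu0 : (0 : ℂ) - u ≠ 0 := by
    rw [zero_sub, neg_ne_zero, ← norm_ne_zero_iff, hu]; exact one_ne_zero
  have := he.div (he.sub_const u) hu0
  rw [zero_div] at this
  exact this

lemma differentiableAt_expQuot {β : ℝ} {u w : ℂ} (h : Complex.exp (β * w) ≠ u) :
    DifferentiableAt ℂ (expQuot β u) w := by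
  unfold expQuot
  exact DifferentiableAt.div (by fun_prop) (by fun_prop) (sub_ne_zero.2 h)

/-- The residue of `e^{βw} / (e^{βw} - u)` at a pole is `1 / β`. -/
lemma tendsto_residue_expQuot {β : ℝ} (hβ : β ≠ 0) {u c : ℂ} (hc : Complex.exp (β * c) = u) :
    Tendsto (fun z => (z - c) * expQuot β u z) (𝓝[≠] c) (𝓝 (1 / β)) := by
  have hu : u ≠ 0 := hc ▸ Complex.exp_ne_zero _
  have hβ' : (β : ℂ) ≠ 0 := by exact_mod_cast hβ
  have hd : HasDerivAt (fun z : ℂ => Complex.exp (β * z)) (u * (β * 1)) c := by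
    rw [← hc]; exact ((hasDerivAt_id c).const_mul (β : ℂ)).cexp
  have h1 := (hasDerivAt_iff_tendsto_slope.1 hd).inv₀ (by simp [hu, hβ'])
  have h2 : Tendsto (fun z : ℂ => Complex.exp (β * z)) (𝓝[≠] c) (𝓝 u) := by
    have := hd.continuousAt.tendsto
    rw [hc] at this
    exact this.mono_left nhdsWithin_le_nhds
  have h3 := h1.mul h2
  have e : (u * (β * 1))⁻¹ * u = 1 / β := by field_simp
  rw [e] at h3
  refine h3.congr fun z => ?_
  rw [slope_def_field, hc, inv_div, expQuot]
  ring

lemma exp_mul_eq_neg_one {α : ℝ} (hα : 0 < α) {w : ℂ} (h : Complex.exp (α * w) = -1) :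
    ∃ n : ℤ, w = ((2 * n + 1) * (Real.pi / α) : ℝ) * Complex.I := by
  rw [← Complex.exp_pi_mul_I] at h
  obtain ⟨n, hn⟩ := Complex.exp_eq_exp_iff_exists_int.1 h
  refine ⟨n, ?_⟩
  have hα' : (α : ℂ) ≠ 0 := by exact_mod_cast hα.ne'
  refine mul_left_cancel₀ hα' ?_
  rw [hn]
  push_cast
  field_simp
  ring

lemma logSymbol_conj (α x : ℝ) : logSymbol α (x - Real.pi * Complex.I) =
    (starRingEnd ℂ) (logSymbol α (x + Real.pi * Complex.I)) := by
  simp only [logSymbol, map_div₀, map_add, map_one, ← Complex.exp_conj, map_mul,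
    Complex.conj_ofReal, Complex.conj_I, mul_neg, sub_eq_add_neg]

section

variable {α : ℝ}

/-- The Stieltjes transform of `K_α`, given an analytic function `ψ` in the strip `|Im w| ≤ π`
with the same jump between the two boundary lines as the symbol. -/
lemma stieltjes_spectralK_of_jump (h0 : 0 < α) (h2 : α < 2) (h1 : α ≠ 1) {ψ : ℂ → ℂ} {L : ℝ}
    (hL : Real.pi < L) (hd : DifferentiableOn ℂ ψ {w | |w.im| < L}) {B M : ℝ}
    (hb : ∀ w : ℂ, |w.im| ≤ Real.pi → M ≤ |w.re| → ‖ψ w‖ ≤ B)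
    (hlim : ∀ y : ℝ, |y| ≤ Real.pi →
      Tendsto (fun R : ℝ => ψ ((-R : ℝ) + y * Complex.I)) atTop (𝓝 0))
    (hjump : ∀ x : ℝ, ψ (x + Real.pi * Complex.I) - ψ (x - Real.pi * Complex.I) =
      logSymbol α (x + Real.pi * Complex.I) - logSymbol α (x - Real.pi * Complex.I))
    {s : ℝ} (hs : 0 < s) :
    ((∫ r in Ioi (0 : ℝ), spectralK α r / (s + r) : ℝ) : ℂ) = ψ (Real.log s) / s := by
  have hπ := Real.pi_pos
  have hT := tendsto_strip_integral hL hd hb hlim (Real.log s)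
  rw [Real.exp_log hs] at hT
  set g : ℝ → ℝ := fun r => spectralK α r / (s + r) with hg
  have himage : Real.exp '' univ = Ioi 0 := by rw [image_univ, Real.range_exp]
  have hder : ∀ x ∈ (univ : Set ℝ), HasDerivWithinAt Real.exp (Real.exp x) univ x := fun x _ =>
    (Real.hasDerivAt_exp x).hasDerivWithinAt
  have hgi : IntegrableOn g (Ioi 0) := by
    have hK := integrableOn_spectralK h0 h2 h1
    have hm : AEStronglyMeasurable (fun r : ℝ => (s + r)⁻¹) (volume.restrict (Ioi 0)) :=
      (by fun_prop : Measurable fun r : ℝ => (s + r)⁻¹).aestronglyMeasurable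
    refine (Integrable.bdd_mul (c := s⁻¹) hK hm ?_).congr
      (Eventually.of_forall fun r => by simp only [hg]; rw [mul_comm, div_eq_mul_inv])
    filter_upwards [ae_restrict_mem measurableSet_Ioi] with r hr
    have hr : 0 < r := hr
    rw [Real.norm_of_nonneg (by positivity)]
    gcongr
    linarith
  have hint : Integrable fun x : ℝ => Real.exp x * g (Real.exp x) := by
    rw [← himage, integrableOn_image_iff_integrableOn_abs_deriv_smul MeasurableSet.univ hder
      Real.exp_injective.injOn, integrableOn_univ] at hgi
    simpa [abs_of_pos (Real.exp_pos _)] using hgi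
  have hval : ∫ r in Ioi (0 : ℝ), g r = ∫ x : ℝ, Real.exp x * g (Real.exp x) := by
    rw [← himage, integral_image_eq_integral_abs_deriv_smul MeasurableSet.univ hder
      Real.exp_injective.injOn, setIntegral_univ]
    simp [abs_of_pos (Real.exp_pos _)]
  have hI := intervalIntegral_tendsto_integral hint tendsto_neg_atTop_atBot tendsto_id
  rw [← hval] at hI
  have hcast := ((Complex.continuous_ofReal.tendsto _).comp hI).const_mul
    (2 * Real.pi * Complex.I)
  have heq := tendsto_nhds_unique hT (hcast.congr fun R => ?_)
  · have h2π : (2 * Real.pi * Complex.I : ℂ) ≠ 0 := by simp [hπ.ne', Complex.I_ne_zero]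
    exact (mul_left_cancel₀ h2π heq).symm
  · simp only [Function.comp_apply, id_eq]
    rw [← intervalIntegral.integral_ofReal, ← intervalIntegral.integral_const_mul]
    refine intervalIntegral.integral_congr fun x _ => ?_
    have hx := spectralK_eq_logSymbol α (Real.exp_pos x)
    rw [Real.log_exp] at hx
    simp only [hg]
    rw [hjump, logSymbol_conj, Complex.sub_conj, hx]
    have e1 : (Real.exp x : ℂ) ≠ 0 := by exact_mod_cast (Real.exp_pos x).ne'
    have e2 : ((s : ℂ) + (Real.exp x : ℂ)) ≠ 0 := by
      exact_mod_cast (add_pos hs (Real.exp_pos x)).ne'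
    have e3 : ((Real.exp x : ℂ) + (s : ℂ)) ≠ 0 := by rwa [add_comm]
    have e4 : (Real.pi : ℂ) ≠ 0 := by exact_mod_cast hπ.ne'
    push_cast [-Complex.ofReal_exp]
    field_simp
    ring

lemma logSymbol_log {s : ℝ} (hs : 0 < s) :
    logSymbol α (Real.log s) / s = ((s ^ (α - 1) / (s ^ α + 1) : ℝ) : ℂ) := by
  have h : Complex.exp (α * (Real.log s : ℂ)) = ((s ^ α : ℝ) : ℂ) := by
    rw [Real.rpow_def_of_pos hs]; push_cast; rw [mul_comm]
  rw [logSymbol, h, Real.rpow_sub hs, Real.rpow_one]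
  push_cast
  rw [div_right_comm]

lemma stieltjes_spectralK_of_lt_one (h0 : 0 < α) (h1 : α < 1) {s : ℝ} (hs : 0 < s) :
    ∫ r in Ioi (0 : ℝ), spectralK α r / (s + r) = s ^ (α - 1) / (s ^ α + 1) := by
  have hπ := Real.pi_pos
  have hun : ‖(-1 : ℂ)‖ = 1 := by simp
  have h := stieltjes_spectralK_of_jump h0 (by linarith) h1.ne (ψ := logSymbol α)
    (L := Real.pi / α) ((lt_div_iff₀ h0).2 (by nlinarith)) ?_ (B := 2) (M := Real.log 2 / α)
    (fun w _ hw => by rw [logSymbol_eq_expQuot]; exact norm_expQuot_le h0 hun hw)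
    (fun y _ => by simp only [logSymbol_eq_expQuot]; exact tendsto_expQuot h0 hun y)
    (fun x => rfl) hs
  · rw [logSymbol_log hs] at h
    exact Complex.ofReal_injective h
  · intro w hw
    have hw : |w.im| < Real.pi / α := hw
    rw [show logSymbol α = expQuot α (-1) from funext (logSymbol_eq_expQuot α)]
    refine (differentiableAt_expQuot fun h => ?_).differentiableWithinAt
    obtain ⟨n, rfl⟩ := exp_mul_eq_neg_one h0 h
    have hp : 0 < Real.pi / α := by positivity
    rw [Complex.im_ofReal_mul, Complex.I_im, mul_one, abs_mul, abs_of_pos hp] at hw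
    have h3 : |((2 * n + 1 : ℤ) : ℝ)| < 1 := by
      push_cast
      by_contra h4
      have := mul_le_mul_of_nonneg_right (not_lt.1 h4) hp.le
      linarith
    have h5 : |(2 * n + 1 : ℤ)| < 1 := by exact_mod_cast h3
    have := Int.abs_lt_one_iff.1 h5
    omega

lemma exists_removable {f : ℂ → ℂ} {S : Set ℂ} {c : ℂ} (hS : S ∈ 𝓝 c)
    (hd : DifferentiableOn ℂ f (S \ {c}))
    (h : Tendsto (fun z => (z - c) * f z) (𝓝[≠] c) (𝓝 0)) :
    ∃ g : ℂ → ℂ, DifferentiableOn ℂ g S ∧ ∀ z ≠ c, g z = f z := by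
  refine ⟨_, Complex.differentiableOn_update_limUnder_of_isLittleO hS hd ?_,
    fun z hz => Function.update_of_ne hz _ _⟩
  rw [Asymptotics.isLittleO_iff_tendsto']
  · have h1 : Tendsto (fun z => (z - c) * f c) (𝓝[≠] c) (𝓝 0) := by
      have : Tendsto (fun z => (z - c) * f c) (𝓝 c) (𝓝 ((c - c) * f c)) :=
        (by fun_prop : Continuous fun z => (z - c) * f c).tendsto c
      rw [sub_self, zero_mul] at this
      exact this.mono_left nhdsWithin_le_nhds
    have h2 := h.sub h1
    rw [sub_zero] at h2
    refine h2.congr fun z => ?_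
    rw [div_inv_eq_mul]; ring
  · filter_upwards [self_mem_nhdsWithin] with z hz h3
    exact absurd (inv_eq_zero.1 h3) (sub_ne_zero.2 hz)

/-- The symbol minus the `2πi`-periodic functions that have the same residue `1/α` at the poles
`p` and `-p`. -/
noncomputable def reducedSymbol (α : ℝ) (p w : ℂ) : ℂ :=
  expQuot α (-1) w - (1 / α) * (expQuot 1 (Complex.exp p) w + expQuot 1 (Complex.exp (-p)) w)

lemma reducedSymbol_neg (α : ℝ) (p w : ℂ) : reducedSymbol α (-p) w = reducedSymbol α p w := by
  rw [reducedSymbol, reducedSymbol, neg_neg, add_comm (expQuot 1 (Complex.exp (-p)) w)]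

lemma tendsto_residue_reducedSymbol (hα : α ≠ 0) {p : ℂ} (hp : Complex.exp (α * p) = -1)
    (hpp : Complex.exp p ≠ Complex.exp (-p)) :
    Tendsto (fun z => (z - p) * reducedSymbol α p z) (𝓝[≠] p) (𝓝 0) := by
  have h1 := tendsto_residue_expQuot hα hp
  have h2 := tendsto_residue_expQuot one_ne_zero (u := Complex.exp p) (c := p) (by simp)
  have h3 : Tendsto (fun z => (z - p) * expQuot 1 (Complex.exp (-p)) z) (𝓝[≠] p) (𝓝 0) := by
    have hc : ContinuousAt (expQuot 1 (Complex.exp (-p))) p :=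
      (differentiableAt_expQuot (by simpa using hpp)).continuousAt
    have h4 : Tendsto (fun z => (z - p) * expQuot 1 (Complex.exp (-p)) z) (𝓝 p)
        (𝓝 ((p - p) * expQuot 1 (Complex.exp (-p)) p)) :=
      ((continuous_id.sub continuous_const).tendsto p).mul hc.tendsto
    rw [sub_self, zero_mul] at h4
    exact h4.mono_left nhdsWithin_le_nhds
  have h5 := h1.sub ((h2.add h3).const_mul (1 / (α : ℂ)))
  have e : (1 / (α : ℂ)) - 1 / α * (1 / ((1 : ℝ) : ℂ) + 0) = 0 := by simp
  rw [e] at h5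
  refine h5.congr fun z => ?_
  rw [reducedSymbol]; ring

lemma exp_eq_exp_of_im_lt {θ L : ℝ} (hL : L ≤ 2 * Real.pi - |θ|) {w : ℂ}
    (hw : |w.im| < L) (h : Complex.exp w = Complex.exp (θ * Complex.I)) : w = θ * Complex.I := by
  obtain ⟨n, hn⟩ := Complex.exp_eq_exp_iff_exists_int.1 h
  have him : w.im = θ + n * (2 * Real.pi) := by rw [hn]; simp
  have hπ := Real.pi_pos
  have h1 : |(n : ℝ) * (2 * Real.pi)| < 2 * Real.pi := by
    have e : (n : ℝ) * (2 * Real.pi) = w.im - θ := by rw [him]; ring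
    rw [e]
    have := abs_sub w.im θ
    linarith
  rw [abs_mul, abs_of_pos (by positivity : 0 < 2 * Real.pi)] at h1
  have h2 : |(n : ℝ)| < 1 := by
    by_contra h3
    have := mul_le_mul_of_nonneg_right (not_lt.1 h3) (by positivity : 0 ≤ 2 * Real.pi)
    linarith
  have h3 : n = 0 := Int.abs_lt_one_iff.1 (by exact_mod_cast h2)
  rw [hn, h3]; simp

lemma stieltjes_spectralK_of_one_lt (h1 : 1 < α) (h2 : α < 2) {s : ℝ} (hs : 0 < s) :
    ∫ r in Ioi (0 : ℝ), spectralK α r / (s + r) = s ^ (α - 1) / (s ^ α + 1) -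
      (2 / α) * (1 / (s - Complex.exp ((Real.pi / α : ℝ) * Complex.I))).re := by
  have hπ := Real.pi_pos
  have h0 : 0 < α := by linarith
  set θ : ℝ := Real.pi / α with hθ
  have hθ0 : 0 < θ := by positivity
  have hθπ : θ < Real.pi := div_lt_self hπ h1
  have hαθ : α * θ = Real.pi := by rw [hθ]; field_simp
  have hθ2 : Real.pi < 3 * θ := by nlinarith
  have hun : ‖(-1 : ℂ)‖ = 1 := by simp
  set p : ℂ := θ * Complex.I with hp
  have hnp : -p = ((-θ : ℝ) : ℂ) * Complex.I := by rw [hp]; push_cast; ring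
  have hpi : p.im = θ := by simp [hp]
  have hp0 : p ≠ -p := fun h => by
    have := congrArg Complex.im h
    rw [Complex.neg_im, hpi] at this; linarith
  -- the next poles of the symbol have `|Im w| = 3θ`, those of the periodic functions `2π - θ`
  set L : ℝ := min (3 * θ) (2 * Real.pi - θ) with hLdef
  have hL : Real.pi < L := lt_min hθ2 (by linarith)
  set S : Set ℂ := {w | |w.im| < L} with hSdef
  have hSo : IsOpen S := isOpen_lt (continuous_abs.comp Complex.continuous_im) continuous_const
  have habs : |θ| = θ := abs_of_pos hθ0
  have hpS : p ∈ S := by show |p.im| < L; rw [hpi, habs]; linarith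
  have hnpS : -p ∈ S := by show |(-p).im| < L; rw [Complex.neg_im, hpi, abs_neg, habs]; linarith
  have hq1 : ∀ w ∈ S, Complex.exp w = Complex.exp p → w = p := fun w hw h =>
    exp_eq_exp_of_im_lt (by rw [habs]; exact min_le_right _ _) hw h
  have hq2 : ∀ w ∈ S, Complex.exp w = Complex.exp (-p) → w = -p := fun w hw h => by
    rw [hnp] at h ⊢
    exact exp_eq_exp_of_im_lt
      (by rw [abs_neg, habs]; exact min_le_right _ _) hw h
  have hq3 : ∀ w ∈ S, Complex.exp (α * w) = -1 → w = p ∨ w = -p := fun w hw h => by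
    obtain ⟨n, rfl⟩ := exp_mul_eq_neg_one h0 h
    have hw : |(((2 * n + 1) * (Real.pi / α) : ℝ) * Complex.I : ℂ).im| < L := hw
    rw [Complex.im_ofReal_mul, Complex.I_im, mul_one, abs_mul, ← hθ, habs] at hw
    have h3 : |((2 * n + 1 : ℤ) : ℝ)| < 3 := by
      push_cast
      have := hw.trans_le (min_le_left _ _)
      exact lt_of_mul_lt_mul_right this hθ0.le
    have h5 : |(2 * n + 1 : ℤ)| < 3 := by exact_mod_cast h3
    rw [abs_lt] at h5
    have h6 : n = 0 ∨ n = -1 := by omega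
    rcases h6 with rfl | rfl
    · left; simp [hp, hθ]
    · right; rw [hnp, ← hθ]; push_cast; ring
  have hpp : Complex.exp p ≠ Complex.exp (-p) := fun h => hp0 (hq2 p hpS h)
  have hep : Complex.exp (α * p) = -1 := by
    rw [hp, ← mul_assoc, ← Complex.ofReal_mul, hαθ, Complex.exp_pi_mul_I]
  have henp : Complex.exp (α * -p) = -1 := by
    rw [mul_neg, Complex.exp_neg, hep]; norm_num
  have hdiff : ∀ w ∈ S, w ≠ p → w ≠ -p → DifferentiableAt ℂ (reducedSymbol α p) w :=
    fun w hw w1 w2 => by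
      have d1 : DifferentiableAt ℂ (expQuot α (-1)) w := differentiableAt_expQuot fun h =>
        (hq3 w hw h).elim w1 w2
      have d2 : DifferentiableAt ℂ (expQuot 1 (Complex.exp p)) w := differentiableAt_expQuot
        fun h => w1 (hq1 w hw (by simpa using h))
      have d3 : DifferentiableAt ℂ (expQuot 1 (Complex.exp (-p))) w := differentiableAt_expQuot
        fun h => w2 (hq2 w hw (by simpa using h))
      exact d1.sub ((d2.add d3).const_mul _)
  obtain ⟨f, hf, hfe⟩ := exists_removable (S := S \ {-p}) (f := reducedSymbol α p)
    ((hSo.sdiff isClosed_singleton).mem_nhds ⟨hpS, hp0⟩)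
    (fun w hw => (hdiff w hw.1.1 hw.2 hw.1.2).differentiableWithinAt)
    (tendsto_residue_reducedSymbol h0.ne' hep hpp)
  obtain ⟨ψ, hψ, hψe⟩ := exists_removable (S := S) (f := f) (hSo.mem_nhds hnpS) hf (by
    have h3 := tendsto_residue_reducedSymbol h0.ne' henp (by rw [neg_neg]; exact hpp.symm)
    refine h3.congr' ?_
    have : ∀ᶠ z in 𝓝[≠] (-p), z ≠ p :=
      nhdsWithin_le_nhds (isOpen_ne.mem_nhds hp0.symm)
    filter_upwards [this] with z hz
    rw [hfe z hz, reducedSymbol_neg])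
  have hψr : ∀ w : ℂ, (w.re ≠ 0 ∨ |w.im| ≠ θ) → ψ w = reducedSymbol α p w := fun w hw => by
    have w1 : w ≠ p := by
      rintro rfl
      rcases hw with h | h
      · exact h (by simp [hp])
      · exact h (by rw [hpi, habs])
    have w2 : w ≠ -p := by
      rintro rfl
      rcases hw with h | h
      · exact h (by simp [hp])
      · exact h (by rw [Complex.neg_im, abs_neg, hpi, habs])
    rw [hψe w w2, hfe w w1]
  have hlog2 : 0 < Real.log 2 := Real.log_pos (by norm_num)
  have hu1 : ‖Complex.exp p‖ = 1 := Complex.norm_exp_ofReal_mul_I θ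
  have hu2 : ‖Complex.exp (-p)‖ = 1 := by rw [hnp]; exact Complex.norm_exp_ofReal_mul_I _
  have hper : ∀ (u : ℂ) (x : ℝ), expQuot 1 u (x + Real.pi * Complex.I) =
      expQuot 1 u (x - Real.pi * Complex.I) := fun u x => by
    simp only [expQuot, Complex.ofReal_one, one_mul, Complex.exp_add, Complex.exp_sub,
      Complex.exp_pi_mul_I, mul_neg, mul_one, div_neg, div_one]
  have h := stieltjes_spectralK_of_jump h0 h2 h1.ne' hL hψ (B := 2 + 1 / α * (2 + 2))
    (M := Real.log 2) (fun w _ hw => ?_) (fun y _ => ?_) (fun x => ?_) hs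
  · have hre : ψ (Real.log s) = reducedSymbol α p (Real.log s) :=
      hψr _ (Or.inr (by simp; exact hθ0.ne))
    have hconj : Complex.exp (-p) = (starRingEnd ℂ) (Complex.exp p) := by
      rw [← Complex.exp_conj]; simp [hp]
    have hnz : ∀ t : ℝ, t ∈ ({θ, -θ} : Set ℝ) → (s : ℂ) - Complex.exp (t * Complex.I) ≠ 0 := by
      intro t ht h3
      have h4 := congrArg Complex.im h3
      rw [Complex.sub_im, Complex.exp_ofReal_mul_I_im, Complex.ofReal_im, Complex.zero_im] at h4
      have h5 := Real.sin_pos_of_pos_of_lt_pi hθ0 hθπ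
      rcases ht with rfl | rfl
      · linarith
      · rw [Real.sin_neg] at h4; linarith
    have hq : ∀ u : ℂ, (s : ℂ) - u ≠ 0 → expQuot 1 u (Real.log s) / s = 1 / (s - u) :=
      fun u hu => by
        have hs' : (s : ℂ) ≠ 0 := by exact_mod_cast hs.ne'
        rw [expQuot, Complex.ofReal_one, one_mul, ← Complex.ofReal_exp, Real.exp_log hs]
        field_simp
    have n1 : (s : ℂ) - Complex.exp p ≠ 0 := hnz θ (Or.inl rfl)
    have n2 : (s : ℂ) - Complex.exp (-p) ≠ 0 := by rw [hnp]; exact hnz (-θ) (Or.inr rfl)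
    have hsum : 1 / ((s : ℂ) - Complex.exp p) + 1 / ((s : ℂ) - Complex.exp (-p)) =
        ((2 * (1 / ((s : ℂ) - Complex.exp p)).re : ℝ) : ℂ) := by
      rw [← Complex.add_conj, map_div₀, map_one, map_sub, Complex.conj_ofReal, hconj]
    rw [hre, reducedSymbol, sub_div, ← logSymbol_eq_expQuot, logSymbol_log hs, mul_div_assoc,
      add_div, hq _ n1, hq _ n2, hsum] at h
    have h' : (1 / (α : ℂ)) * ((2 * (1 / ((s : ℂ) - Complex.exp p)).re : ℝ) : ℂ) =
        (((2 / α) * (1 / ((s : ℂ) - Complex.exp p)).re : ℝ) : ℂ) := by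
      rw [Complex.ofReal_mul, Complex.ofReal_mul, Complex.ofReal_div]; push_cast; ring
    rw [h', ← Complex.ofReal_sub] at h
    exact Complex.ofReal_injective h
  · have hw0 : w.re ≠ 0 := by
      intro h3; rw [h3, abs_zero] at hw; linarith
    rw [hψr w (Or.inl hw0), reducedSymbol]
    have b1 : ‖expQuot α (-1) w‖ ≤ 2 := norm_expQuot_le h0 hun
      ((div_le_self hlog2.le h1.le).trans hw)
    have b2 := norm_expQuot_le one_pos hu1 (by rwa [div_one] : Real.log 2 / 1 ≤ |w.re|)
    have b3 := norm_expQuot_le one_pos hu2 (by rwa [div_one] : Real.log 2 / 1 ≤ |w.re|)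
    have hα1 : ‖(1 / α : ℂ)‖ = 1 / α := by
      rw [norm_div, norm_one, Complex.norm_real, Real.norm_of_nonneg h0.le]
    refine (norm_sub_le _ _).trans ?_
    rw [norm_mul, hα1]
    gcongr
    exact (norm_add_le _ _).trans (by gcongr)
  · have h3 := (tendsto_expQuot h0 hun y).sub
      (((tendsto_expQuot one_pos hu1 y).add (tendsto_expQuot one_pos hu2 y)).const_mul (1 / α : ℂ))
    rw [add_zero, mul_zero, sub_zero] at h3
    refine h3.congr' ?_
    filter_upwards [eventually_gt_atTop 0] with R hR
    rw [hψr _ (Or.inl (by simpa using hR.ne')), reducedSymbol]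
  · have i1 : |(x + Real.pi * Complex.I : ℂ).im| ≠ θ := by
      simp [abs_of_pos hπ]; exact hθπ.ne'
    have i2 : |(x - Real.pi * Complex.I : ℂ).im| ≠ θ := by
      simp [abs_of_pos hπ]; exact hθπ.ne'
    rw [hψr _ (Or.inr i1), hψr _ (Or.inr i2), reducedSymbol, reducedSymbol, hper, hper,
      logSymbol_eq_expQuot, logSymbol_eq_expQuot]
    ring

end

/-! ### Spectral representation of `e_α` -/

section

variable {α : ℝ}

lemma integrableOn_exp_mul_of_le {h : ℝ → ℝ} (hc : ContinuousOn h (Ici 0)) {C a s : ℝ}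
    (hb : ∀ t, 0 ≤ t → |h t| ≤ C * Real.exp (a * t)) (hs : a < s) :
    IntegrableOn (fun t => Real.exp (-(s * t)) * h t) (Ioi 0) := by
  have h1 : IntegrableOn (fun t : ℝ => C * Real.exp ((a - s) * t)) (Ioi 0) :=
    (integrableOn_exp_mul_Ioi (by linarith) 0).const_mul C
  have h2 : Continuous fun t : ℝ => Real.exp (-(s * t)) := by fun_prop
  refine Integrable.mono' h1 (h2.aestronglyMeasurable.mul
    ((hc.mono Ioi_subset_Ici_self).aestronglyMeasurable measurableSet_Ioi)) ?_
  filter_upwards [ae_restrict_mem measurableSet_Ioi] with t ht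
  rw [norm_mul, Real.norm_of_nonneg (Real.exp_pos _).le]
  calc Real.exp (-(s * t)) * ‖h t‖ ≤ Real.exp (-(s * t)) * (C * Real.exp (a * t)) := by
        gcongr; exact hb t (le_of_lt ht)
    _ = C * (Real.exp (-(s * t)) * Real.exp (a * t)) := by ring
    _ = _ := by rw [← Real.exp_add]; congr 2; ring

lemma abs_laplaceInt_le {K : ℝ → ℝ} (hK : IntegrableOn K (Ioi 0)) {t : ℝ} (ht : 0 ≤ t) :
    |laplaceInt K t| ≤ ∫ r in Ioi (0 : ℝ), ‖K r‖ := by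
  rw [← Real.norm_eq_abs]
  refine norm_integral_le_of_norm_le hK.norm ?_
  filter_upwards [ae_restrict_mem measurableSet_Ioi] with r hr using exp_mul_norm_le hr ht

/-- If the Laplace transforms agree, then `e_α` is the sum of `f_α` and a bounded continuous
function. -/
lemma eFun_eq_fFun_add (h0 : 0 < α) (h2 : α < 2) (h1 : α ≠ 1) {G : ℝ → ℝ} (hG : Continuous G)
    {C : ℝ} (hGb : ∀ t, 0 ≤ t → |G t| ≤ C)
    (hL : ∀ s, 0 < s → ∫ r in Ioi (0 : ℝ), spectralK α r / (s + r) =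
      s ^ (α - 1) / (s ^ α + 1) - ∫ t in Ioi (0 : ℝ), Real.exp (-(s * t)) * G t)
    {t : ℝ} (ht : 0 ≤ t) : eFun α t = fFun α t + G t := by
  set a : ℝ := 2 ^ (1 / α)
  have ha : 1 ≤ a := Real.one_le_rpow (by norm_num) (by positivity)
  have hK := integrableOn_spectralK h0 h2 h1
  set D := ∫ r in Ioi (0 : ℝ), ‖spectralK α r‖
  have hexp : ∀ t, 0 ≤ t → 1 ≤ Real.exp (a * t) := fun t ht => Real.one_le_exp (by positivity)
  have be : ∀ t, 0 ≤ t → |eFun α t| ≤ 2 * Real.exp (a * t) := fun t ht => abs_eFun_le h0 ht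
  have hD : 0 ≤ D := integral_nonneg fun r => norm_nonneg _
  have hC : 0 ≤ C := (abs_nonneg _).trans (hGb 0 le_rfl)
  have bf : ∀ t, 0 ≤ t → |fFun α t| ≤ D * Real.exp (a * t) := fun t ht =>
    (abs_laplaceInt_le hK ht).trans (le_mul_of_one_le_right hD (hexp t ht))
  have bG : ∀ t, 0 ≤ t → |G t| ≤ C * Real.exp (a * t) := fun t ht =>
    (hGb t ht).trans (le_mul_of_one_le_right hC (hexp t ht))
  have ce := (eFun_continuous h0).continuousOn (s := Ici 0)
  have cf : ContinuousOn (fFun α) (Ici 0) := continuousOn_laplaceInt hK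
  have cG := hG.continuousOn (s := Ici 0)
  have key := eq_zero_of_laplace_eq_zero (h := fun t => eFun α t - fFun α t - G t)
    ((ce.sub cf).sub cG) (C := 2 + D + C) (a := a) (fun t ht => ?_) (fun s hs => ?_) ht
  · linarith
  · have e1 := be t ht
    have e2 := bf t ht
    have e3 := bG t ht
    have e4 := (abs_sub (eFun α t - fFun α t) (G t)).trans
      (add_le_add_left (abs_sub (eFun α t) (fFun α t)) _)
    linarith
  · have i1 := integrableOn_exp_mul_of_le ce be hs
    have i2 := integrableOn_exp_mul_of_le cf bf hs
    have i3 := integrableOn_exp_mul_of_le cG bG hs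
    have hs0 : 0 < s := by linarith
    simp only [mul_sub]
    have i12 : IntegrableOn (fun t => Real.exp (-(s * t)) * eFun α t -
        Real.exp (-(s * t)) * fFun α t) (Ioi 0) := i1.sub i2
    rw [integral_sub i12 i3, integral_sub i1 i2, laplace_eFun h0 (by linarith), fFun,
      laplace_laplaceInt hK hs0, hL s hs0]
    ring

lemma eFun_eq_fFun (h0 : 0 < α) (h1 : α < 1) {t : ℝ} (ht : 0 ≤ t) : eFun α t = fFun α t := by
  have := eFun_eq_fFun_add h0 (by linarith) h1.ne (G := fun _ => 0) continuous_const (C := 0)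
    (by simp) (fun s hs => by simpa using stieltjes_spectralK_of_lt_one h0 h1 hs) ht
  simpa using this

lemma cos_pi_div_neg (h1 : 1 < α) (h2 : α < 2) : Real.cos (Real.pi / α) < 0 := by
  have hπ := Real.pi_pos
  refine Real.cos_neg_of_pi_div_two_lt_of_lt (div_lt_div_of_pos_left hπ (by linarith) h2) ?_
  have := div_lt_self hπ h1
  linarith

lemma sin_pi_div_pos (h1 : 1 < α) : 0 < Real.sin (Real.pi / α) :=
  Real.sin_pos_of_pos_of_lt_pi (div_pos Real.pi_pos (by linarith)) (div_lt_self Real.pi_pos h1)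

lemma gFun_eq_re (α t : ℝ) : gFun α t =
    (2 / α) * (Complex.exp (Complex.exp ((Real.pi / α : ℝ) * Complex.I) * t)).re := by
  rw [gFun, Complex.exp_re, mul_assoc, Complex.re_mul_ofReal, Complex.im_mul_ofReal,
    Complex.exp_ofReal_mul_I_re, Complex.exp_ofReal_mul_I_im, mul_comm t, mul_comm t]

lemma abs_gFun_le (h1 : 1 < α) (h2 : α < 2) {t : ℝ} (ht : 0 ≤ t) : |gFun α t| ≤ 2 / α := by
  have h0 : 0 < α := by linarith
  rw [gFun, abs_mul, abs_mul, abs_of_pos (by positivity : 0 < 2 / α), abs_of_pos (Real.exp_pos _)]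
  have e1 : Real.exp (t * Real.cos (Real.pi / α)) ≤ 1 := by
    rw [Real.exp_le_one_iff]
    exact mul_nonpos_of_nonneg_of_nonpos ht (cos_pi_div_neg h1 h2).le
  calc 2 / α * Real.exp (t * Real.cos (Real.pi / α)) * |Real.cos (t * Real.sin (Real.pi / α))|
      ≤ 2 / α * 1 * 1 := by gcongr; exact Real.abs_cos_le_one _
    _ = _ := by ring

lemma laplace_gFun (h1 : 1 < α) (h2 : α < 2) {s : ℝ} (hs : 0 < s) :
    ∫ t in Ioi (0 : ℝ), Real.exp (-(s * t)) * gFun α t =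
      (2 / α) * (1 / (s - Complex.exp ((Real.pi / α : ℝ) * Complex.I))).re := by
  set z := Complex.exp ((Real.pi / α : ℝ) * Complex.I) with hz
  have hre : (z - s).re < 0 := by
    rw [Complex.sub_re, Complex.ofReal_re, hz, Complex.exp_ofReal_mul_I_re]
    linarith [cos_pi_div_neg h1 h2]
  have hi := integrableOn_exp_mul_complex_Ioi hre 0
  have hv := integral_exp_mul_complex_Ioi hre 0
  have e : ∀ t : ℝ, Real.exp (-(s * t)) * gFun α t =
      (2 / α) * (Complex.exp ((z - s) * t)).re := fun t => by
    rw [gFun_eq_re, ← hz, sub_mul, sub_eq_add_neg, Complex.exp_add]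
    rw [show -((s : ℂ) * t) = ((-(s * t) : ℝ) : ℂ) by push_cast; ring, ← Complex.ofReal_exp,
      Complex.re_mul_ofReal]
    ring
  simp only [e]
  rw [integral_const_mul]
  congr 1
  have h3 : ∫ t in Ioi (0 : ℝ), (Complex.exp ((z - s) * t)).re =
      (∫ t in Ioi (0 : ℝ), Complex.exp ((z - s) * t)).re := integral_re hi
  rw [h3, hv]
  simp only [Complex.ofReal_zero, mul_zero, Complex.exp_zero]
  rw [← neg_sub (s : ℂ) z, neg_div_neg_eq]

lemma gFun_continuous (α : ℝ) : Continuous (gFun α) := by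
  unfold gFun; fun_prop

lemma eFun_eq_fFun_add_gFun (h1 : 1 < α) (h2 : α < 2) {t : ℝ} (ht : 0 ≤ t) :
    eFun α t = fFun α t + gFun α t :=
  eFun_eq_fFun_add (by linarith) h2 h1.ne' (gFun_continuous α)
    (fun _ ht => abs_gFun_le h1 h2 ht)
    (fun s hs => by rw [laplace_gFun h1 h2 hs]; exact stieltjes_spectralK_of_one_lt h1 h2 hs) ht

/-! ### The impulse response and the second fundamental solution -/

/-- The function `(2/α) e^{t cos(π/α)} cos(t sin(π/α) + φ)`: the oscillatory part of the
fundamental solutions, with a phase. -/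
noncomputable def phaseFun (α φ t : ℝ) : ℝ :=
  (2 / α) * Real.exp (t * Real.cos (Real.pi / α)) * Real.cos (t * Real.sin (Real.pi / α) + φ)

lemma gFun_eq_phaseFun (α t : ℝ) : gFun α t = phaseFun α 0 t := by
  rw [gFun, phaseFun, add_zero]

lemma hasDerivAt_phaseFun (α φ t : ℝ) :
    HasDerivAt (phaseFun α φ) (phaseFun α (φ + Real.pi / α) t) t := by
  have h1 := (((hasDerivAt_id t).mul_const (Real.cos (Real.pi / α))).exp).const_mul (2 / α)
  have h2 := (((hasDerivAt_id t).mul_const (Real.sin (Real.pi / α))).add_const φ).cos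
  have h3 := h1.mul h2
  refine h3.congr_deriv ?_
  simp only [id]
  rw [phaseFun, ← add_assoc, Real.cos_add _ (Real.pi / α)]
  ring

lemma laplaceConverges_spectralK (h0 : 0 < α) (h2 : α < 2) (h1 : α ≠ 1) {t : ℝ} (ht : 0 ≤ t) :
    LaplaceConverges (spectralK α) t :=
  laplaceConverges_of_integrable (integrableOn_spectralK h0 h2 h1) ht

lemma laplaceInt_neg (K : ℝ → ℝ) (t : ℝ) : laplaceInt (fun r => -K r) t = -laplaceInt K t := by
  simp only [laplaceInt, mul_neg, integral_neg]

lemma laplaceConverges_spectralKk_neg_one (h0 : 0 < α) (h2 : α < 2) (h1 : α ≠ 1) {t : ℝ}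
    (ht : 0 < t) : LaplaceConverges (spectralKk α (-1)) t := by
  have h := (LaplaceConverges.mul_self (fun t ht => laplaceConverges_spectralK h0 h2 h1 (le_of_lt ht))
    ht).neg
  refine h.congr (Eventually.of_forall fun r => ?_)
  simp [spectralKk_neg_one]

lemma hasDerivAt_fFun (h0 : 0 < α) (h2 : α < 2) (h1 : α ≠ 1) {t : ℝ} (ht : 0 < t) :
    HasDerivAt (fFun α) (laplaceInt (spectralKk α (-1)) t) t := by
  have h := hasDerivAt_laplaceInt
    (fun t ht => laplaceConverges_spectralK h0 h2 h1 (le_of_lt ht)) ht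
  refine h.congr_deriv ?_
  rw [← laplaceInt_neg]
  congr 1; ext r; rw [spectralKk_neg_one]

lemma impulseSol_of_lt_one (h0 : 0 < α) (h1 : α < 1) {t : ℝ} (ht : 0 < t) :
    impulseSol α t = -laplaceInt (spectralKk α (-1)) t := by
  have h : HasDerivAt (eFun α) (laplaceInt (spectralKk α (-1)) t) t := by
    refine (hasDerivAt_fFun h0 (by linarith) h1.ne ht).congr_of_eventuallyEq ?_
    filter_upwards [Ioi_mem_nhds ht] with s hs using eFun_eq_fFun h0 h1 (le_of_lt hs)
  rw [impulseSol, fundSol_zero, h.deriv]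

lemma impulseSol_of_one_lt (h1 : 1 < α) (h2 : α < 2) {t : ℝ} (ht : 0 < t) :
    impulseSol α t = -laplaceInt (spectralKk α (-1)) t - phaseFun α (Real.pi / α) t := by
  have h : HasDerivAt (eFun α)
      (laplaceInt (spectralKk α (-1)) t + phaseFun α (0 + Real.pi / α) t) t := by
    refine ((hasDerivAt_fFun (by linarith) h2 h1.ne' ht).add
      (hasDerivAt_phaseFun α 0 t)).congr_of_eventuallyEq ?_
    filter_upwards [Ioi_mem_nhds ht] with s hs
    rw [eFun_eq_fFun_add_gFun h1 h2 (le_of_lt hs), gFun_eq_phaseFun]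
    rfl
  rw [impulseSol, fundSol_zero, h.deriv, zero_add]
  ring

/-- The limit `s → 0` of the Stieltjes transform; it says that the spectral formula for `u_1`
vanishes at the origin. -/
lemma integral_spectralKk_one (h1 : 1 < α) (h2 : α < 2) :
    ∫ r in Ioi (0 : ℝ), spectralKk α 1 r = -((2 / α) * Real.cos (Real.pi / α)) := by
  have h0 : 0 < α := by linarith
  have hK := integrableOn_spectralKk_one h1 h2
  set z := Complex.exp ((Real.pi / α : ℝ) * Complex.I) with hz
  -- dominated convergence, as `|K_α(r)| / (s + r) ≤ |K_α(r)| / r`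
  have hL : Tendsto (fun s : ℝ => ∫ r in Ioi (0 : ℝ), spectralK α r / (s + r)) (𝓝[>] 0)
      (𝓝 (∫ r in Ioi (0 : ℝ), -spectralKk α 1 r)) := by
    refine tendsto_integral_filter_of_dominated_convergence (fun r => ‖spectralKk α 1 r‖)
      ?_ ?_ hK.norm ?_
    · refine Eventually.of_forall fun s => ?_
      exact (integrableOn_spectralK h0 h2 h1.ne').aestronglyMeasurable.mul
        (by fun_prop : Measurable fun r : ℝ => (s + r)⁻¹).aestronglyMeasurable
    · filter_upwards [self_mem_nhdsWithin] with s hs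
      have hs : 0 < s := hs
      filter_upwards [ae_restrict_mem measurableSet_Ioi] with r hr
      have hr : 0 < r := hr
      rw [spectralKk_one, norm_neg, norm_mul, norm_div, Real.rpow_neg_one, norm_inv,
        ← div_eq_inv_mul, Real.norm_of_nonneg hr.le, Real.norm_of_nonneg (add_pos hs hr).le]
      gcongr
      linarith
    · filter_upwards [ae_restrict_mem measurableSet_Ioi] with r hr
      have hr : 0 < r := hr
      have h3 : Tendsto (fun s : ℝ => spectralK α r / (s + r)) (𝓝 0)
          (𝓝 (spectralK α r / (0 + r))) :=
        tendsto_const_nhds.div ((continuous_id.add continuous_const).tendsto 0) (by simpa using hr.ne')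
      rw [spectralKk_one, neg_neg, Real.rpow_neg_one, ← div_eq_inv_mul]
      rw [zero_add] at h3
      exact h3.mono_left nhdsWithin_le_nhds
  have hR : Tendsto (fun s : ℝ => s ^ (α - 1) / (s ^ α + 1) - (2 / α) * (1 / (s - z)).re) (𝓝[>] 0)
      (𝓝 ((0 : ℝ) ^ (α - 1) / ((0 : ℝ) ^ α + 1) - (2 / α) * (1 / ((0 : ℝ) - z)).re)) := by
    have c1 : Tendsto (fun s : ℝ => s ^ (α - 1)) (𝓝 0) (𝓝 ((0 : ℝ) ^ (α - 1))) :=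
      (Real.continuous_rpow_const (by linarith)).tendsto 0
    have c2 : Tendsto (fun s : ℝ => s ^ α + 1) (𝓝 0) (𝓝 ((0 : ℝ) ^ α + 1)) :=
      ((Real.continuous_rpow_const h0.le).add continuous_const).tendsto 0
    have c3 : Tendsto (fun s : ℝ => (1 / ((s : ℂ) - z))) (𝓝 0) (𝓝 (1 / (((0 : ℝ) : ℂ) - z))) :=
      tendsto_const_nhds.div ((Complex.continuous_ofReal.sub continuous_const).tendsto 0)
        (by simp [hz, Complex.exp_ne_zero])
    have c4 := (Complex.continuous_re.tendsto _).comp c3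
    have c5 := (c1.div c2 (by rw [Real.zero_rpow h0.ne']; norm_num)).sub (c4.const_mul (2 / α))
    exact c5.mono_left nhdsWithin_le_nhds
  have heq := tendsto_nhds_unique hL (hR.congr' (by
    filter_upwards [self_mem_nhdsWithin] with s hs
    exact (stieltjes_spectralK_of_one_lt h1 h2 hs).symm))
  have hzre : (1 / (((0 : ℝ) : ℂ) - z)).re = -Real.cos (Real.pi / α) := by
    have : 1 / (((0 : ℝ) : ℂ) - z) = -Complex.exp (((-(Real.pi / α) : ℝ) : ℂ) * Complex.I) := by
      rw [Complex.ofReal_zero, zero_sub, one_div, inv_neg, hz, ← Complex.exp_neg]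
      push_cast; ring_nf
    rw [this, Complex.neg_re, Complex.exp_ofReal_mul_I_re, Real.cos_neg]
  rw [hzre, Real.zero_rpow (by linarith : α - 1 ≠ 0), zero_div, integral_neg] at heq
  linarith

lemma hasDerivAt_laplaceInt_spectralKk_one (h1 : 1 < α) (h2 : α < 2) {t : ℝ} (ht : 0 < t) :
    HasDerivAt (laplaceInt (spectralKk α 1)) (fFun α t) t := by
  have hK := integrableOn_spectralKk_one h1 h2
  refine (hasDerivAt_laplaceInt (fun t ht => laplaceConverges_of_integrable hK (le_of_lt ht))
    ht).congr_deriv ?_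
  rw [← laplaceInt_neg, fFun]
  refine setIntegral_congr_fun measurableSet_Ioi fun r hr => ?_
  have hr : 0 < r := hr
  beta_reduce
  rw [spectralKk_one, Real.rpow_neg_one]
  field_simp

lemma fundSol_one_eq (h1 : 1 < α) (h2 : α < 2) {t : ℝ} (ht : 0 ≤ t) :
    fundSol α 1 t = laplaceInt (spectralKk α 1) t + phaseFun α (-(Real.pi / α)) t := by
  have h0 : 0 < α := by linarith
  have hK := integrableOn_spectralKk_one h1 h2
  set D : ℝ → ℝ := fun t =>
    fundSol α 1 t - (laplaceInt (spectralKk α 1) t + phaseFun α (-(Real.pi / α)) t)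
  have hcont : ContinuousOn D (Ici 0) :=
    (fundSol_continuousOn h0 1).sub ((continuousOn_laplaceInt hK).add
      (fun x _ => (hasDerivAt_phaseFun α _ x).continuousAt.continuousWithinAt))
  have hD0 : D 0 = 0 := by
    have e1 : fundSol α 1 0 = 0 := rlIntegral_at_zero (by norm_num) _
    have e2 : laplaceInt (spectralKk α 1) 0 = -((2 / α) * Real.cos (Real.pi / α)) := by
      rw [← integral_spectralKk_one h1 h2, laplaceInt]
      simp
    simp only [D]
    rw [e1, e2, phaseFun]
    simp
  have hderiv : ∀ x, 0 < x → HasDerivAt D 0 x := fun x hx => by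
    have d1 := (hasDerivWithinAt_fundSol_one h0 hx.le).hasDerivAt (Ici_mem_nhds hx)
    have d2 := hasDerivAt_laplaceInt_spectralKk_one h1 h2 hx
    have d3 := hasDerivAt_phaseFun α (-(Real.pi / α)) x
    rw [neg_add_cancel, ← gFun_eq_phaseFun] at d3
    refine (d1.sub (d2.add d3)).congr_deriv ?_
    rw [eFun_eq_fFun_add_gFun h1 h2 hx.le, sub_self]
  rcases ht.eq_or_lt with rfl | ht
  · exact sub_eq_zero.1 hD0
  · obtain ⟨x, hx, hx'⟩ := exists_hasDerivAt_eq_slope D (fun _ => 0) ht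
      (hcont.mono Icc_subset_Ici_self) fun x hx => hderiv x hx.1
    rw [hD0, sub_zero, sub_zero, eq_comm, div_eq_zero_iff] at hx'
    exact sub_eq_zero.1 (hx'.resolve_right ht.ne')

end

/-! ### Behaviour at the origin and explicit forms of the solution -/

section

variable {α : ℝ}

lemma tendsto_fundSol_zero (h0 : 0 < α) : Tendsto (fundSol α 0) (𝓝[>] 0) (𝓝 1) := by
  have := (eFun_continuous h0).tendsto 0
  rw [eFun_zero h0, ← fundSol_zero] at this
  exact this.mono_left nhdsWithin_le_nhds

lemma tendsto_impulseSol_atTop (h0 : 0 < α) (h1 : α < 1) :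
    Tendsto (impulseSol α) (𝓝[>] 0) atTop := by
  refine (tendsto_mlKernel_atTop h0 h0 h1).congr' ?_
  filter_upwards [self_mem_nhdsWithin] with t ht using (impulseSol_eq_mlKernel h0 ht).symm

lemma tendsto_impulseSol_zero (h1 : 1 < α) : Tendsto (impulseSol α) (𝓝[>] 0) (𝓝 0) := by
  have h0 : 0 < α := by linarith
  refine (tendsto_mlKernel_zero h0 h1).congr' ?_
  filter_upwards [self_mem_nhdsWithin] with t ht using (impulseSol_eq_mlKernel h0 ht).symm

lemma tendsto_deriv_fundSol_zero (h1 : 1 < α) :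
    Tendsto (deriv (fundSol α 0)) (𝓝[>] 0) (𝓝 0) := by
  have := (tendsto_impulseSol_zero h1).neg
  rw [neg_zero] at this
  exact this.congr fun t => by rw [impulseSol, neg_neg]

lemma tendsto_deriv_impulseSol (h1 : 1 < α) (h2 : α < 2) :
    Tendsto (deriv (impulseSol α)) (𝓝[>] 0) atTop := by
  have h0 : 0 < α := by linarith
  refine (tendsto_mlKernel_atTop h0 (sub_pos.2 h1) (by linarith)).congr' ?_
  filter_upwards [self_mem_nhdsWithin] with t ht
  have h := hasDerivAt_mlKernel h0 (sub_pos.2 h1) ht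
  rw [sub_add_cancel] at h
  refine (HasDerivAt.deriv (h.congr_of_eventuallyEq ?_)).symm
  filter_upwards [Ioi_mem_nhds ht] with s hs using impulseSol_eq_mlKernel h0 hs

lemma tendsto_fundSol_one (h0 : 0 < α) : Tendsto (fundSol α 1) (𝓝[>] 0) (𝓝 0) := by
  have h := fundSol_continuousOn h0 1 0 self_mem_Ici
  have e : fundSol α 1 0 = 0 := rlIntegral_at_zero (by norm_num) _
  rw [ContinuousWithinAt, e] at h
  exact h.mono_left (nhdsWithin_mono _ Ioi_subset_Ici_self)

lemma tendsto_deriv_fundSol_one (h0 : 0 < α) :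
    Tendsto (deriv (fundSol α 1)) (𝓝[>] 0) (𝓝 1) := by
  have h := tendsto_fundSol_zero h0
  rw [fundSol_zero] at h
  refine h.congr' ?_
  filter_upwards [self_mem_nhdsWithin] with t ht
  exact ((hasDerivWithinAt_fundSol_one h0 (le_of_lt ht)).hasDerivAt (Ici_mem_nhds ht)).deriv.symm

lemma IsSolution.eq_sum_add_integral_impulseSol {c : ℕ → ℝ} {q u : ℝ → ℝ} (h0 : 0 < α)
    (hq : ContinuousOn q (Ici 0)) (hu : IsSolution α c q u) {t : ℝ} (ht : 0 ≤ t) :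
    u t = ∑ k ∈ Finset.range ⌈α⌉₊, c k * fundSol α k t +
      ∫ τ in (0 : ℝ)..t, q (t - τ) * impulseSol α τ := by
  rw [eq_of_isSolution h0 hq hu (isSolution_solFormula h0 hq c) ht, solFormula]
  simp only [impulseSol, mul_neg, intervalIntegral.integral_neg, sub_eq_add_neg]

lemma fundSol_two_one {t : ℝ} : fundSol 2 1 t = Real.sin t := by
  rw [fundSol, Nat.cast_one, rlIntegral_one]
  simp only [eFun_two, integral_cos, Real.sin_zero, sub_zero]

end

end FracRelax

open FracRelax
theorem mainTheorem2 :
    -- the solution formula, for every order `α > 0`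
    (∀ α : ℝ, 0 < α →
      (∀ t, 0 ≤ t → Summable fun n : ℕ => (-(t ^ α)) ^ n / Real.Gamma (α * n + 1)) ∧
      DifferentiableOn ℝ (eFun α) (Ioi 0) ∧
      ∀ q : ℝ → ℝ, ContinuousOn q (Ici 0) → ∀ c : ℕ → ℝ,
        (∀ t, 0 ≤ t → IntervalIntegrable
          (fun τ => q (t - τ) * deriv (fundSol α 0) τ) volume 0 t) ∧
        IsSolution α c q (solFormula α c q) ∧
        ∀ u : ℝ → ℝ, IsSolution α c q u → ∀ t, 0 ≤ t → u t = solFormula α c q t) ∧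
    -- the elementary cases `α = 1, 2`
    (∀ t, 0 ≤ t → fundSol 1 0 t = Real.exp (-t) ∧
      fundSol 2 0 t = Real.cos t ∧ fundSol 2 1 t = Real.sin t) ∧
    -- the spectral function
    (∀ α : ℝ, 0 < α → α < 2 → α ≠ 1 → ∀ r : ℝ, 0 < r →
      (r ^ α - 1) ^ 2 < r ^ (2 * α) + 2 * r ^ α * Real.cos (α * Real.pi) + 1 ∧
      spectralK α r = (1 / Real.pi) * (r ^ (α - 1) * Real.sin (α * Real.pi) /
        (r ^ (2 * α) + 2 * r ^ α * Real.cos (α * Real.pi) + 1))) ∧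
    -- (a) fractional relaxation
    (∀ α : ℝ, 0 < α → α < 1 →
      (∀ r, 0 < r → 0 < spectralK α r) ∧
      (∀ t, 0 ≤ t → LaplaceConverges (spectralK α) t ∧ eFun α t = fFun α t) ∧
      CompletelyMonotone (fFun α) ∧ CompletelyMonotone (eFun α) ∧
      StrictAntiOn (fFun α) (Ici 0) ∧ (∀ t, 0 ≤ t → 0 < fFun α t) ∧
      Tendsto (fFun α) atTop (𝓝 0) ∧
      (∀ q : ℝ → ℝ, ContinuousOn q (Ici 0) → ∀ c : ℕ → ℝ, ∀ u : ℝ → ℝ,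
        IsSolution α c q u → ∀ t, 0 ≤ t →
          u t = c 0 * fundSol α 0 t + ∫ τ in (0 : ℝ)..t, q (t - τ) * impulseSol α τ) ∧
      (∀ t, 0 ≤ t → LaplaceConverges (spectralKk α 0) t ∧
        fundSol α 0 t = laplaceInt (spectralKk α 0) t) ∧
      (∀ t, 0 < t → LaplaceConverges (spectralKk α (-1)) t ∧
        impulseSol α t = -laplaceInt (spectralKk α (-1)) t) ∧
      Tendsto (fundSol α 0) (𝓝[>] 0) (𝓝 1) ∧
      Tendsto (impulseSol α) (𝓝[>] 0) atTop) ∧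
    -- (b) fractional oscillation
    (∀ α : ℝ, 1 < α → α < 2 →
      (∀ r, 0 < r → spectralK α r < 0) ∧
      (∀ t, 0 ≤ t → LaplaceConverges (spectralK α) t ∧ eFun α t = fFun α t + gFun α t) ∧
      CompletelyMonotone (fun t => -fFun α t) ∧
      StrictMonoOn (fFun α) (Ici 0) ∧ (∀ t, 0 ≤ t → fFun α t < 0) ∧
      Tendsto (fFun α) atTop (𝓝 0) ∧
      Real.cos (Real.pi / α) < 0 ∧ 0 < Real.sin (Real.pi / α) ∧
      (∀ q : ℝ → ℝ, ContinuousOn q (Ici 0) → ∀ c : ℕ → ℝ, ∀ u : ℝ → ℝ,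
        IsSolution α c q u → ∀ t, 0 ≤ t →
          u t = c 0 * fundSol α 0 t + c 1 * fundSol α 1 t +
            ∫ τ in (0 : ℝ)..t, q (t - τ) * impulseSol α τ) ∧
      (∀ t, 0 ≤ t → LaplaceConverges (spectralKk α 0) t ∧
        fundSol α 0 t = laplaceInt (spectralKk α 0) t +
          (2 / α) * Real.exp (t * Real.cos (Real.pi / α)) *
            Real.cos (t * Real.sin (Real.pi / α))) ∧
      (∀ t, 0 ≤ t → LaplaceConverges (spectralKk α 1) t ∧
        fundSol α 1 t = laplaceInt (spectralKk α 1) t +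
          (2 / α) * Real.exp (t * Real.cos (Real.pi / α)) *
            Real.cos (t * Real.sin (Real.pi / α) - Real.pi / α)) ∧
      (∀ t, 0 < t → LaplaceConverges (spectralKk α (-1)) t ∧
        impulseSol α t = -laplaceInt (spectralKk α (-1)) t -
          (2 / α) * Real.exp (t * Real.cos (Real.pi / α)) *
            Real.cos (t * Real.sin (Real.pi / α) + Real.pi / α)) ∧
      Tendsto (fundSol α 0) (𝓝[>] 0) (𝓝 1) ∧
      Tendsto (deriv (fundSol α 0)) (𝓝[>] 0) (𝓝 0) ∧
      Tendsto (fundSol α 1) (𝓝[>] 0) (𝓝 0) ∧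
      Tendsto (deriv (fundSol α 1)) (𝓝[>] 0) (𝓝 1) ∧
      Tendsto (impulseSol α) (𝓝[>] 0) (𝓝 0) ∧
      Tendsto (deriv (impulseSol α)) (𝓝[>] 0) atTop) := by
  refine ⟨fun α h0 => ⟨fun t _ => summable_pow_div_Gamma h0 one_pos _,
      fun t ht => (hasDerivAt_eFun h0 ht).differentiableAt.differentiableWithinAt,
      fun q hq c => ⟨fun t ht => intervalIntegrable_solFormula h0 hq ht,
        isSolution_solFormula h0 hq c,
        fun u hu t ht => eq_of_isSolution h0 hq hu (isSolution_solFormula h0 hq c) ht⟩⟩,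
    fun t _ => ⟨by rw [fundSol_zero, eFun_one], by rw [fundSol_zero, eFun_two], fundSol_two_one⟩,
    fun α h0 h2 h1 r hr => ⟨sq_lt_spectral_denom h0 h2 h1 hr, spectralK_eq α hr⟩,
    fun α h0 h1 => ?_, fun α h1 h2 => ?_⟩
  · have h2 : α < 2 := by linarith
    have hK := integrableOn_spectralK h0 h2 h1.ne
    have hceil : ⌈α⌉₊ = 1 := (Nat.ceil_eq_iff one_ne_zero).2 ⟨by simpa using h0, by simpa using h1.le⟩
    have hcm : CompletelyMonotone (fFun α) := completelyMonotone_laplaceInt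
      (fun t ht => laplaceConverges_spectralK h0 h2 h1.ne (le_of_lt ht))
      fun r hr => (spectralK_pos h0 h1 hr).le
    refine ⟨fun r hr => spectralK_pos h0 h1 hr,
      fun t ht => ⟨laplaceConverges_spectralK h0 h2 h1.ne ht, eFun_eq_fFun h0 h1 ht⟩,
      hcm, hcm.congr fun t ht => eFun_eq_fFun h0 h1 (le_of_lt ht),
      strictAntiOn_laplaceInt hK fun r hr => spectralK_pos h0 h1 hr,
      fun t ht => laplaceInt_pos hK (fun r hr => spectralK_pos h0 h1 hr) ht,
      tendsto_laplaceInt_atTop hK, fun q hq c u hu t ht => ?_, fun t ht => ?_,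
      fun t ht => ⟨laplaceConverges_spectralKk_neg_one h0 h2 h1.ne ht, impulseSol_of_lt_one h0 h1 ht⟩,
      tendsto_fundSol_zero h0, tendsto_impulseSol_atTop h0 h1⟩
    · rw [hu.eq_sum_add_integral_impulseSol h0 hq ht, hceil, Finset.sum_range_one]
    · rw [spectralKk_zero, fundSol_zero]
      exact ⟨laplaceConverges_spectralK h0 h2 h1.ne ht, eFun_eq_fFun h0 h1 ht⟩
  · have h0 : 0 < α := by linarith
    have hK := integrableOn_spectralK h0 h2 h1.ne'
    have hneg : (fun t => -fFun α t) = laplaceInt fun r => -spectralK α r :=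
      funext fun t => (laplaceInt_neg _ t).symm
    have hpos : ∀ r, 0 < r → 0 < -spectralK α r := fun r hr => neg_pos.2 (spectralK_neg h1 h2 hr)
    have hceil : ⌈α⌉₊ = 2 := (Nat.ceil_eq_iff two_ne_zero).2
      ⟨by norm_num; exact h1, by norm_num; exact h2.le⟩
    refine ⟨fun r hr => spectralK_neg h1 h2 hr,
      fun t ht => ⟨laplaceConverges_spectralK h0 h2 h1.ne' ht, eFun_eq_fFun_add_gFun h1 h2 ht⟩,
      ?_, ?_, fun t ht => ?_, tendsto_laplaceInt_atTop hK, cos_pi_div_neg h1 h2, sin_pi_div_pos h1,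
      fun q hq c u hu t ht => ?_, fun t ht => ?_, fun t ht => ?_, fun t ht => ?_,
      tendsto_fundSol_zero h0, tendsto_deriv_fundSol_zero h1, tendsto_fundSol_one h0,
      tendsto_deriv_fundSol_one h0, tendsto_impulseSol_zero h1, tendsto_deriv_impulseSol h1 h2⟩
    · rw [hneg]
      exact completelyMonotone_laplaceInt
        (fun t ht => laplaceConverges_of_integrable hK.neg (le_of_lt ht))
        fun r hr => (hpos r hr).le
    · have h := strictAntiOn_laplaceInt hK.neg hpos
      intro a ha b hb hab
      have h3 : laplaceInt (fun r => -spectralK α r) b < laplaceInt (fun r => -spectralK α r) a :=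
        h ha hb hab
      rw [laplaceInt_neg, laplaceInt_neg] at h3
      exact neg_lt_neg_iff.1 h3
    · have h3 : 0 < laplaceInt (fun r => -spectralK α r) t := laplaceInt_pos hK.neg hpos ht
      rw [laplaceInt_neg] at h3
      exact neg_pos.1 h3
    · rw [hu.eq_sum_add_integral_impulseSol h0 hq ht, hceil, Finset.sum_range_succ,
        Finset.sum_range_one]
    · rw [spectralKk_zero, fundSol_zero]
      exact ⟨laplaceConverges_spectralK h0 h2 h1.ne' ht, eFun_eq_fFun_add_gFun h1 h2 ht⟩
    · refine ⟨laplaceConverges_of_integrable (integrableOn_spectralKk_one h1 h2) ht, ?_⟩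
      rw [fundSol_one_eq h1 h2 ht, phaseFun, sub_eq_add_neg (t * _)]
    · exact ⟨laplaceConverges_spectralKk_neg_one h0 h2 h1.ne' ht, impulseSol_of_one_lt h1 h2 ht⟩
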